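/- Let $d\ge 1$. For $n\in\mathbb N=\{1,2,\dots\}$ let $\mathcal S_n=n^{-1}\mathbb Z^d\subset\mathbb R^d$ with the Euclidean norm $|\cdot|$, let $B(x,r)=\{z\in\mathcal S_n:|z-x|<r\}$, and let $C^n(x,y)=C^n(y,x)\ge 0$ be conductances on $\{(x,y)\in\mathcal S_n\times\mathcal S_n: x\ne y\}$ (put $C^n(x,x)=0$). Assume: (A1) there are $c,c'>0$, independent of $n$, with $c\le\sum_{y\in\mathcal S_n}C^n(x,y)\le c'$ for all $n$ and all $x\in\mathcal S_n$; (A2) there are $M_0\ge1$ and $\delta>0$, independent of $n$, such that for all $n$ and all $x,y\in\mathcal S_n$ with $|x-y|=n^{-1}$ there are $N\ge2$ and $x_1,\dots,x_N\in B(x,n^{-1}M_0)$ with $x_1=x$, $x_N=y$ and $C^n(x_i,x_{i+1})\ge\delta$ for $1\le i\le N-1$; (A3) there is $\varphi:[0,\infty)\to[0,\infty)$ with $\int_0^\infty(1\wedge s^2)s^{d-1}\varphi(s)\,ds<\infty$ and $C^n(x,y)\le n^{-(d+2)}\varphi(|x-y|)$ for all $n$ and all $x\neq y$ in $\mathcal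 S_n$; moreover $$\sup_{n}\sup_{x\in\mathcal S_n} n^2\sum_{y\in\mathcal S_n}(1\wedge|x-y|^2)\,C^n(x,y)<\infty .$$ Let $Y^{(n)}$ be the continuous time Markov chain on $\mathcal S_n$ with right continuous paths and generator $\mathcal A^nf(x)=n^2\sum_{y\in\mathcal S_n}(f(y)-f(x))C^n(x,y)$, let $\mathbb P^x$ be its law when started at $x$, and let $\tau_A=\inf\{t\ge0:Y^{(n)}_t\notin A\}$. Proposition 4.2. There exist $c_1>0$ and $\theta\in(0,1)$ such that for all $n\in\mathbb N$, all $t\in(n^{-1},1]$, all $x,y,x_0\in\mathcal S_n$ with $|x-x_0|\le t^{1/2}$ and $|y-x_0|\le t^{1/2}$, and all $r\ge t^{1/2}/\theta$, $$\mathbb P^x\bigl(Y^{(n)}_t=y,\ \tau_{B(x_0,r)}>t\bigr)\ \ge\ c_1\,t^{-d/2}\,n^{-d}.$$ -/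

import Mathlib

open MeasureTheory
open scoped NNReal ENNReal

/-- The scaled lattice `S_n = n⁻¹ ℤ^d` inside Euclidean space `ℝ^d` (used for `n ≥ 1`). As a type it
carries the Euclidean distance, the induced topology (which is discrete) and the induced
`σ`-algebra (all subsets). -/
def ScaledLattice (d n : ℕ) : Set (EuclideanSpace ℝ (Fin d)) :=
  {x | ∃ k : Fin d → ℤ, ∀ i, x i = (k i : ℝ) / (n : ℝ)}

/-- A family of conductances: symmetric nonnegative functions `C n` on pairs of distinct points of
`S_n`, extended by `0` to the diagonal. -/
structure IsConductanceFamily {d : ℕ} (C : ∀ n : ℕ, ScaledLattice d n → ScaledLattice d n → ℝ) :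
    Prop where
  nonneg : ∀ n, 1 ≤ n → ∀ x y, 0 ≤ C n x y
  symm : ∀ n, 1 ≤ n → ∀ x y, C n x y = C n y x
  diag : ∀ n, 1 ≤ n → ∀ x, C n x x = 0

/-- The total conductance `ν^n_x = ∑_y C^n(x,y)` is bounded above and below by positive constants,
uniformly in `x` and `n`. -/
def TotalConductanceBounded {d : ℕ}
    (C : ∀ n : ℕ, ScaledLattice d n → ScaledLattice d n → ℝ) : Prop :=
  ∃ c₁ c₂ : ℝ, 0 < c₁ ∧ 0 < c₂ ∧ ∀ n : ℕ, 1 ≤ n → ∀ x : ScaledLattice d n,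
    Summable (C n x) ∧ c₁ ≤ ∑' y, C n x y ∧ ∑' y, C n x y ≤ c₂

/-- Nearest neighbours `x, y` of `S_n` are joined by a path `z 1 = x, …, z N = y` inside the open
ball of radius `M₀ / n` about `x` whose steps have conductance at least `δ`. -/
def NeighboursConnected {d : ℕ}
    (C : ∀ n : ℕ, ScaledLattice d n → ScaledLattice d n → ℝ) : Prop :=
  ∃ M₀ δ : ℝ, 1 ≤ M₀ ∧ 0 < δ ∧ ∀ n : ℕ, 1 ≤ n → ∀ x y : ScaledLattice d n,
    dist x y = 1 / (n : ℝ) →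
      ∃ (N : ℕ) (z : ℕ → ScaledLattice d n), 2 ≤ N ∧ z 1 = x ∧ z N = y ∧
        (∀ i, 1 ≤ i → i ≤ N → dist x (z i) < M₀ / (n : ℝ)) ∧
        (∀ i, 1 ≤ i → i < N → δ ≤ C n (z i) (z (i + 1)))

/-- `C^n(x,y) ≤ n^{-(d+2)} φ(|x-y|)` for a function `φ : [0,∞) → [0,∞)` with
`∫_0^∞ (1 ∧ s²) s^{d-1} φ(s) ds < ∞`. -/
def DominatedByProfile {d : ℕ}
    (C : ∀ n : ℕ, ScaledLattice d n → ScaledLattice d n → ℝ) : Prop :=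
  ∃ φ : ℝ → ℝ, (∀ s, 0 ≤ s → 0 ≤ φ s) ∧
    (∀ n : ℕ, 1 ≤ n → ∀ x y : ScaledLattice d n,
      x ≠ y → C n x y ≤ ((n : ℝ) ^ (d + 2))⁻¹ * φ (dist x y)) ∧
    IntegrableOn (fun s : ℝ => min 1 (s ^ 2) * s ^ (d - 1) * φ s) (Set.Ioi 0) volume

/-- `sup_n sup_x n² ∑_y (1 ∧ |x-y|²) C^n(x,y) < ∞`. -/
def TruncatedSecondMomentBounded {d : ℕ}
    (C : ∀ n : ℕ, ScaledLattice d n → ScaledLattice d n → ℝ) : Prop :=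
  ∃ M : ℝ, ∀ n : ℕ, 1 ≤ n → ∀ x : ScaledLattice d n,
    Summable (fun y => min 1 (dist x y ^ 2) * C n x y) ∧
    (n : ℝ) ^ 2 * ∑' y, min 1 (dist x y ^ 2) * C n x y ≤ M

/-- The generator `(A f)(x) = ∑_y (f(y) - f(x)) C(x,y) n²`. -/
noncomputable def generator {d n : ℕ} (C : ScaledLattice d n → ScaledLattice d n → ℝ)
    (f : ScaledLattice d n → ℝ) : ScaledLattice d n → ℝ :=
  fun x => ∑' y, (f y - f x) * C x y * (n : ℝ) ^ 2

/-- The transition probabilities `P_t(x,{y}) = (e^{tA} 1_{y})(x) = ∑_k t^k / k! (A^k 1_{y})(x)`.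
If the total conductances are bounded then `A` is bounded on bounded functions, and the
exponential series converges absolutely. -/
noncomputable def transitionProb {d n : ℕ} (C : ScaledLattice d n → ScaledLattice d n → ℝ)
    (t : ℝ) (x y : ScaledLattice d n) : ℝ :=
  ∑' k : ℕ, t ^ k / (k.factorial : ℝ) * ((generator C)^[k] (Set.indicator {y} (fun _ => 1))) x

/-- Under `P`, the process `Y` is the continuous time Markov chain on `S_n` with generator
`generator C`, started at `x`: it has right continuous paths, and its finite dimensional
distributions are those of the Markov chain with transition probabilities `e^{tA}`. -/
structure IsMarkovChainFrom {d n : ℕ} (C : ScaledLattice d n → ScaledLattice d n → ℝ)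
    (x : ScaledLattice d n) {Ω : Type*} [MeasurableSpace Ω] (P : Measure Ω)
    (Y : ℝ≥0 → Ω → ScaledLattice d n) : Prop where
  isProbabilityMeasure : IsProbabilityMeasure P
  measurable : ∀ t, Measurable (Y t)
  rightContinuous : ∀ ω t, ContinuousWithinAt (fun s => Y s ω) (Set.Ici t) t
  finiteDimensional : ∀ (m : ℕ) (s : ℕ → ℝ≥0) (z : ℕ → ScaledLattice d n),
    Monotone s → s 0 = 0 → z 0 = x →
      P.real {ω | ∀ i ≤ m, Y (s i) ω = z i} =
        ∏ i ∈ Finset.range m, transitionProb C ((s (i + 1) : ℝ) - (s i : ℝ)) (z i) (z (i + 1))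

/-- The exit time `τ_A = inf {t ≥ 0 : Y_t ∉ A}`, with value `∞` if `Y` never leaves `A`. -/
noncomputable def exitTime {S Ω : Type*} (Y : ℝ≥0 → Ω → S) (A : Set S) (ω : Ω) : ℝ≥0∞ :=
  ⨅ (t : ℝ≥0) (_ : Y t ω ∉ A), (t : ℝ≥0∞)

/-!
The proof passes to the integer lattice and works at the diffusive scale `ℓ = ⌈n √t⌉`, at which
`n² t` is comparable to `ℓ²`.

The second moment bound shows that the jumps longer than a fixed multiple of `√t` occur at rate
`O(1 / t)`, so with probability bounded below none of them occurs before time `t`. The chain without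
these jumps, killed outside a cube of radius of order `ℓ`, has a finite generator, and its heat kernel
is a matrix exponential. The transition probabilities dominate it up to a constant factor
(`exp_killedGenerator_le_transitionProb`), and multiplying such bounds along the dyadic fractions of
`t` gives a lower bound for the probability of being at `y` at time `t` without having left the ball,
because the paths are right continuous (`IsMarkovChainFrom.le_measureReal_exitTime`). It remains to
bound the killed heat kernel from below by a multiple of `ℓ ^ (-d)`
(`exists_killed_heat_kernel_ge`).

For this, Nash's method is followed, in an elementary form. Let `u` be the killed heat kernel started
at a point of the cube of radius `ℓ`.

* The Nash inequality `nash_latticeBox` gives the decay `∑ u² ≤ C s ^ (-d / 2)`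
  (`exists_sum_sq_le`).
* Most of the mass stays in a cube of radius `κ ℓ` (`exists_mass_ge`): the loss of mass through a
  conical cutoff is controlled by the entropy production of `∑ u ^ (1 + ε)`, and this entropy is
  controlled by the `ℓ²` decay. Together, the two facts force `u ≥ h ℓ ^ (-d)` on a positive fraction
  of the cube `Q` of radius `κ ℓ` (`exists_card_large_ge`).
* Let `G = ∑ ψ² log (ℓ ^ d u + η)` with a cutoff `ψ` that is `1` on `Q`. Its derivative is at least the
  energy of the logarithm minus a constant multiple of `|Q| / ℓ²`. By the Poincaré inequality on `Q`,
  the energy is at least of the order of `G² / (|Q| ℓ²)` as long as `G / |Q|` is very negative, since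
  the logarithm is bounded below on a positive fraction of `Q`. The Riccati inequality
  `riccati_lower_bound` then bounds `G / |Q|` from below after a time of order `ℓ²`. The layer in which
  `ψ` is neither `0` nor `1` takes part with a factor `log η`, but occupies at most a twelfth of the
  volume of `Q`, so if `η` is small enough it follows that `u < η ℓ ^ (-d)` on at most a third of `Q`
  (`exists_card_small_le`).
* The rows of the kernel at `x` and at `y` are then both at least `η ℓ ^ (-d)` on a common third of
  `Q`, and the semigroup property and symmetry give the bound at twice the time.
-/

/-! ### Poincaré and Nash inequalities on lattice cubes -/

/-- The cube of sup-norm radius `m` about `x` in `ℤ^d`. -/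
noncomputable def latticeBox {d : ℕ} (x : Fin d → ℤ) (m : ℕ) : Finset (Fin d → ℤ) :=
  Finset.Icc (fun i => x i - m) (fun i => x i + m)

lemma mem_latticeBox {d : ℕ} {x z : Fin d → ℤ} {m : ℕ} :
    z ∈ latticeBox x m ↔ ∀ i, x i - m ≤ z i ∧ z i ≤ x i + m := by
  simp [latticeBox, Finset.mem_Icc, Pi.le_def, forall_and]

lemma mem_latticeBox_iff_norm {d : ℕ} {x z : Fin d → ℤ} {m : ℕ} :
    z ∈ latticeBox x m ↔ ‖z - x‖ ≤ (m : ℝ) := by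
  rw [mem_latticeBox, pi_norm_le_iff_of_nonneg (Nat.cast_nonneg m)]
  refine forall_congr' fun i => ?_
  rw [Pi.sub_apply, Int.norm_eq_abs, ← Int.cast_abs, show ((m : ℕ) : ℝ) = ((m : ℤ) : ℝ) by simp,
    Int.cast_le, abs_le]
  constructor <;> rintro ⟨h1, h2⟩ <;> constructor <;> linarith

lemma card_latticeBox {d : ℕ} (x : Fin d → ℤ) (m : ℕ) :
    (latticeBox x m).card = (2 * m + 1) ^ d := by
  have h : ∀ i : Fin d, ((x i + m + 1 - (x i - m)).toNat) = 2 * m + 1 := fun i => by omega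
  simp [latticeBox, Pi.card_Icc, h]

lemma latticeBox_mono {d : ℕ} (x : Fin d → ℤ) {m m' : ℕ} (h : m ≤ m') :
    latticeBox x m ⊆ latticeBox x m' := by
  intro z hz
  rw [mem_latticeBox_iff_norm] at hz ⊢
  exact hz.trans (by exact_mod_cast h)

lemma mem_latticeBox_trans {d : ℕ} {x y z : Fin d → ℤ} {m m' k : ℕ}
    (hy : y ∈ latticeBox x m) (hz : z ∈ latticeBox y m') (h : m + m' ≤ k) :
    z ∈ latticeBox x k := by
  rw [mem_latticeBox_iff_norm] at *
  have h' : (m : ℝ) + m' ≤ k := by exact_mod_cast h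
  calc ‖z - x‖ = ‖(z - y) + (y - x)‖ := by congr 1; abel
    _ ≤ ‖z - y‖ + ‖y - x‖ := norm_add_le _ _
    _ ≤ k := by linarith

/-- The nearest neighbour Dirichlet energy of `f` on the edges with both end points in `Q`. -/
noncomputable def gradEnergy {d : ℕ} (Q : Finset (Fin d → ℤ)) (f : (Fin d → ℤ) → ℝ) : ℝ :=
  ∑ i, ∑ z ∈ Q with z + Pi.single i 1 ∈ Q, (f (z + Pi.single i 1) - f z) ^ 2

lemma gradEnergy_nonneg {d : ℕ} (Q : Finset (Fin d → ℤ)) (f : (Fin d → ℤ) → ℝ) :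
    0 ≤ gradEnergy Q f :=
  Finset.sum_nonneg fun _ _ => Finset.sum_nonneg fun _ _ => sq_nonneg _

/-- A translation by a unit step costs at most the Dirichlet energy, also along an injective image
of the index set. -/
lemma sum_unit_step_le_gradEnergy {d : ℕ} {Q S : Finset (Fin d → ℤ)} (f : (Fin d → ℤ) → ℝ)
    (g : Fin d → ℤ) (i : Fin d) (hS : ∀ a ∈ S, a + g ∈ Q ∧ a + g + Pi.single i 1 ∈ Q) :
    ∑ a ∈ S, (f (a + g + Pi.single i 1) - f (a + g)) ^ 2 ≤ gradEnergy Q f := by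
  calc ∑ a ∈ S, (f (a + g + Pi.single i 1) - f (a + g)) ^ 2
      = ∑ z ∈ S.image (· + g), (f (z + Pi.single i 1) - f z) ^ 2 := by
        rw [Finset.sum_image]
        intro a _ b _ h
        exact add_right_cancel h
    _ ≤ ∑ z ∈ Q with z + Pi.single i 1 ∈ Q, (f (z + Pi.single i 1) - f z) ^ 2 := by
        refine Finset.sum_le_sum_of_subset_of_nonneg ?_ fun _ _ _ => sq_nonneg _
        intro z hz
        obtain ⟨a, ha, rfl⟩ := Finset.mem_image.1 hz
        simpa using hS a ha
    _ ≤ gradEnergy Q f := by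
        have hnn : ∀ j ∈ (Finset.univ : Finset (Fin d)),
            0 ≤ ∑ z ∈ Q with z + Pi.single j 1 ∈ Q, (f (z + Pi.single j 1) - f z) ^ 2 :=
          fun _ _ => Finset.sum_nonneg fun _ _ => sq_nonneg _
        exact Finset.single_le_sum hnn (Finset.mem_univ i)

/-- A translation by `h` inside a cube costs at most `|h|₁²` times the Dirichlet energy: the
straight coordinate path from `a` to `a + h` stays in the cube. -/
lemma sum_shift_sq_le {d : ℕ} (x : Fin d → ℤ) (m : ℕ) (f : (Fin d → ℤ) → ℝ) (k : ℕ) :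
    ∀ h : Fin d → ℤ, ∑ i, (h i).natAbs = k →
    ∑ a ∈ latticeBox x m with a + h ∈ latticeBox x m, (f (a + h) - f a) ^ 2
      ≤ (k : ℝ) ^ 2 * gradEnergy (latticeBox x m) f := by
  induction k with
  | zero =>
    intro h hk
    have h0 : h = 0 := by
      funext i
      simpa using (Finset.sum_eq_zero_iff.1 hk) i (Finset.mem_univ i)
    subst h0
    simp
  | succ k ih =>
    intro h hk
    set Q := latticeBox x m with hQ
    set S := Q.filter (fun a => a + h ∈ Q) with hSdef
    -- peel one unit step off `h`
    obtain ⟨h', hk', hmem, hstep⟩ : ∃ h' : Fin d → ℤ, ∑ i, (h' i).natAbs = k ∧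
        (∀ a ∈ S, a + h' ∈ Q) ∧
        ∑ a ∈ S, (f (a + h) - f (a + h')) ^ 2 ≤ gradEnergy Q f := by
      obtain ⟨i, hi⟩ : ∃ i, h i ≠ 0 := by
        by_contra hcon
        push Not at hcon
        simp [hcon] at hk
      have hsum : ∀ h' : Fin d → ℤ, (∀ j, j ≠ i → h' j = h j) →
          (h' i).natAbs + 1 = (h i).natAbs → ∑ j, (h' j).natAbs = k := by
        intro h' hj hi'
        rw [← Finset.add_sum_erase _ _ (Finset.mem_univ i)] at hk ⊢
        have : ∑ j ∈ Finset.univ.erase i, (h' j).natAbs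
            = ∑ j ∈ Finset.univ.erase i, (h j).natAbs :=
          Finset.sum_congr rfl fun j hj' => by rw [hj j (Finset.ne_of_mem_erase hj')]
        omega
      have hbox : ∀ h' : Fin d → ℤ, (∀ j, j ≠ i → h' j = h j) →
          (0 ≤ h' i ∧ h' i ≤ h i ∨ h i ≤ h' i ∧ h' i ≤ 0) → ∀ a ∈ S, a + h' ∈ Q := by
        intro h' hj hi' a ha
        rw [hSdef, Finset.mem_filter, hQ, mem_latticeBox, mem_latticeBox] at ha
        rw [hQ, mem_latticeBox]
        intro j
        have h1 := ha.1 j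
        have h2 := ha.2 j
        simp only [Pi.add_apply] at h2 ⊢
        by_cases hji : j = i
        · subst hji; omega
        · rw [hj j hji]; exact h2
      rcases lt_or_gt_of_ne hi with hneg | hpos
      · refine ⟨h + Pi.single i 1, hsum _ ?_ ?_, hbox _ ?_ ?_, ?_⟩
        · intro j hj; simp [hj]
        · simp; omega
        · intro j hj; simp [hj]
        · right; simp; omega
        · calc ∑ a ∈ S, (f (a + h) - f (a + (h + Pi.single i 1))) ^ 2
              = ∑ a ∈ S, (f (a + h + Pi.single i 1) - f (a + h)) ^ 2 := by
                refine Finset.sum_congr rfl fun a _ => ?_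
                rw [← add_assoc]; ring
            _ ≤ _ := by
                refine sum_unit_step_le_gradEnergy f h i fun a ha => ⟨?_, ?_⟩
                · rw [hSdef, Finset.mem_filter] at ha; exact ha.2
                · rw [add_assoc]
                  refine hbox _ ?_ ?_ a ha
                  · intro j hj; simp [hj]
                  · right; simp; omega
      · have hrw : ∀ a : Fin d → ℤ, a + (h - Pi.single i 1) + Pi.single i 1 = a + h :=
          fun a => by abel
        refine ⟨h - Pi.single i 1, hsum _ ?_ ?_, hbox _ ?_ ?_, ?_⟩
        · intro j hj; simp [hj]
        · simp; omega
        · intro j hj; simp [hj]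
        · left; simp; omega
        · have := sum_unit_step_le_gradEnergy (Q := Q) (S := S) f (h - Pi.single i 1) i
            (fun a ha => ⟨hbox _ (fun j hj => by simp [hj]) (by left; simp; omega) a ha, by
              rw [hrw]; rw [hSdef, Finset.mem_filter] at ha; exact ha.2⟩)
          simpa only [hrw] using this
    have hE := gradEnergy_nonneg Q f
    have hih : ∑ a ∈ S, (f (a + h') - f a) ^ 2 ≤ (k : ℝ) ^ 2 * gradEnergy Q f := by
      refine le_trans (Finset.sum_le_sum_of_subset_of_nonneg ?_ fun _ _ _ => sq_nonneg _)
        (ih h' hk')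
      intro a ha
      rw [Finset.mem_filter]
      exact ⟨(Finset.mem_filter.1 ha).1, hmem a ha⟩
    rcases Nat.eq_zero_or_pos k with rfl | hkpos
    · have h0 : h' = 0 := by
        funext i
        simpa using (Finset.sum_eq_zero_iff.1 hk') i (Finset.mem_univ i)
      subst h0
      simpa using hstep
    · have hkr : (0 : ℝ) < k := by exact_mod_cast hkpos
      calc ∑ a ∈ S, (f (a + h) - f a) ^ 2
          ≤ ∑ a ∈ S, ((k + 1) / k * (f (a + h') - f a) ^ 2
              + (k + 1) * (f (a + h) - f (a + h')) ^ 2) := by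
            refine Finset.sum_le_sum fun a _ => ?_
            have key : ∀ p q : ℝ, (q + p) ^ 2 ≤ (k + 1) / k * p ^ 2 + (k + 1) * q ^ 2 := by
              intro p q
              have : (k + 1) / k * p ^ 2 + (k + 1) * q ^ 2 - (q + p) ^ 2
                  = (p - k * q) ^ 2 / k := by field_simp; ring
              have : 0 ≤ (p - k * q) ^ 2 / k := by positivity
              linarith
            have := key (f (a + h') - f a) (f (a + h) - f (a + h'))
            rwa [sub_add_sub_cancel] at this
        _ = (k + 1) / k * ∑ a ∈ S, (f (a + h') - f a) ^ 2
            + (k + 1) * ∑ a ∈ S, (f (a + h) - f (a + h')) ^ 2 := by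
            rw [Finset.sum_add_distrib, Finset.mul_sum, Finset.mul_sum]
        _ ≤ (k + 1) / k * ((k : ℝ) ^ 2 * gradEnergy Q f) + (k + 1) * gradEnergy Q f := by
            gcongr
        _ = ((k + 1 : ℕ) : ℝ) ^ 2 * gradEnergy Q f := by
            push_cast; field_simp

/-- The Poincaré inequality on a lattice cube, in the form of a sum over pairs of points. -/
lemma poincare_latticeBox {d : ℕ} (x : Fin d → ℤ) (m : ℕ) (f : (Fin d → ℤ) → ℝ) :
    ∑ a ∈ latticeBox x m, ∑ b ∈ latticeBox x m, (f a - f b) ^ 2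
      ≤ (4 * m + 1 : ℝ) ^ d * (2 * d * m : ℝ) ^ 2 * gradEnergy (latticeBox x m) f := by
  set Q := latticeBox x m with hQ
  have hE := gradEnergy_nonneg Q f
  calc ∑ a ∈ Q, ∑ b ∈ Q, (f a - f b) ^ 2
      ≤ ∑ a ∈ Q, ∑ h ∈ latticeBox (0 : Fin d → ℤ) (2 * m) with a + h ∈ Q,
          (f (a + h) - f a) ^ 2 := by
        refine Finset.sum_le_sum fun a ha => ?_
        calc ∑ b ∈ Q, (f a - f b) ^ 2 = ∑ h ∈ Q.image (· - a), (f (a + h) - f a) ^ 2 := by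
              rw [Finset.sum_image (fun b _ b' _ h => sub_left_injective h)]
              refine Finset.sum_congr rfl fun b _ => ?_
              rw [add_sub_cancel]; ring
          _ ≤ _ := by
              refine Finset.sum_le_sum_of_subset_of_nonneg ?_ fun _ _ _ => sq_nonneg _
              intro h hh
              obtain ⟨b, hb, rfl⟩ := Finset.mem_image.1 hh
              rw [Finset.mem_filter]
              refine ⟨?_, by simpa using hb⟩
              rw [hQ, mem_latticeBox] at ha hb
              rw [mem_latticeBox]
              intro i
              have := ha i
              have := hb i
              simp only [Pi.zero_apply, Pi.sub_apply]
              push_cast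
              omega
    _ = ∑ h ∈ latticeBox (0 : Fin d → ℤ) (2 * m), ∑ a ∈ Q with a + h ∈ Q,
          (f (a + h) - f a) ^ 2 := by
        simp only [Finset.sum_filter]
        rw [Finset.sum_comm]
    _ ≤ ∑ h ∈ latticeBox (0 : Fin d → ℤ) (2 * m), (2 * d * m : ℝ) ^ 2 * gradEnergy Q f := by
        refine Finset.sum_le_sum fun h hh => ?_
        refine (sum_shift_sq_le x m f _ h rfl).trans ?_
        gcongr
        rw [mem_latticeBox] at hh
        have : ∑ i, (h i).natAbs ≤ ∑ _i : Fin d, 2 * m := by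
          refine Finset.sum_le_sum fun i _ => ?_
          have := hh i
          simp only [Pi.zero_apply] at this
          push_cast at this
          omega
        have h2 : ((∑ i, (h i).natAbs : ℕ) : ℝ) ≤ ((∑ _i : Fin d, 2 * m : ℕ) : ℝ) := by
          exact_mod_cast this
        refine h2.trans (le_of_eq ?_)
        simp; ring
    _ = _ := by
        rw [Finset.sum_const, card_latticeBox, nsmul_eq_mul]
        push_cast; ring

/-- A Nash type inequality: the squared `ℓ²` norm of a finitely supported function is controlled, at
every scale `r`, by its energy and its `ℓ¹` norm. It follows by averaging
`f(z)² ≤ 2 f(z) f(z+h) + (f(z) - f(z+h))²` over `h ∈ [0,r)^d`. -/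
lemma nash_latticeBox {d : ℕ} (x : Fin d → ℤ) (m r : ℕ) (hr : 1 ≤ r) (f : (Fin d → ℤ) → ℝ)
    (hf : ∀ z, z ∉ latticeBox x m → f z = 0) :
    ∑ z ∈ latticeBox x m, f z ^ 2
      ≤ 2 * ((r : ℝ) ^ d)⁻¹ * (∑ z ∈ latticeBox x m, |f z|) ^ 2
        + (d * r : ℝ) ^ 2 * gradEnergy (latticeBox x (m + r)) f := by
  set A := latticeBox x m with hA
  set Q := latticeBox x (m + r) with hQ
  set H : Finset (Fin d → ℤ) := Finset.Icc 0 (fun _ => (r : ℤ) - 1) with hH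
  have hcard : (H.card : ℝ) = (r : ℝ) ^ d := by
    have h1 : ∀ i : Fin d, ((r : ℤ) - 1 + 1 - 0).toNat = r := fun i => by omega
    simp [hH, Pi.card_Icc]
  have hE := gradEnergy_nonneg Q f
  have hmem : ∀ h ∈ H, ∀ i, 0 ≤ h i ∧ h i ≤ r - 1 := by
    intro h hh i
    rw [hH, Finset.mem_Icc] at hh
    exact ⟨hh.1 i, hh.2 i⟩
  have hone : ∀ h ∈ H, ∑ z ∈ A, f z ^ 2 ≤ 2 * ∑ z ∈ A, |f z| * |f (z + h)|
      + (d * r : ℝ) ^ 2 * gradEnergy Q f := by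
    intro h hh
    have h1 : ∑ z ∈ A, (f (z + h) - f z) ^ 2 ≤ (d * r : ℝ) ^ 2 * gradEnergy Q f := by
      calc ∑ z ∈ A, (f (z + h) - f z) ^ 2
          ≤ ∑ z ∈ Q with z + h ∈ Q, (f (z + h) - f z) ^ 2 := by
            refine Finset.sum_le_sum_of_subset_of_nonneg ?_ fun _ _ _ => sq_nonneg _
            intro z hz
            rw [Finset.mem_filter]
            rw [hA, mem_latticeBox] at hz
            rw [hQ, mem_latticeBox, mem_latticeBox]
            constructor
            · intro i; have := hz i; push_cast; omega
            · intro i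
              have := hz i
              have := hmem h hh i
              simp only [Pi.add_apply]
              push_cast; omega
        _ ≤ _ := by
            refine (sum_shift_sq_le x (m + r) f _ h rfl).trans ?_
            gcongr
            have : ∑ i, (h i).natAbs ≤ ∑ _i : Fin d, r := by
              refine Finset.sum_le_sum fun i _ => ?_
              have := hmem h hh i
              omega
            have h2 : ((∑ i, (h i).natAbs : ℕ) : ℝ) ≤ ((∑ _i : Fin d, r : ℕ) : ℝ) := by
              exact_mod_cast this
            refine h2.trans (le_of_eq ?_)
            simp
    calc ∑ z ∈ A, f z ^ 2 ≤ ∑ z ∈ A, (2 * (|f z| * |f (z + h)|) + (f (z + h) - f z) ^ 2) := by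
          refine Finset.sum_le_sum fun z _ => ?_
          rw [← abs_mul]
          nlinarith [le_abs_self (f z * f (z + h)), sq_nonneg (f (z + h))]
      _ ≤ _ := by
          rw [Finset.sum_add_distrib, ← Finset.mul_sum]
          linarith
  have hsh : ∀ z ∈ A, ∑ h ∈ H, |f (z + h)| ≤ ∑ w ∈ A, |f w| := by
    intro z _
    calc ∑ h ∈ H, |f (z + h)| = ∑ w ∈ H.image (z + ·), |f w| := by
          rw [Finset.sum_image (fun b _ b' _ h => add_left_cancel h)]
      _ = ∑ w ∈ (H.image (z + ·)).filter (· ∈ A), |f w| := by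
          rw [Finset.sum_filter]
          refine Finset.sum_congr rfl fun w _ => ?_
          by_cases hw : w ∈ A
          · simp [hw]
          · simp [hw, hf w hw]
      _ ≤ _ := Finset.sum_le_sum_of_subset_of_nonneg
          (fun w hw => (Finset.mem_filter.1 hw).2) fun _ _ _ => abs_nonneg _
  have hsum : (r : ℝ) ^ d * ∑ z ∈ A, f z ^ 2 ≤ 2 * (∑ z ∈ A, |f z|) ^ 2
      + (r : ℝ) ^ d * ((d * r : ℝ) ^ 2 * gradEnergy Q f) := by
    have := Finset.sum_le_sum hone
    rw [Finset.sum_const, Finset.sum_add_distrib, Finset.sum_const, ← Finset.mul_sum,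
      Finset.sum_comm, nsmul_eq_mul, nsmul_eq_mul, hcard] at this
    refine this.trans ?_
    gcongr
    rw [sq, Finset.sum_mul]
    refine Finset.sum_le_sum fun z hz => ?_
    rw [← Finset.mul_sum]
    exact mul_le_mul_of_nonneg_left (hsh z hz) (abs_nonneg _)
  have hrd : (0 : ℝ) < (r : ℝ) ^ d := by
    have : (0 : ℝ) < r := by exact_mod_cast hr
    positivity
  rw [← mul_le_mul_iff_right₀ hrd]
  refine hsum.trans (le_of_eq ?_)
  field_simp

/-! ### The killed heat equation for conductances on the lattice -/

/-- Conductances `c` on `ℤ^d` of range at most `ρ`, with second moments at most `M`, for which every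
nearest neighbour increment is controlled by the conductances within distance `m₀`. -/
structure IsLatticeConductance {d : ℕ} (c : (Fin d → ℤ) → (Fin d → ℤ) → ℝ) (m₀ ρ : ℕ)
    (K₀ M : ℝ) : Prop where
  nonneg : ∀ z w, 0 ≤ c z w
  symm : ∀ z w, c z w = c w z
  range_le : ∀ z w, (ρ : ℝ) < ‖z - w‖ → c z w = 0
  second_moment : ∀ z (S : Finset (Fin d → ℤ)), ∑ w ∈ S, ‖z - w‖ ^ 2 * c z w ≤ M
  neighbour : ∀ z i (f : (Fin d → ℤ) → ℝ), (f (z + Pi.single i 1) - f z) ^ 2 ≤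
    K₀ * ∑ a ∈ latticeBox z m₀, ∑ b ∈ latticeBox z m₀, c a b * (f a - f b) ^ 2

/-- `u` solves the heat equation for the conductances `c` on `A`, started from a unit mass at `x` and
killed outside `A`; the finite set `D` holds the points that are reachable in one step from `A`. -/
structure IsKilledHeatSolution {V : Type*} [DecidableEq V] (c : V → V → ℝ) (A D : Finset V) (x : V)
    (u : ℝ → V → ℝ) : Prop where
  zero_off : ∀ s z, z ∉ A → u s z = 0
  nonneg : ∀ s, 0 ≤ s → ∀ z, 0 ≤ u s z
  init : u 0 = Pi.single x 1
  deriv : ∀ s, ∀ z ∈ A, HasDerivAt (fun s => u s z) (∑ w ∈ D, c z w * (u s w - u s z)) s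

/-- The Dirichlet energy, summed over ordered pairs. -/
def dirichletEnergy {V : Type*} (c : V → V → ℝ) (D : Finset V) (f : V → ℝ) : ℝ :=
  ∑ z ∈ D, ∑ w ∈ D, c z w * (f z - f w) ^ 2

/-- Summation by parts for test functions supported in `A`. -/
lemma sum_mul_generator_eq {V : Type*} {c : V → V → ℝ} (hsymm : ∀ z w, c z w = c w z)
    {A D : Finset V} (hAD : A ⊆ D) (φ u : V → ℝ) (hφ : ∀ z, z ∉ A → φ z = 0) :
    ∑ z ∈ A, φ z * ∑ w ∈ D, c z w * (u w - u z)
      = -(1 / 2) * ∑ z ∈ D, ∑ w ∈ D, c z w * ((φ z - φ w) * (u z - u w)) := by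
  have h1 : ∑ z ∈ A, φ z * ∑ w ∈ D, c z w * (u w - u z)
      = ∑ z ∈ D, ∑ w ∈ D, c z w * (φ z * (u w - u z)) := by
    rw [Finset.sum_subset hAD fun z _ hz => by rw [hφ z hz, zero_mul]]
    refine Finset.sum_congr rfl fun z _ => ?_
    rw [Finset.mul_sum]
    exact Finset.sum_congr rfl fun w _ => by ring
  have h2 : ∑ z ∈ D, ∑ w ∈ D, c z w * (φ z * (u w - u z))
      = ∑ z ∈ D, ∑ w ∈ D, c z w * (φ w * (u z - u w)) := by
    rw [Finset.sum_comm]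
    refine Finset.sum_congr rfl fun z _ => Finset.sum_congr rfl fun w _ => ?_
    rw [hsymm w z]
  have h3 : ∑ z ∈ D, ∑ w ∈ D, c z w * ((φ z - φ w) * (u z - u w))
      = -(∑ z ∈ D, ∑ w ∈ D, c z w * (φ z * (u w - u z)))
        - ∑ z ∈ D, ∑ w ∈ D, c z w * (φ w * (u z - u w)) := by
    rw [← Finset.sum_neg_distrib, ← Finset.sum_sub_distrib]
    refine Finset.sum_congr rfl fun z _ => ?_
    rw [← Finset.sum_neg_distrib, ← Finset.sum_sub_distrib]
    exact Finset.sum_congr rfl fun w _ => by ring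
  rw [h3, h1, ← h2]; ring

namespace IsLatticeConductance

variable {d : ℕ} {c : (Fin d → ℤ) → (Fin d → ℤ) → ℝ} {m₀ ρ : ℕ} {K₀ M : ℝ}

lemma sum_second_moment_le (hc : IsLatticeConductance c m₀ ρ K₀ M) (D : Finset (Fin d → ℤ))
    (a : (Fin d → ℤ) → ℝ) (ha : ∀ z, 0 ≤ a z) :
    ∑ z ∈ D, ∑ w ∈ D, c z w * (‖z - w‖ ^ 2 * a z) ≤ M * ∑ z ∈ D, a z := by
  rw [Finset.mul_sum]
  refine Finset.sum_le_sum fun z _ => ?_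
  calc ∑ w ∈ D, c z w * (‖z - w‖ ^ 2 * a z) = (∑ w ∈ D, ‖z - w‖ ^ 2 * c z w) * a z := by
        rw [Finset.sum_mul]; exact Finset.sum_congr rfl fun w _ => by ring
    _ ≤ M * a z := mul_le_mul_of_nonneg_right (hc.second_moment z D) (ha z)

/-- The nearest neighbour energy is dominated by the energy of the conductances. -/
lemma gradEnergy_le (hc : IsLatticeConductance c m₀ ρ K₀ M) (hK₀ : 0 ≤ K₀)
    (Q D : Finset (Fin d → ℤ)) (f : (Fin d → ℤ) → ℝ)
    (h : ∀ z ∈ Q, ∀ i, f (z + Pi.single i 1) ≠ f z → latticeBox z m₀ ⊆ D) :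
    gradEnergy Q f ≤ K₀ * d * (2 * m₀ + 1) ^ d * dirichletEnergy c D f := by
  classical
  have hterm : ∀ z ∈ Q, ∀ i, (f (z + Pi.single i 1) - f z) ^ 2 ≤
      K₀ * ∑ a ∈ D, ∑ b ∈ D, if a ∈ latticeBox z m₀ then c a b * (f a - f b) ^ 2 else 0 := by
    intro z hz i
    have hnn : ∀ a b, 0 ≤ c a b * (f a - f b) ^ 2 := fun a b =>
      mul_nonneg (hc.nonneg a b) (sq_nonneg _)
    by_cases hne : f (z + Pi.single i 1) = f z
    · rw [hne, sub_self]
      have : 0 ≤ ∑ a ∈ D, ∑ b ∈ D,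
          if a ∈ latticeBox z m₀ then c a b * (f a - f b) ^ 2 else 0 :=
        Finset.sum_nonneg fun a _ => Finset.sum_nonneg fun b _ => by
          split_ifs <;> first | exact hnn a b | exact le_rfl
      simpa using mul_nonneg hK₀ this
    · have hsub := h z hz i hne
      refine (hc.neighbour z i f).trans (mul_le_mul_of_nonneg_left ?_ hK₀)
      calc ∑ a ∈ latticeBox z m₀, ∑ b ∈ latticeBox z m₀, c a b * (f a - f b) ^ 2
          ≤ ∑ a ∈ latticeBox z m₀, ∑ b ∈ D, c a b * (f a - f b) ^ 2 :=
            Finset.sum_le_sum fun a _ =>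
              Finset.sum_le_sum_of_subset_of_nonneg hsub fun b _ _ => hnn a b
        _ = ∑ a ∈ latticeBox z m₀, ∑ b ∈ D,
              if a ∈ latticeBox z m₀ then c a b * (f a - f b) ^ 2 else 0 :=
            Finset.sum_congr rfl fun a ha => Finset.sum_congr rfl fun b _ => by rw [if_pos ha]
        _ ≤ _ := Finset.sum_le_sum_of_subset_of_nonneg hsub fun a _ ha =>
            Finset.sum_nonneg fun b _ => by rw [if_neg ha]
  have hcount : ∀ a, ((Q.filter (fun z => a ∈ latticeBox z m₀)).card : ℝ) ≤ (2 * m₀ + 1) ^ d := by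
    intro a
    have : (Q.filter (fun z => a ∈ latticeBox z m₀)).card ≤ (latticeBox a m₀).card := by
      refine Finset.card_le_card fun z hz => ?_
      have := (Finset.mem_filter.1 hz).2
      rw [mem_latticeBox_iff_norm] at this ⊢
      rwa [norm_sub_rev]
    rw [card_latticeBox] at this
    exact_mod_cast this
  calc gradEnergy Q f ≤ ∑ _i : Fin d, ∑ z ∈ Q, K₀ * ∑ a ∈ D, ∑ b ∈ D,
        (if a ∈ latticeBox z m₀ then c a b * (f a - f b) ^ 2 else 0) := by
        refine Finset.sum_le_sum fun i _ => ?_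
        refine (Finset.sum_le_sum_of_subset_of_nonneg (Finset.filter_subset _ _)
          fun _ _ _ => sq_nonneg _).trans (Finset.sum_le_sum fun z hz => hterm z hz i)
    _ = K₀ * d * ∑ a ∈ D, ∑ b ∈ D,
        ((Q.filter (fun z => a ∈ latticeBox z m₀)).card : ℝ) * (c a b * (f a - f b) ^ 2) := by
        rw [Finset.sum_const, Finset.card_univ, Fintype.card_fin, nsmul_eq_mul, ← Finset.mul_sum,
          Finset.sum_comm]
        rw [← mul_assoc, mul_comm (d : ℝ)]
        congr 1
        refine Finset.sum_congr rfl fun a _ => ?_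
        rw [Finset.sum_comm]
        refine Finset.sum_congr rfl fun b _ => ?_
        rw [← Finset.sum_filter, Finset.sum_const, nsmul_eq_mul]
    _ ≤ K₀ * d * ∑ a ∈ D, ∑ b ∈ D, (2 * m₀ + 1) ^ d * (c a b * (f a - f b) ^ 2) := by
        gcongr with a _ b _
        · exact mul_nonneg (hc.nonneg a b) (sq_nonneg _)
        · exact hcount a
    _ = _ := by
        rw [dirichletEnergy]
        simp only [← Finset.mul_sum]
        ring

end IsLatticeConductance

namespace IsKilledHeatSolution

variable {V : Type*} [DecidableEq V] {c : V → V → ℝ} {A D : Finset V} {x : V} {u : ℝ → V → ℝ}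

lemma continuous (hu : IsKilledHeatSolution c A D x u) (z : V) : Continuous fun s => u s z := by
  by_cases hz : z ∈ A
  · exact continuous_iff_continuousAt.2 fun s => (hu.deriv s z hz).continuousAt
  · have : (fun s => u s z) = fun _ => 0 := funext fun s => hu.zero_off s z hz
    rw [this]; exact continuous_const

/-- The derivative of `∑ φ u` for a test function `φ`, after summation by parts. -/
lemma hasDerivAt_sum_mul (hu : IsKilledHeatSolution c A D x u) (hsymm : ∀ z w, c z w = c w z)
    (hAD : A ⊆ D) (φ : V → ℝ) (hφ : ∀ z, z ∉ A → φ z = 0) (s : ℝ) :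
    HasDerivAt (fun s => ∑ z ∈ A, φ z * u s z)
      (-(1 / 2) * ∑ z ∈ D, ∑ w ∈ D, c z w * ((φ z - φ w) * (u s z - u s w))) s := by
  rw [← sum_mul_generator_eq hsymm hAD φ (u s) hφ]
  exact HasDerivAt.fun_sum fun z hz => (hu.deriv s z hz).const_mul _

/-- The derivative of `∑ Φ(u)`, after summation by parts. -/
lemma hasDerivAt_sum_comp (hu : IsKilledHeatSolution c A D x u) (hsymm : ∀ z w, c z w = c w z)
    (hAD : A ⊆ D) (Φ Φ' : V → ℝ → ℝ) (s : ℝ)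
    (hΦ : ∀ z ∈ A, HasDerivAt (Φ z) (Φ' z (u s z)) (u s z))
    (h0 : ∀ z, z ∉ A → Φ' z 0 = 0) :
    HasDerivAt (fun s => ∑ z ∈ A, Φ z (u s z))
      (-(1 / 2) * ∑ z ∈ D, ∑ w ∈ D,
        c z w * ((Φ' z (u s z) - Φ' w (u s w)) * (u s z - u s w))) s := by
  rw [← sum_mul_generator_eq hsymm hAD (fun z => Φ' z (u s z)) (u s)
    (fun z hz => by rw [hu.zero_off s z hz, h0 z hz])]
  exact HasDerivAt.fun_sum fun z hz => (hΦ z hz).comp s (hu.deriv s z hz)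

lemma sum_le_one (hu : IsKilledHeatSolution c A D x u) (hsymm : ∀ z w, c z w = c w z)
    (hnn : ∀ z w, 0 ≤ c z w) (hAD : A ⊆ D) (hx : x ∈ A) {s : ℝ} (hs : 0 ≤ s) :
    ∑ z ∈ A, u s z ≤ 1 := by
  have hder := fun s : ℝ => hu.hasDerivAt_sum_mul hsymm hAD (fun z => if z ∈ A then 1 else 0)
    (fun z hz => if_neg hz) s
  have hanti : AntitoneOn (fun s => ∑ z ∈ A, (if z ∈ A then (1 : ℝ) else 0) * u s z)
      (Set.Ici 0) := by
    refine antitoneOn_of_hasDerivWithinAt_nonpos (convex_Ici 0)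
      (fun s _ => (hder s).continuousAt.continuousWithinAt)
      (fun s _ => (hder s).hasDerivWithinAt) fun s hs => ?_
    rw [interior_Ici] at hs
    have : 0 ≤ ∑ z ∈ D, ∑ w ∈ D, c z w *
        (((if z ∈ A then (1 : ℝ) else 0) - if w ∈ A then 1 else 0) * (u s z - u s w)) := by
      refine Finset.sum_nonneg fun z _ => Finset.sum_nonneg fun w _ => mul_nonneg (hnn z w) ?_
      have h1 := hu.nonneg s (le_of_lt hs) z
      have h2 := hu.nonneg s (le_of_lt hs) w
      by_cases hz : z ∈ A <;> by_cases hw : w ∈ A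
      · simp [hz, hw]
      · simp [hz, hw, hu.zero_off s w hw, h1]
      · simp [hz, hw, hu.zero_off s z hz, h2]
      · simp [hz, hw]
    linarith
  have h0 := hanti (Set.mem_Ici.2 le_rfl) (Set.mem_Ici.2 hs) hs
  have e1 : ∀ s, ∑ z ∈ A, (if z ∈ A then (1 : ℝ) else 0) * u s z = ∑ z ∈ A, u s z := fun s =>
    Finset.sum_congr rfl fun z hz => by rw [if_pos hz, one_mul]
  simp only [e1] at h0
  rw [hu.init] at h0
  simpa [Finset.sum_pi_single', hx, Pi.single_apply] using h0

lemma hasDerivAt_sum_sq (hu : IsKilledHeatSolution c A D x u) (hsymm : ∀ z w, c z w = c w z)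
    (hAD : A ⊆ D) (s : ℝ) :
    HasDerivAt (fun s => ∑ z ∈ A, u s z ^ 2) (-dirichletEnergy c D (u s)) s := by
  have := hu.hasDerivAt_sum_comp hsymm hAD (fun _ v => v ^ 2) (fun _ v => 2 * v) s
    (fun z _ => by simpa using hasDerivAt_pow 2 (u s z)) (fun _ _ => by simp)
  convert this using 1
  rw [dirichletEnergy, Finset.mul_sum, ← Finset.sum_neg_distrib]
  refine Finset.sum_congr rfl fun z _ => ?_
  rw [Finset.mul_sum, ← Finset.sum_neg_distrib]
  exact Finset.sum_congr rfl fun w _ => by ring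

end IsKilledHeatSolution

/-- A differential form of Nash's argument: a function bounded by `1` that satisfies a Nash type
inequality at every scale `r` decays like `s ^ (-d / 2)`. -/
lemma nash_decay {d : ℕ} (hd : 1 ≤ d) {K : ℝ} (hK : 0 < K) :
    ∃ κ : ℝ, 0 < κ ∧ ∀ F F' : ℝ → ℝ, (∀ s, HasDerivAt F (F' s) s) → (∀ s, 0 ≤ s → F' s ≤ 0) →
      (∀ s, 0 ≤ s → F s ≤ 1) →
      (∀ s, 0 ≤ s → ∀ r : ℕ, 1 ≤ r → F s ≤ 2 * ((r : ℝ) ^ d)⁻¹ + K * (r : ℝ) ^ 2 * (-F' s)) →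
      ∀ s, 0 < s → F s ≤ (κ * s) ^ (-(d : ℝ) / 2) := by
  have hd0 : (0 : ℝ) < d := by exact_mod_cast hd
  refine ⟨(2 / d) / (8 * K * 4 ^ (2 / (d : ℝ))), by positivity, ?_⟩
  set κ := (2 / d) / (8 * K * 4 ^ (2 / (d : ℝ))) with hκ
  have hκ0 : 0 < κ := by positivity
  intro F F' hF hF' hF1 hN s hs
  rcases le_or_gt (F s) 0 with hF0 | hFpos
  · exact hF0.trans (by positivity)
  have hanti : AntitoneOn F (Set.Ici 0) := by
    refine antitoneOn_of_hasDerivWithinAt_nonpos (convex_Ici 0)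
      (fun s _ => (hF s).continuousAt.continuousWithinAt)
      (fun s _ => (hF s).hasDerivWithinAt) fun s hs => ?_
    rw [interior_Ici] at hs
    exact hF' s (le_of_lt hs)
  have hpos : ∀ q ∈ Set.Icc 0 s, 0 < F q := fun q hq =>
    hFpos.trans_le (hanti hq.1 (hq.1.trans hq.2) hq.2)
  -- the reciprocal power `F ^ (-2 / d)` grows at least linearly
  have hrate : ∀ q ∈ Set.Icc 0 s, κ ≤ F' q * (-(2 / d)) * F q ^ (-(2 / (d : ℝ)) - 1) := by
    intro q hq
    have hFq := hpos q hq
    -- at this scale the first term of the Nash inequality is at most half of `F q`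
    set y : ℝ := (4 / F q) ^ (1 / (d : ℝ)) with hy
    have h4 : 1 ≤ 4 / F q := by
      rw [le_div_iff₀ hFq]; linarith [hF1 q hq.1]
    have hy1 : 1 ≤ y := Real.one_le_rpow h4 (by positivity)
    set r := ⌈y⌉₊ with hr
    have hr1 : 1 ≤ r := Nat.one_le_ceil_iff.2 (by linarith)
    have hry : y ≤ r := Nat.le_ceil y
    have hr2 : (r : ℝ) ≤ 2 * y := by
      have := Nat.ceil_lt_add_one (show 0 ≤ y by linarith)
      linarith
    have hyd : y ^ d = 4 / F q := by
      rw [hy, ← Real.rpow_natCast, ← Real.rpow_mul (by positivity), one_div,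
        inv_mul_cancel₀ hd0.ne', Real.rpow_one]
    have hrd : 4 / F q ≤ (r : ℝ) ^ d := by
      rw [← hyd]; gcongr
    have h1 := hN q hq.1 r hr1
    have h2 : 2 * ((r : ℝ) ^ d)⁻¹ ≤ F q / 2 := by
      calc 2 * ((r : ℝ) ^ d)⁻¹ ≤ 2 * (4 / F q)⁻¹ := by gcongr
        _ = F q / 2 := by field_simp; norm_num
    have h3 : F q / 2 ≤ K * (2 * y) ^ 2 * (-F' q) := by
      have h3' : 0 ≤ -F' q := by linarith [hF' q hq.1]
      calc F q / 2 ≤ K * (r : ℝ) ^ 2 * (-F' q) := by linarith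
        _ ≤ _ := by gcongr
    have hy2 : y ^ 2 = 4 ^ (2 / (d : ℝ)) * F q ^ (-(2 / (d : ℝ))) := by
      rw [hy, ← Real.rpow_natCast, ← Real.rpow_mul (by positivity),
        Real.div_rpow (by norm_num) hFq.le, Real.rpow_neg hFq.le, div_eq_mul_inv]
      norm_num [div_eq_mul_inv, mul_comm]
    have hX : 0 < F q ^ (-(2 / (d : ℝ))) := Real.rpow_pos_of_pos hFq _
    rw [Real.rpow_sub_one hFq.ne']
    rw [mul_pow, hy2] at h3
    rw [hκ, div_le_iff₀ (by positivity)]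
    have h4 : F q ≤ F' q * (-1) * F q ^ (-(2 / (d : ℝ))) * (8 * K * 4 ^ (2 / (d : ℝ))) := by
      nlinarith
    calc (2 / d : ℝ) = (2 / d) * (F q / F q) := by rw [div_self hFq.ne', mul_one]
      _ ≤ (2 / d) * ((F' q * (-1) * F q ^ (-(2 / (d : ℝ))) * (8 * K * 4 ^ (2 / (d : ℝ)))) / F q) := by
          gcongr
      _ = _ := by ring
  have hmono : MonotoneOn (fun q => F q ^ (-(2 / (d : ℝ))) - κ * q) (Set.Icc 0 s) := by
    have hder : ∀ q ∈ Set.Icc 0 s, HasDerivAt (fun q => F q ^ (-(2 / (d : ℝ))) - κ * q)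
        (F' q * (-(2 / d)) * F q ^ (-(2 / (d : ℝ)) - 1) - κ) q := fun q hq => by
        have h1 := (hF q).rpow_const (p := -(2 / (d : ℝ))) (Or.inl (hpos q hq).ne')
        have h2 := (hasDerivAt_id q).const_mul κ
        rw [mul_one] at h2
        exact h1.sub h2
    refine monotoneOn_of_hasDerivWithinAt_nonneg (convex_Icc 0 s)
      (fun q hq => (hder q hq).continuousAt.continuousWithinAt)
      (fun q hq => (hder q (interior_subset hq)).hasDerivWithinAt) fun q hq => ?_
    linarith [hrate q (interior_subset hq)]
  have hfin := hmono (Set.left_mem_Icc.2 hs.le) (Set.right_mem_Icc.2 hs.le) hs.le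
  simp only [mul_zero, sub_zero] at hfin
  have h0 : 0 < F 0 ^ (-(2 / (d : ℝ))) := Real.rpow_pos_of_pos (hpos 0 (Set.left_mem_Icc.2 hs.le)) _
  have h5 : κ * s ≤ F s ^ (-(2 / (d : ℝ))) := by linarith
  calc F s = (F s ^ (-(2 / (d : ℝ)))) ^ (-(d : ℝ) / 2) := by
        rw [← Real.rpow_mul hFpos.le]
        have : -(2 / (d : ℝ)) * (-(d : ℝ) / 2) = 1 := by field_simp
        rw [this, Real.rpow_one]
    _ ≤ (κ * s) ^ (-(d : ℝ) / 2) :=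
        Real.rpow_le_rpow_of_nonpos (by positivity) h5 (by
          have : (0 : ℝ) ≤ d := hd0.le
          linarith)

/-! ### Decay and tightness of killed heat solutions -/

/-- The on-diagonal decay of the killed heat equation, as a bound on its `ℓ²` norm. -/
lemma exists_sum_sq_le {d : ℕ} (hd : 1 ≤ d) (m₀ : ℕ) {K₀ : ℝ} (hK₀ : 0 < K₀) :
    ∃ C : ℝ, 0 < C ∧ ∀ (c : (Fin d → ℤ) → (Fin d → ℤ) → ℝ) (ρ m : ℕ) (M : ℝ)
      (x₀ x : Fin d → ℤ) (u : ℝ → (Fin d → ℤ) → ℝ), IsLatticeConductance c m₀ ρ K₀ M →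
      m₀ + 1 ≤ ρ → x ∈ latticeBox x₀ m →
      IsKilledHeatSolution c (latticeBox x₀ m) (latticeBox x₀ (m + ρ)) x u →
      ∀ s, 0 < s → ∑ z ∈ latticeBox x₀ m, u s z ^ 2 ≤ C * s ^ (-(d : ℝ) / 2) := by
  have hd0 : (0 : ℝ) < d := by exact_mod_cast hd
  set K : ℝ := d ^ 2 * (K₀ * d * (2 * m₀ + 1) ^ d) with hKdef
  have hK : 0 < K := by positivity
  obtain ⟨κ, hκ, H⟩ := nash_decay hd hK
  refine ⟨κ ^ (-(d : ℝ) / 2), by positivity, ?_⟩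
  intro c ρ m M x₀ x u hc hρ hx hu s hs
  have hAD : latticeBox x₀ m ⊆ latticeBox x₀ (m + ρ) := latticeBox_mono x₀ (Nat.le_add_right _ _)
  set A := latticeBox x₀ m with hA
  set D := latticeBox x₀ (m + ρ) with hD
  have hEnn : ∀ f, 0 ≤ dirichletEnergy c D f := fun f => Finset.sum_nonneg fun z _ =>
    Finset.sum_nonneg fun w _ => mul_nonneg (hc.nonneg z w) (sq_nonneg _)
  have hsum : ∀ s, 0 ≤ s → ∑ z ∈ A, u s z ≤ 1 := fun s hs =>
    hu.sum_le_one hc.symm hc.nonneg hAD hx hs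
  rw [← Real.mul_rpow hκ.le hs.le]
  refine H (fun s => ∑ z ∈ A, u s z ^ 2) (fun s => -dirichletEnergy c D (u s))
    (hu.hasDerivAt_sum_sq hc.symm hAD) (fun s _ => neg_nonpos.2 (hEnn _)) ?_ ?_ s hs
  · intro s hs
    refine le_trans (Finset.sum_le_sum fun z hz => ?_) (hsum s hs)
    have h1 : u s z ≤ 1 :=
      (Finset.single_le_sum (fun w _ => hu.nonneg s hs w) hz).trans (hsum s hs)
    nlinarith [hu.nonneg s hs z]
  · intro s hs r hr
    have h1 := nash_latticeBox x₀ m r hr (u s) (hu.zero_off s)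
    have h2 := hc.gradEnergy_le hK₀.le (latticeBox x₀ (m + r)) D (u s) (by
      intro z _ i hne
      have hz : z ∈ latticeBox x₀ (m + 1) := by
        by_cases hzA : z ∈ A
        · exact latticeBox_mono x₀ (Nat.le_succ m) hzA
        · have hz' : z + Pi.single i 1 ∈ A := by
            by_contra hcon
            exact hne (by rw [hu.zero_off s _ hcon, hu.zero_off s _ hzA])
          rw [hA, mem_latticeBox] at hz'
          rw [mem_latticeBox]
          intro j
          have := hz' j
          by_cases hj : j = i
          · subst hj; simp at this; push_cast; omega
          · simp [hj] at this; push_cast; omega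
      intro w hw
      exact mem_latticeBox_trans hz hw (by omega))
    simp only [neg_neg]
    have h3 : (∑ z ∈ A, |u s z|) ^ 2 ≤ 1 := by
      have e : ∑ z ∈ A, |u s z| = ∑ z ∈ A, u s z :=
        Finset.sum_congr rfl fun z _ => abs_of_nonneg (hu.nonneg s hs z)
      rw [e]
      have h0 : 0 ≤ ∑ z ∈ A, u s z := Finset.sum_nonneg fun z _ => hu.nonneg s hs z
      have := hsum s hs
      nlinarith
    calc ∑ z ∈ A, u s z ^ 2 ≤ _ := h1
      _ ≤ 2 * ((r : ℝ) ^ d)⁻¹ * 1 + (d * r : ℝ) ^ 2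
            * (K₀ * d * (2 * m₀ + 1) ^ d * dirichletEnergy c D (u s)) := by
          gcongr
      _ = _ := by rw [hKdef]; ring

/-- A convexity inequality which bounds an increment by the entropy production of the power
`u ^ (1 + ε)`. -/
lemma sq_sub_le_rpow {a b ε : ℝ} (ha : 0 ≤ a) (hb : 0 ≤ b) (h0 : 0 < ε) (h1 : ε < 1) :
    ε * (a - b) ^ 2 ≤ (a - b) * (a ^ ε - b ^ ε) * (a ^ (1 - ε) + b ^ (1 - ε)) := by
  wlog hab : b ≤ a generalizing a b
  · have := this hb ha (le_of_not_ge hab)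
    nlinarith
  have hgm := Real.geom_mean_le_arith_mean2_weighted (w₁ := ε) (w₂ := 1 - ε) h0.le
    (by linarith) hb ha (by ring)
  have haa : a ^ ε * a ^ (1 - ε) = a := by
    rw [← Real.rpow_add_of_nonneg ha h0.le (by linarith)]; simp
  have hmono : b ^ ε ≤ a ^ ε := Real.rpow_le_rpow hb hab h0.le
  have hb' : 0 ≤ b ^ (1 - ε) := by positivity
  have key : ε * (a - b) ≤ (a ^ ε - b ^ ε) * (a ^ (1 - ε) + b ^ (1 - ε)) := by
    nlinarith [mul_nonneg (sub_nonneg.2 hmono) hb']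
  nlinarith [mul_le_mul_of_nonneg_left key (sub_nonneg.2 hab)]

/-- Young's inequality with parameter `β`, for an increment `Δ` controlled as in `sq_sub_le_rpow`. -/
lemma mul_abs_le_of_sq_le {y Δ S P β ε : ℝ} (hS : 0 ≤ S) (hP : 0 ≤ P) (hβ : 0 < β)
    (hε : 0 < ε) (h : ε * Δ ^ 2 ≤ P * S) :
    y * |Δ| ≤ β / 2 * (y ^ 2 * S) + 1 / (2 * β * ε) * P := by
  refine abs_le_of_sq_le_sq' ?_ (by positivity) |>.2
  have h2 : (y * |Δ|) ^ 2 ≤ y ^ 2 * (P * S / ε) := by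
    rw [mul_pow, sq_abs]
    gcongr
    rw [le_div_iff₀ hε]; linarith
  have h3 : 4 * (β / 2 * (y ^ 2 * S)) * (1 / (2 * β * ε) * P) = y ^ 2 * (P * S / ε) := by
    field_simp; norm_num
  nlinarith [sq_nonneg (β / 2 * (y ^ 2 * S) - 1 / (2 * β * ε) * P)]

lemma rpow_one_add_le {v ε l : ℝ} (hv : 0 ≤ v) (h0 : 0 < ε) (h1 : ε < 1) (hl : 0 < l) :
    v ^ (1 + ε) ≤ l ^ ε * v + l ^ (ε - 1) * v ^ 2 := by
  rcases hv.eq_or_lt with rfl | hv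
  · rw [Real.zero_rpow (by linarith)]; simp
  rcases le_total v l with h | h
  · rw [Real.rpow_one_add' hv.le (by linarith), mul_comm]
    have : v ^ ε ≤ l ^ ε := Real.rpow_le_rpow hv.le h h0.le
    have : 0 ≤ l ^ (ε - 1) * v ^ 2 := by positivity
    nlinarith
  · have e : v ^ (1 + ε) = v ^ (ε - 1) * v ^ 2 := by
      rw [← Real.rpow_natCast, ← Real.rpow_add hv]; congr 1; push_cast; ring
    have : v ^ (ε - 1) ≤ l ^ (ε - 1) := Real.rpow_le_rpow_of_nonpos hl h (by linarith)
    have : 0 ≤ l ^ ε * v := by positivity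
    rw [e]
    nlinarith [sq_nonneg v]

lemma rpow_one_sub_le {v ε l : ℝ} (hv : 0 ≤ v) (h0 : 0 < ε) (h1 : ε < 1) (hl : 0 < l) :
    v ^ (1 - ε) ≤ l ^ (-ε) * v + l ^ (1 - ε) := by
  rcases hv.eq_or_lt with rfl | hv
  · rw [Real.zero_rpow (by linarith)]; positivity
  rcases le_total v l with h | h
  · have : v ^ (1 - ε) ≤ l ^ (1 - ε) := Real.rpow_le_rpow hv.le h (by linarith)
    have : 0 ≤ l ^ (-ε) * v := by positivity
    linarith
  · have e : v ^ (1 - ε) = v ^ (-ε) * v := by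
      rw [← Real.rpow_add_one hv.ne']; congr 1; ring
    have : v ^ (-ε) ≤ l ^ (-ε) := Real.rpow_le_rpow_of_nonpos hl h (by linarith)
    have : 0 ≤ l ^ (1 - ε) := by positivity
    rw [e]; nlinarith

/-- The conical cutoff of radius `L` about `x₀`. -/
noncomputable def coneCutoff {d : ℕ} (x₀ : Fin d → ℤ) (L : ℝ) (z : Fin d → ℤ) : ℝ :=
  max 0 (1 - ‖z - x₀‖ / L)

lemma abs_coneCutoff_sub_le {d : ℕ} (x₀ : Fin d → ℤ) {L : ℝ} (hL : 0 < L) (z w : Fin d → ℤ) :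
    |coneCutoff x₀ L z - coneCutoff x₀ L w| ≤ ‖z - w‖ / L := by
  have h1 : |max (1 - ‖z - x₀‖ / L) 0 - max (1 - ‖w - x₀‖ / L) 0|
      ≤ |(1 - ‖z - x₀‖ / L) - (1 - ‖w - x₀‖ / L)| := abs_max_sub_max_le_abs _ _ 0
  rw [coneCutoff, coneCutoff, max_comm, max_comm 0]
  refine h1.trans ?_
  have e : (1 - ‖z - x₀‖ / L) - (1 - ‖w - x₀‖ / L) = (‖w - x₀‖ - ‖z - x₀‖) / L := by ring
  rw [e, abs_div, abs_of_pos hL]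
  gcongr
  refine (abs_norm_sub_norm_le _ _).trans (le_of_eq ?_)
  rw [sub_sub_sub_cancel_right, norm_sub_rev]

/-- Differential inequality behind the tightness estimate. The first moment of the cutoff can only
decrease at a rate that is controlled by the production of `∑ u ^ (1 + ε)`. -/
lemma IsKilledHeatSolution.cutoff_deriv_ge {d : ℕ} {c : (Fin d → ℤ) → (Fin d → ℤ) → ℝ} {m₀ ρ : ℕ}
    {K₀ M : ℝ} {A D : Finset (Fin d → ℤ)} {x : Fin d → ℤ} {u : ℝ → (Fin d → ℤ) → ℝ}
    (hu : IsKilledHeatSolution c A D x u) (hc : IsLatticeConductance c m₀ ρ K₀ M) (hM : 0 ≤ M)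
    (hAD : A ⊆ D) (hx : x ∈ A) {ε : ℝ} (h0 : 0 < ε) (h1 : ε < 1) {L : ℝ} (hL : 0 < L)
    (g : (Fin d → ℤ) → ℝ) (hg : ∀ z w, |g z - g w| ≤ ‖z - w‖ / L) {β : ℝ} (hβ : 0 < β) {s : ℝ}
    (hs : 0 ≤ s) :
    -(2 * β * M * (A.card : ℝ) ^ ε +
      1 / (2 * β * ε) * ∑ z ∈ D, ∑ w ∈ D, c z w * ((u s z ^ ε - u s w ^ ε) * (u s z - u s w)))
      ≤ L * -(∑ z ∈ D, ∑ w ∈ D, c z w * ((g z - g w) * (u s z - u s w))) := by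
  have hun := hu.nonneg s hs
  have hpow : ∑ z ∈ D, u s z ^ (1 - ε) ≤ 2 * (A.card : ℝ) ^ ε := by
    have hcard : (0 : ℝ) < A.card := by exact_mod_cast Finset.card_pos.2 ⟨x, hx⟩
    have hl : (0 : ℝ) < (A.card : ℝ)⁻¹ := by positivity
    rw [← Finset.sum_subset hAD fun z _ hz => by
      rw [hu.zero_off s z hz, Real.zero_rpow (by linarith)]]
    calc ∑ z ∈ A, u s z ^ (1 - ε)
        ≤ ∑ z ∈ A, (((A.card : ℝ)⁻¹) ^ (-ε) * u s z + ((A.card : ℝ)⁻¹) ^ (1 - ε)) :=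
          Finset.sum_le_sum fun z _ => rpow_one_sub_le (hun z) h0 h1 hl
      _ = ((A.card : ℝ)⁻¹) ^ (-ε) * ∑ z ∈ A, u s z + A.card * ((A.card : ℝ)⁻¹) ^ (1 - ε) := by
          rw [Finset.sum_add_distrib, Finset.mul_sum, Finset.sum_const, nsmul_eq_mul]
      _ ≤ ((A.card : ℝ)⁻¹) ^ (-ε) * 1 + A.card * ((A.card : ℝ)⁻¹) ^ (1 - ε) := by
          gcongr
          exact hu.sum_le_one hc.symm hc.nonneg hAD hx hs
      _ = 2 * (A.card : ℝ) ^ ε := by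
          rw [Real.inv_rpow hcard.le, Real.inv_rpow hcard.le, Real.rpow_neg hcard.le, inv_inv,
            Real.rpow_sub hcard, Real.rpow_one]
          field_simp; norm_num
  have hpt : ∀ z w, L * ((g z - g w) * (u s z - u s w))
      ≤ β / 2 * (‖z - w‖ ^ 2 * (u s z ^ (1 - ε) + u s w ^ (1 - ε)))
        + 1 / (2 * β * ε) * ((u s z ^ ε - u s w ^ ε) * (u s z - u s w)) := by
    intro z w
    have hP : 0 ≤ (u s z ^ ε - u s w ^ ε) * (u s z - u s w) := by
      rcases le_total (u s z) (u s w) with h | h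
      · exact mul_nonneg_of_nonpos_of_nonpos
          (sub_nonpos.2 (Real.rpow_le_rpow (hun z) h h0.le)) (sub_nonpos.2 h)
      · exact mul_nonneg (sub_nonneg.2 (Real.rpow_le_rpow (hun w) h h0.le)) (sub_nonneg.2 h)
    have hS : 0 ≤ u s z ^ (1 - ε) + u s w ^ (1 - ε) :=
      add_nonneg (Real.rpow_nonneg (hun z) _) (Real.rpow_nonneg (hun w) _)
    have hmain := mul_abs_le_of_sq_le (y := ‖z - w‖) (Δ := u s z - u s w) hS hP hβ h0 (by
      have := sq_sub_le_rpow (hun z) (hun w) h0 h1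
      linarith)
    refine le_trans ?_ hmain
    calc L * ((g z - g w) * (u s z - u s w)) ≤ L * (|g z - g w| * |u s z - u s w|) := by
          rw [← abs_mul]; gcongr; exact le_abs_self _
      _ ≤ L * (‖z - w‖ / L * |u s z - u s w|) := by gcongr; exact hg z w
      _ = _ := by field_simp
  have hmom : ∑ z ∈ D, ∑ w ∈ D, c z w * (‖z - w‖ ^ 2 * (u s z ^ (1 - ε) + u s w ^ (1 - ε)))
      ≤ 4 * M * (A.card : ℝ) ^ ε := by
    have e1 := hc.sum_second_moment_le D (fun z => u s z ^ (1 - ε))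
      (fun z => Real.rpow_nonneg (hun z) _)
    have e2 : ∑ z ∈ D, ∑ w ∈ D, c z w * (‖z - w‖ ^ 2 * u s w ^ (1 - ε))
        = ∑ z ∈ D, ∑ w ∈ D, c z w * (‖z - w‖ ^ 2 * u s z ^ (1 - ε)) := by
      rw [Finset.sum_comm]
      refine Finset.sum_congr rfl fun z _ => Finset.sum_congr rfl fun w _ => ?_
      rw [hc.symm w z, norm_sub_rev]
    simp only [mul_add, Finset.sum_add_distrib]
    rw [e2]
    have := mul_le_mul_of_nonneg_left hpow hM
    linarith
  have hsum : L * ∑ z ∈ D, ∑ w ∈ D, c z w * ((g z - g w) * (u s z - u s w))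
      ≤ β / 2 * ∑ z ∈ D, ∑ w ∈ D,
          c z w * (‖z - w‖ ^ 2 * (u s z ^ (1 - ε) + u s w ^ (1 - ε)))
        + 1 / (2 * β * ε) * ∑ z ∈ D, ∑ w ∈ D,
          c z w * ((u s z ^ ε - u s w ^ ε) * (u s z - u s w)) := by
    simp only [Finset.mul_sum, ← Finset.sum_add_distrib]
    refine Finset.sum_le_sum fun z _ => Finset.sum_le_sum fun w _ => ?_
    have := mul_le_mul_of_nonneg_left (hpt z w) (hc.nonneg z w)
    linarith
  have := mul_le_mul_of_nonneg_left hmom (show 0 ≤ β / 2 by positivity)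
  linarith

set_option maxHeartbeats 1000000 in
/-- Tightness: up to time `ℓ²` most of the mass stays in the cube of radius `κ ℓ`. -/
lemma exists_mass_ge {d : ℕ} (hd : 1 ≤ d) (m₀ : ℕ) {K₀ M : ℝ} (hK₀ : 0 < K₀) (hM : 0 < M) :
    ∃ C : ℝ, 0 < C ∧ ∀ (c : (Fin d → ℤ) → (Fin d → ℤ) → ℝ) (ρ κ ℓ : ℕ)
      (x₀ x : Fin d → ℤ) (u : ℝ → (Fin d → ℤ) → ℝ), IsLatticeConductance c m₀ ρ K₀ M →
      m₀ + 1 ≤ ρ → 1 ≤ κ → 1 ≤ ℓ → x ∈ latticeBox x₀ ℓ →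
      IsKilledHeatSolution c (latticeBox x₀ (2 * κ * ℓ)) (latticeBox x₀ (2 * κ * ℓ + ρ)) x u →
      ∀ s, 0 < s → s ≤ (ℓ : ℝ) ^ 2 →
        1 - C / Real.sqrt κ ≤ ∑ z ∈ latticeBox x₀ (κ * ℓ), u s z := by
  obtain ⟨C, hC, HL2⟩ := exists_sum_sq_le hd m₀ hK₀
  have hd0 : (0 : ℝ) < d := by exact_mod_cast hd
  have hd1 : (1 : ℝ) ≤ d := by exact_mod_cast hd
  set ε : ℝ := 1 / (2 * d) with hε
  have hε0 : 0 < ε := by positivity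
  have hε1 : ε < 1 := by
    rw [hε, div_lt_one (by positivity)]; linarith
  refine ⟨1 + 2 * M * Real.sqrt 5 + 2 * d * (1 + C), by positivity, ?_⟩
  intro c ρ κ ℓ x₀ x u hc hρ hκ hℓ hx hu s hs hsℓ
  have hκ1 : (1 : ℝ) ≤ κ := by exact_mod_cast hκ
  have hℓ1 : (1 : ℝ) ≤ ℓ := by exact_mod_cast hℓ
  have hAD : latticeBox x₀ (2 * κ * ℓ) ⊆ latticeBox x₀ (2 * κ * ℓ + ρ) :=
    latticeBox_mono x₀ (Nat.le_add_right _ _)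
  have hκℓ : ℓ ≤ 2 * κ * ℓ := by nlinarith
  have hxA : x ∈ latticeBox x₀ (2 * κ * ℓ) := latticeBox_mono x₀ hκℓ hx
  have hQA : latticeBox x₀ (κ * ℓ) ⊆ latticeBox x₀ (2 * κ * ℓ) :=
    latticeBox_mono x₀ (by nlinarith)
  have hF := HL2 c ρ (2 * κ * ℓ) M x₀ x u hc hρ hxA hu
  have hcardA : ((latticeBox x₀ (2 * κ * ℓ)).card : ℝ) ^ ε ≤ Real.sqrt (5 * (κ * ℓ)) := by
    rw [card_latticeBox]
    have h1 : (((2 * (2 * κ * ℓ) + 1) ^ d : ℕ) : ℝ) ≤ (5 * (κ * ℓ) : ℝ) ^ d := by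
      push_cast
      gcongr
      nlinarith
    calc (((2 * (2 * κ * ℓ) + 1) ^ d : ℕ) : ℝ) ^ ε ≤ ((5 * (κ * ℓ) : ℝ) ^ d) ^ ε := by
          gcongr
      _ = Real.sqrt (5 * (κ * ℓ)) := by
          rw [← Real.rpow_natCast, ← Real.rpow_mul (by positivity), Real.sqrt_eq_rpow]
          congr 1
          rw [hε]; field_simp
  set A := latticeBox x₀ (2 * κ * ℓ) with hA
  set D := latticeBox x₀ (2 * κ * ℓ + ρ) with hD
  set L : ℝ := κ * ℓ with hL
  have hL0 : 0 < L := by positivity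
  set g := coneCutoff x₀ L with hg
  have hgQ : ∀ z, z ∉ latticeBox x₀ (κ * ℓ) → g z = 0 := by
    intro z hz
    rw [mem_latticeBox_iff_norm, not_le] at hz
    rw [hg, coneCutoff, max_eq_left]
    rw [sub_nonpos, le_div_iff₀ hL0, one_mul]
    push_cast at hz
    exact hz.le
  have hg0 : ∀ z, z ∉ A → g z = 0 := fun z hz => hgQ z fun h => hz (hQA h)
  -- `J` is the power entropy, `E` its production
  set J : ℝ → ℝ := fun s => ∑ z ∈ A, u s z ^ (1 + ε) with hJ
  set E : ℝ → ℝ := fun s =>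
    ∑ z ∈ D, ∑ w ∈ D, c z w * ((u s z ^ ε - u s w ^ ε) * (u s z - u s w)) with hE
  have hJd : ∀ s, HasDerivAt J (-(1 / 2) * (1 + ε) * E s) s := by
    intro s
    have := hu.hasDerivAt_sum_comp hc.symm hAD (fun _ v => v ^ (1 + ε))
      (fun _ v => (1 + ε) * v ^ ε) s
      (fun z _ => by
        have := Real.hasDerivAt_rpow_const (x := u s z) (p := 1 + ε) (Or.inr (by linarith))
        simpa using this)
      (fun _ _ => by rw [Real.zero_rpow hε0.ne', mul_zero])
    convert this using 1
    rw [hE]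
    simp only [Finset.mul_sum]
    refine Finset.sum_congr rfl fun z _ => Finset.sum_congr rfl fun w _ => by ring
  have hEnn : ∀ s, 0 ≤ s → 0 ≤ E s := by
    intro s hs
    refine Finset.sum_nonneg fun z _ => Finset.sum_nonneg fun w _ =>
      mul_nonneg (hc.nonneg z w) ?_
    rcases le_total (u s z) (u s w) with h | h
    · exact mul_nonneg_of_nonpos_of_nonpos
        (sub_nonpos.2 (Real.rpow_le_rpow (hu.nonneg s hs z) h hε0.le)) (sub_nonpos.2 h)
    · exact mul_nonneg (sub_nonneg.2 (Real.rpow_le_rpow (hu.nonneg s hs w) h hε0.le))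
        (sub_nonneg.2 h)
  have hJnn : ∀ s, 0 ≤ s → 0 ≤ J s := fun s hs =>
    Finset.sum_nonneg fun z _ => Real.rpow_nonneg (hu.nonneg s hs z) _
  have hJle : ∀ s, 0 < s → J s ≤ (1 + C) * s ^ (-(1 / 4) : ℝ) := by
    intro s hs
    set l : ℝ := s ^ (-(d : ℝ) / 2) with hl
    have hl0 : 0 < l := by positivity
    have e1 : l ^ ε = s ^ (-(1 / 4) : ℝ) := by
      rw [hl, ← Real.rpow_mul hs.le]
      congr 1
      rw [hε]; field_simp; norm_num
    calc J s ≤ ∑ z ∈ A, (l ^ ε * u s z + l ^ (ε - 1) * u s z ^ 2) :=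
          Finset.sum_le_sum fun z _ => rpow_one_add_le (hu.nonneg s hs.le z) hε0 hε1 hl0
      _ = l ^ ε * ∑ z ∈ A, u s z + l ^ (ε - 1) * ∑ z ∈ A, u s z ^ 2 := by
          rw [Finset.sum_add_distrib, Finset.mul_sum, Finset.mul_sum]
      _ ≤ l ^ ε * 1 + l ^ (ε - 1) * (C * l) := by
          gcongr
          · exact hu.sum_le_one hc.symm hc.nonneg hAD hxA hs.le
          · exact hF s hs
      _ = (1 + C) * s ^ (-(1 / 4) : ℝ) := by
          rw [Real.rpow_sub_one hl0.ne', ← e1]; field_simp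
  -- With the parameter `b s ^ (-1/2)` in the differential inequality, the production `E s` comes with
  -- the factor `s ^ (1/2)`. In the derivative of `Ψ` the term with `s ^ (1/2) * J s` compensates it, and
  -- the new term `s ^ (-1/2) * J s` is of order `s ^ (-3/4)`, hence integrable at `0`.
  set b : ℝ := (Real.sqrt ℓ)⁻¹ with hb
  have hb0 : 0 < b := by positivity
  set Ac : ℝ := (A.card : ℝ) ^ ε with hAc
  set Ψ : ℝ → ℝ := fun s => L * ∑ z ∈ A, g z * u s z + 2 * b * M * Ac * s ^ (1 / 2 : ℝ)
    - d / b * (s ^ (1 / 2 : ℝ) * J s) + 2 * (d / b) * (1 + C) * s ^ (1 / 4 : ℝ) with hΨ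
  have hIcont : Continuous fun s => ∑ z ∈ A, g z * u s z :=
    continuous_finsetSum _ fun z _ => (hu.continuous z).const_mul _ |>.congr fun _ => rfl
  have hJcont : Continuous J := continuous_iff_continuousAt.2 fun s => (hJd s).continuousAt
  have hΨmono : MonotoneOn Ψ (Set.Ici 0) := by
    have hder : ∀ s, 0 < s → HasDerivAt Ψ
        (L * (-(1 / 2) * ∑ z ∈ D, ∑ w ∈ D, c z w * ((g z - g w) * (u s z - u s w)))
        + 2 * b * M * Ac * ((1 / 2) * s ^ (1 / 2 - 1 : ℝ))
        - d / b * ((1 / 2) * s ^ (1 / 2 - 1 : ℝ) * J s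
            + s ^ (1 / 2 : ℝ) * (-(1 / 2) * (1 + ε) * E s))
        + 2 * (d / b) * (1 + C) * ((1 / 4) * s ^ (1 / 4 - 1 : ℝ))) s := by
      intro s hs
      have p1 := Real.hasDerivAt_rpow_const (x := s) (p := (1 / 2 : ℝ)) (Or.inl hs.ne')
      have p2 := Real.hasDerivAt_rpow_const (x := s) (p := (1 / 4 : ℝ)) (Or.inl hs.ne')
      exact ((((hu.hasDerivAt_sum_mul hc.symm hAD g hg0 s).const_mul L).add
        (p1.const_mul _)).sub ((p1.mul (hJd s)).const_mul _)).add (p2.const_mul _)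
    refine monotoneOn_of_hasDerivWithinAt_nonneg (convex_Ici 0) ?_
      (fun s hs => (hder s (by simpa using hs)).hasDerivWithinAt) fun s hs => ?_
    · refine Continuous.continuousOn ?_
      have q1 : Continuous fun s : ℝ => s ^ (1 / 2 : ℝ) := Real.continuous_rpow_const (by norm_num)
      have q2 : Continuous fun s : ℝ => s ^ (1 / 4 : ℝ) := Real.continuous_rpow_const (by norm_num)
      fun_prop
    · have hs : 0 < s := by simpa using hs
      have hβ : 0 < b * s ^ (-(1 / 2) : ℝ) := by positivity
      have key := hu.cutoff_deriv_ge hc hM.le hAD hxA hε0 hε1 hL0 g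
        (abs_coneCutoff_sub_le x₀ hL0) hβ hs.le
      have e1 : s ^ (1 / 2 - 1 : ℝ) = s ^ (-(1 / 2) : ℝ) := by norm_num
      have e2 : s ^ (1 / 4 - 1 : ℝ) = s ^ (-(1 / 2) : ℝ) * s ^ (-(1 / 4) : ℝ) := by
        rw [← Real.rpow_add hs]; norm_num
      have e3 : 1 / (2 * (b * s ^ (-(1 / 2) : ℝ)) * ε) = d / b * s ^ (1 / 2 : ℝ) := by
        rw [hε, Real.rpow_neg hs.le]; field_simp
      rw [e3] at key
      rw [e1, e2]
      have hJ' := hJle s hs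
      set X := s ^ (-(1 / 2) : ℝ) with hX
      have hX0 : 0 < X := by positivity
      set Y := s ^ (1 / 2 : ℝ) with hY
      have hY0 : 0 < Y := by positivity
      have h1 : d / b * X * J s ≤ d / b * X * ((1 + C) * s ^ (-(1 / 4) : ℝ)) := by gcongr
      have h2 : 0 ≤ d / b * Y * (ε * E s) := by
        have := hEnn s hs.le
        positivity
      have h3 : ∑ z ∈ D, ∑ w ∈ D, c z w * ((u s z ^ ε - u s w ^ ε) * (u s z - u s w)) = E s := rfl
      rw [h3] at key
      linarith
  have hfin := hΨmono (Set.mem_Ici.2 le_rfl) (Set.mem_Ici.2 hs.le) hs.le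
  have hΨ0 : Ψ 0 = L * g x := by
    simp only [hΨ]
    rw [hu.init, Real.zero_rpow (by norm_num), Real.zero_rpow (by norm_num)]
    simp [Pi.single_apply, hxA]
  have hgx : 1 - 1 / κ ≤ g x := by
    refine le_trans ?_ (le_max_right _ _)
    rw [mem_latticeBox_iff_norm] at hx
    have : ‖x - x₀‖ / L ≤ 1 / κ := by
      rw [hL, div_le_div_iff₀ (by positivity) (by positivity)]
      nlinarith
    linarith
  have hI : ∑ z ∈ A, g z * u s z ≤ ∑ z ∈ latticeBox x₀ (κ * ℓ), u s z := by
    rw [← Finset.sum_subset hQA fun z _ hz => by rw [hgQ z hz, zero_mul]]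
    refine Finset.sum_le_sum fun z _ => ?_
    have h1 : g z ≤ 1 := max_le zero_le_one (by
      have : 0 ≤ ‖z - x₀‖ / L := by positivity
      linarith)
    nlinarith [hu.nonneg s hs.le z]
  refine le_trans ?_ hI
  have hsh : s ^ (1 / 2 : ℝ) ≤ ℓ := by
    rw [← Real.sqrt_eq_rpow]
    exact Real.sqrt_le_iff.2 ⟨by positivity, hsℓ⟩
  have hsq : s ^ (1 / 4 : ℝ) ≤ Real.sqrt ℓ := by
    have : s ^ (1 / 4 : ℝ) = Real.sqrt (s ^ (1 / 2 : ℝ)) := by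
      rw [Real.sqrt_eq_rpow, ← Real.rpow_mul hs.le]; norm_num
    rw [this]
    exact Real.sqrt_le_sqrt hsh
  have hsqℓ : Real.sqrt ℓ * Real.sqrt ℓ = ℓ := Real.mul_self_sqrt (by positivity)
  have hsqℓ0 : 0 < Real.sqrt ℓ := by positivity
  have hsqκ : Real.sqrt κ * Real.sqrt κ = κ := Real.mul_self_sqrt (by positivity)
  have hsqκ1 : 1 ≤ Real.sqrt κ := Real.one_le_sqrt.2 hκ1
  have t1 : 2 * b * M * Ac * s ^ (1 / 2 : ℝ) ≤ 2 * M * Real.sqrt 5 * Real.sqrt κ * ℓ := by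
    calc 2 * b * M * Ac * s ^ (1 / 2 : ℝ)
        ≤ 2 * b * M * Real.sqrt (5 * (κ * ℓ)) * ℓ := by gcongr
      _ = _ := by
          rw [Real.sqrt_mul (by norm_num), Real.sqrt_mul (by positivity), hb]
          field_simp
  have t2 : 2 * (d / b) * (1 + C) * s ^ (1 / 4 : ℝ) ≤ 2 * d * (1 + C) * ℓ := by
    calc 2 * (d / b) * (1 + C) * s ^ (1 / 4 : ℝ)
        ≤ 2 * (d / b) * (1 + C) * Real.sqrt ℓ := by gcongr
      _ = 2 * d * (1 + C) * (Real.sqrt ℓ * Real.sqrt ℓ) := by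
          rw [hb]; field_simp
      _ = _ := by rw [hsqℓ]
  have t3 : 0 ≤ d / b * (s ^ (1 / 2 : ℝ) * J s) := by
    have := hJnn s hs.le
    positivity
  rw [hΨ0] at hfin
  simp only [hΨ] at hfin
  have h5 : L * (1 - 1 / κ) ≤ L * g x := by gcongr
  have h6 : L * (1 - 1 / κ) - 2 * M * Real.sqrt 5 * Real.sqrt κ * ℓ - 2 * d * (1 + C) * ℓ
      ≤ L * ∑ z ∈ A, g z * u s z := by linarith
  refine le_of_mul_le_mul_left (le_trans ?_ h6) hL0
  have e : L * (1 - (1 + 2 * M * Real.sqrt 5 + 2 * d * (1 + C)) / Real.sqrt κ)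
      = L - ℓ * Real.sqrt κ * (1 + 2 * M * Real.sqrt 5 + 2 * d * (1 + C)) := by
    rw [hL, mul_sub, mul_one]
    congr 1
    nth_rewrite 1 [← hsqκ]
    field_simp
  have e' : L * (1 - 1 / κ) = L - ℓ := by
    rw [hL]; field_simp
  rw [e, e']
  have h7 : (ℓ : ℝ) ≤ ℓ * Real.sqrt κ := by nlinarith
  have h8 : 2 * d * (1 + C) * ℓ ≤ 2 * d * (1 + C) * (ℓ * Real.sqrt κ) := by gcongr
  linarith

/-- Most of the mass being in the cube and the `ℓ²` bound force the solution to be of the order of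
`ℓ ^ (-d)` on a positive fraction of the cube. -/
lemma exists_card_large_ge {d : ℕ} (hd : 1 ≤ d) (m₀ : ℕ) {K₀ M : ℝ} (hK₀ : 0 < K₀) (hM : 0 < M) :
    ∃ κ₀ : ℕ, ∀ κ : ℕ, κ₀ ≤ κ → 1 ≤ κ → ∃ h cH : ℝ, 0 < h ∧ h < 1 ∧ 0 < cH ∧
      ∀ (c : (Fin d → ℤ) → (Fin d → ℤ) → ℝ) (ρ ℓ : ℕ)
      (x₀ x : Fin d → ℤ) (u : ℝ → (Fin d → ℤ) → ℝ), IsLatticeConductance c m₀ ρ K₀ M →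
      m₀ + 1 ≤ ρ → 1 ≤ ℓ → x ∈ latticeBox x₀ ℓ →
      IsKilledHeatSolution c (latticeBox x₀ (2 * κ * ℓ)) (latticeBox x₀ (2 * κ * ℓ + ρ)) x u →
      ∀ s, (ℓ : ℝ) ^ 2 / 16 ≤ s → s ≤ (ℓ : ℝ) ^ 2 →
        cH * (ℓ : ℝ) ^ d ≤
          ((latticeBox x₀ (κ * ℓ)).filter (fun z => h ≤ (ℓ : ℝ) ^ d * u s z)).card := by
  obtain ⟨C, hC, Hmass⟩ := exists_mass_ge hd m₀ hK₀ hM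
  obtain ⟨C', hC', HL2⟩ := exists_sum_sq_le hd m₀ hK₀
  refine ⟨⌈(2 * C) ^ 2⌉₊, fun κ hκ₀ hκ => ?_⟩
  have hκ1 : (1 : ℝ) ≤ κ := by exact_mod_cast hκ
  set h : ℝ := 1 / (4 * (3 * κ) ^ d) with hh
  refine ⟨h, 1 / (16 * (C' * 4 ^ d)), by positivity, ?_, by positivity, ?_⟩
  · rw [hh, div_lt_one (by positivity)]
    have : 1 ≤ (3 * κ : ℝ) ^ d := one_le_pow₀ (by linarith)
    linarith
  intro c ρ ℓ x₀ x u hc hρ hℓ hx hu s hs1 hs2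
  have hℓ1 : (1 : ℝ) ≤ ℓ := by exact_mod_cast hℓ
  have hs0 : 0 < s := lt_of_lt_of_le (by positivity) hs1
  have hκℓ : ℓ ≤ 2 * κ * ℓ := by nlinarith
  have hmass := Hmass c ρ κ ℓ x₀ x u hc hρ hκ hℓ hx hu s hs0 hs2
  have hF := HL2 c ρ (2 * κ * ℓ) M x₀ x u hc hρ (latticeBox_mono x₀ hκℓ hx) hu s hs0
  have hCκ : C / Real.sqrt κ ≤ 1 / 2 := by
    have : 2 * C ≤ Real.sqrt κ := by
      refine Real.le_sqrt_of_sq_le ?_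
      exact (Nat.le_ceil _).trans (by exact_mod_cast hκ₀)
    rw [div_le_div_iff₀ (by positivity) (by norm_num)]
    linarith
  set Q := latticeBox x₀ (κ * ℓ) with hQ
  have hQA : Q ⊆ latticeBox x₀ (2 * κ * ℓ) := latticeBox_mono x₀ (by nlinarith)
  set H := Q.filter (fun z => h ≤ (ℓ : ℝ) ^ d * u s z) with hH
  have hun := hu.nonneg s hs0.le
  have hcardQ : (Q.card : ℝ) ≤ (3 * κ : ℝ) ^ d * (ℓ : ℝ) ^ d := by
    rw [hQ, card_latticeBox, ← mul_pow]
    push_cast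
    gcongr
    nlinarith
  have hN : (0 : ℝ) < (ℓ : ℝ) ^ d := by positivity
  have hrest : ∑ z ∈ Q with ¬ h ≤ (ℓ : ℝ) ^ d * u s z, u s z ≤ 1 / 4 := by
    calc ∑ z ∈ Q with ¬ h ≤ (ℓ : ℝ) ^ d * u s z, u s z
        ≤ ∑ z ∈ Q with ¬ h ≤ (ℓ : ℝ) ^ d * u s z, h / (ℓ : ℝ) ^ d := by
          refine Finset.sum_le_sum fun z hz => ?_
          have := (Finset.mem_filter.1 hz).2
          rw [le_div_iff₀ hN]; linarith
      _ ≤ ∑ z ∈ Q, h / (ℓ : ℝ) ^ d :=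
          Finset.sum_le_sum_of_subset_of_nonneg (Finset.filter_subset _ _)
            fun _ _ _ => by positivity
      _ = Q.card * (h / (ℓ : ℝ) ^ d) := by rw [Finset.sum_const, nsmul_eq_mul]
      _ ≤ (3 * κ : ℝ) ^ d * (ℓ : ℝ) ^ d * (h / (ℓ : ℝ) ^ d) := by gcongr
      _ = 1 / 4 := by rw [hh]; field_simp
  have hHmass : 1 / 4 ≤ ∑ z ∈ H, u s z := by
    have := Finset.sum_filter_add_sum_filter_not Q (fun z => h ≤ (ℓ : ℝ) ^ d * u s z) (u s)
    linarith
  have hHsq : ∑ z ∈ H, u s z ^ 2 ≤ C' * 4 ^ d / (ℓ : ℝ) ^ d := by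
    calc ∑ z ∈ H, u s z ^ 2 ≤ ∑ z ∈ latticeBox x₀ (2 * κ * ℓ), u s z ^ 2 :=
          Finset.sum_le_sum_of_subset_of_nonneg ((Finset.filter_subset _ _).trans hQA)
            fun _ _ _ => sq_nonneg _
      _ ≤ C' * s ^ (-(d : ℝ) / 2) := hF
      _ ≤ C' * ((ℓ : ℝ) ^ 2 / 16) ^ (-(d : ℝ) / 2) := by
          gcongr ?_ * ?_
          refine Real.rpow_le_rpow_of_nonpos (by positivity) hs1 ?_
          have : (0 : ℝ) ≤ d := by positivity
          linarith
      _ = C' * 4 ^ d / (ℓ : ℝ) ^ d := by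
          have e : ((ℓ : ℝ) ^ 2 / 16) = ((ℓ : ℝ) / 4) ^ (2 : ℝ) := by
            rw [Real.rpow_two]; ring
          rw [e, ← Real.rpow_mul (by positivity)]
          have e2 : (2 : ℝ) * (-(d : ℝ) / 2) = -(d : ℝ) := by ring
          rw [e2, Real.rpow_neg (by positivity), Real.rpow_natCast, div_pow]
          field_simp
  have hcs := sq_sum_le_card_mul_sum_sq (s := H) (f := u s)
  have h16 : 1 / 16 ≤ (H.card : ℝ) * (C' * 4 ^ d / (ℓ : ℝ) ^ d) := by
    calc (1 / 16 : ℝ) = (1 / 4) ^ 2 := by norm_num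
      _ ≤ (∑ z ∈ H, u s z) ^ 2 := by gcongr
      _ ≤ _ := hcs
      _ ≤ _ := by gcongr
  rw [mul_div_assoc', le_div_iff₀ hN] at h16
  rw [div_mul_eq_mul_div, div_le_iff₀ (by positivity)]
  linarith

/-! ### Inequalities for the logarithm of a heat solution -/

/-- The logarithmic form of `y² ≤ sinh² y`. -/
lemma log_sq_le {q : ℝ} (hq : 0 < q) : Real.log q ^ 2 ≤ q + q⁻¹ - 2 := by
  set y := Real.log q / 2 with hy
  have h1 : |y| ≤ |Real.sinh y| := by
    rw [Real.abs_sinh]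
    exact Real.self_le_sinh_iff.2 (abs_nonneg y)
  have h2 : y ^ 2 ≤ Real.sinh y ^ 2 := sq_le_sq.2 h1
  have hqe : Real.exp y * Real.exp y = q := by
    rw [← Real.exp_add, hy, add_halves, Real.exp_log hq]
  have hqe' : Real.exp (-y) * Real.exp (-y) = q⁻¹ := by
    rw [← hqe, mul_inv, Real.exp_neg]
  have hee : Real.exp y * Real.exp (-y) = 1 := by rw [← Real.exp_add]; simp
  rw [Real.sinh_eq] at h2
  have : Real.log q = 2 * y := by rw [hy]; ring
  rw [this]
  nlinarith

/-- The pointwise inequality behind the logarithmic energy estimate. -/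
lemma cutoff_log_inequality {a b u w : ℝ} (ha : 0 ≤ a) (hb : 0 ≤ b) (hu : 0 < u) (hw : 0 < w) :
    (a ^ 2 / u - b ^ 2 / w) * (u - w)
      ≤ 5 * (a - b) ^ 2 - 1 / 2 * (min a b ^ 2 * (Real.log u - Real.log w) ^ 2) := by
  wlog hab : b ≤ a generalizing a b u w
  · have := this hb ha hw hu (le_of_not_ge hab)
    rw [min_comm]
    calc _ = (b ^ 2 / w - a ^ 2 / u) * (w - u) := by ring
      _ ≤ _ := this
      _ = _ := by ring
  rw [min_eq_right hab]
  set q := w / u with hq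
  have hq0 : 0 < q := by positivity
  have hlog := log_sq_le hq0
  rw [hq, Real.log_div hw.ne' hu.ne', ← hq] at hlog
  have hl2 : (Real.log u - Real.log w) ^ 2 ≤ q + q⁻¹ - 2 := by
    calc _ = (Real.log w - Real.log u) ^ 2 := by ring
      _ ≤ _ := hlog
  have e : (a ^ 2 / u - b ^ 2 / w) * (u - w)
      = (a ^ 2 - b ^ 2) * (1 - q) - b ^ 2 * (q + q⁻¹ - 2) := by
    rw [hq]; field_simp; ring
  rw [e]
  have hl0 : 0 ≤ q + q⁻¹ - 2 := le_trans (sq_nonneg _) hl2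
  have h1 := mul_le_mul_of_nonneg_left hl2 (sq_nonneg b)
  have h2 : 0 ≤ b ^ 2 * (q + q⁻¹ - 2) := by positivity
  have hsq := sq_nonneg (a - b)
  suffices (a ^ 2 - b ^ 2) * (1 - q) ≤ 5 * (a - b) ^ 2 + 1 / 2 * (b ^ 2 * (q + q⁻¹ - 2)) by
    linarith
  rcases le_or_gt 1 q with h | h
  · have : (a ^ 2 - b ^ 2) * (1 - q) ≤ 0 :=
      mul_nonpos_of_nonneg_of_nonpos (by nlinarith) (by linarith)
    linarith
  · have e3 : q + q⁻¹ - 2 = (1 - q) ^ 2 * q⁻¹ := by field_simp; ring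
    have h4 : (1 - q) ^ 2 ≤ q + q⁻¹ - 2 := by
      rw [e3]
      exact le_mul_of_one_le_right (sq_nonneg _) ((one_le_inv₀ hq0).2 h.le)
    have h5 := mul_le_mul_of_nonneg_left h4 (sq_nonneg b)
    rcases le_or_gt a (2 * b) with h6 | h6
    · have h7 : (a ^ 2 - b ^ 2) * (1 - q) ≤ 3 * b * (a - b) * (1 - q) := by
        refine mul_le_mul_of_nonneg_right ?_ (by linarith)
        nlinarith
      nlinarith [sq_nonneg (3 * (a - b) - b * (1 - q))]
    · have h7 : (a ^ 2 - b ^ 2) * (1 - q) ≤ a ^ 2 * 1 :=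
        mul_le_mul (by nlinarith) (by linarith) (by linarith) (sq_nonneg a)
      nlinarith

/-- A Riccati type differential inequality forgets how negative its initial value is: below `-B`
the function grows at least quadratically, on the time scale `Λ`, so it cannot still be far below
`-B` at time `T`. The constant `C₅` does not depend on `B`. -/
lemma riccati_lower_bound {C₁ c₂ : ℝ} (hC₁ : 0 < C₁) (hc₂ : 0 < c₂) :
    ∃ C₅ : ℝ, 0 < C₅ ∧ ∀ (γ γ' : ℝ → ℝ) (B T Λ : ℝ), 0 ≤ B → 0 < Λ → Λ / 8 ≤ T → T ≤ Λ →
      (∀ s ∈ Set.Icc (T / 2) T, HasDerivAt γ (γ' s) s) →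
      (∀ s ∈ Set.Icc (T / 2) T, -C₁ / Λ ≤ γ' s) →
      (∀ s ∈ Set.Icc (T / 2) T, γ s ≤ -B → (c₂ * γ s ^ 2 - C₁) / Λ ≤ γ' s) →
      -(B + C₅) ≤ γ T := by
  set B' : ℝ := 32 / c₂ + 2 * C₁ / c₂ + 1 with hB'
  have hB'1 : 1 ≤ B' := by
    have : 0 ≤ 32 / c₂ + 2 * C₁ / c₂ := by positivity
    linarith
  refine ⟨C₁ + B', by positivity, ?_⟩
  intro γ γ' B T Λ hB hΛ hT1 hT2 hder h1 h2
  by_contra hcon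
  push Not at hcon
  have hT0 : 0 < T := lt_of_lt_of_le (by positivity) hT1
  have hTT : T / 2 ≤ T := by linarith
  -- the linear lower bound on the derivative propagates the assumption backwards in time
  have hneg : ∀ s ∈ Set.Icc (T / 2) T, γ s < -(B + B') := by
    intro s hs
    have hmono : MonotoneOn (fun s => γ s + C₁ / Λ * s) (Set.Icc (T / 2) T) := by
      have hd : ∀ s ∈ Set.Icc (T / 2) T,
          HasDerivAt (fun s => γ s + C₁ / Λ * s) (γ' s + C₁ / Λ) s := fun s hs => by
        have h1 := hder s hs
        have h2 := (hasDerivAt_id s).const_mul (C₁ / Λ)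
        rw [mul_one] at h2
        exact h1.add h2
      refine monotoneOn_of_hasDerivWithinAt_nonneg (convex_Icc _ _)
        (fun q hq => (hd q hq).continuousAt.continuousWithinAt)
        (fun q hq => (hd q (interior_subset hq)).hasDerivWithinAt) fun q hq => ?_
      have := h1 q (interior_subset hq)
      rw [neg_div] at this
      linarith
    have := hmono hs (Set.right_mem_Icc.2 hTT) hs.2
    simp only at this
    have h3 : C₁ / Λ * T - C₁ / Λ * s ≤ C₁ := by
      rw [← mul_sub, div_mul_eq_mul_div, div_le_iff₀ hΛ]
      have : T - s ≤ Λ := by linarith [hs.1]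
      nlinarith
    linarith
  have hlt : ∀ s ∈ Set.Icc (T / 2) T, γ s < -B' := fun s hs => by linarith [hneg s hs]
  -- the negative reciprocal grows linearly, which bounds it below by `c₂ / 32` at time `T`
  have hmono : MonotoneOn (fun s => -(γ s)⁻¹ - c₂ / (2 * Λ) * s) (Set.Icc (T / 2) T) := by
    have hd : ∀ s ∈ Set.Icc (T / 2) T, HasDerivAt (fun s => -(γ s)⁻¹ - c₂ / (2 * Λ) * s)
        (-(-γ' s / γ s ^ 2) - c₂ / (2 * Λ)) s := fun s hs => by
      have hne : γ s ≠ 0 := by have := hlt s hs; intro h0; rw [h0] at this; linarith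
      have h1 := ((hder s hs).inv hne).neg
      have h2 := (hasDerivAt_id s).const_mul (c₂ / (2 * Λ))
      rw [mul_one] at h2
      exact h1.sub h2
    refine monotoneOn_of_hasDerivWithinAt_nonneg (convex_Icc _ _)
      (fun q hq => (hd q hq).continuousAt.continuousWithinAt)
      (fun q hq => (hd q (interior_subset hq)).hasDerivWithinAt) fun q hq => ?_
    have hq := interior_subset hq
    have hl := hlt q hq
    have hr := h2 q hq (by linarith [hneg q hq])
    have hsq0 : 0 < γ q ^ 2 := by nlinarith
    have hbig : 2 * C₁ ≤ c₂ * γ q ^ 2 := by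
      have h3 : B' ≤ γ q ^ 2 := by nlinarith
      have h4 : 2 * C₁ / c₂ ≤ B' := by
        have : 0 ≤ 32 / c₂ := by positivity
        linarith
      have h5 : 2 * C₁ / c₂ ≤ γ q ^ 2 := h4.trans h3
      rw [div_le_iff₀ hc₂] at h5
      linarith
    have h6 : c₂ * γ q ^ 2 / (2 * Λ) ≤ γ' q := by
      refine le_trans ?_ hr
      rw [div_le_div_iff₀ (by positivity) hΛ]
      nlinarith
    have h7 : c₂ / (2 * Λ) ≤ γ' q / γ q ^ 2 := by
      rw [le_div_iff₀ hsq0]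
      calc _ = c₂ * γ q ^ 2 / (2 * Λ) := by ring
        _ ≤ _ := h6
    rw [neg_div, neg_neg]
    linarith
  have hfin := hmono (Set.left_mem_Icc.2 hTT) (Set.right_mem_Icc.2 hTT) hTT
  simp only at hfin
  have hi : 0 < -(γ (T / 2))⁻¹ := by
    have := hlt _ (Set.left_mem_Icc.2 hTT)
    rw [Left.neg_pos_iff, inv_lt_zero]
    linarith
  have h3 : c₂ / 32 ≤ -(γ T)⁻¹ := by
    have : c₂ / 32 ≤ c₂ / (2 * Λ) * T - c₂ / (2 * Λ) * (T / 2) := by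
      have e : c₂ / (2 * Λ) * T - c₂ / (2 * Λ) * (T / 2) = c₂ * T / (4 * Λ) := by
        field_simp; norm_num
      rw [e, div_le_div_iff₀ (by norm_num) (by positivity)]
      nlinarith
    linarith
  have hT := hlt T (Set.right_mem_Icc.2 hTT)
  have h32 : 32 / c₂ < -γ T := by
    have : 0 ≤ 2 * C₁ / c₂ := by positivity
    linarith
  have : c₂ / 32 * (32 / c₂) < -(γ T)⁻¹ * -γ T :=
    mul_lt_mul' h3 h32 (by positivity) (lt_of_lt_of_le (by positivity) h3)
  rw [neg_mul_neg, inv_mul_cancel₀ (by linarith : γ T < 0).ne] at this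
  have e : c₂ / 32 * (32 / c₂) = 1 := by field_simp
  linarith

/-- The cutoff that equals `1` within distance `r` of `x₀` and decreases linearly to `0` over a layer
of width `a`. -/
noncomputable def plateauCutoff {d : ℕ} (x₀ : Fin d → ℤ) (r a : ℝ) (z : Fin d → ℤ) : ℝ :=
  max (min (1 - (‖z - x₀‖ - r) / a) 1) 0

section plateauCutoff

variable {d : ℕ} (x₀ : Fin d → ℤ) {r a : ℝ}

lemma plateauCutoff_nonneg (z : Fin d → ℤ) : 0 ≤ plateauCutoff x₀ r a z := le_max_right _ _

lemma plateauCutoff_le_one (z : Fin d → ℤ) : plateauCutoff x₀ r a z ≤ 1 :=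
  max_le (min_le_right _ _) zero_le_one

lemma plateauCutoff_eq_one (ha : 0 < a) {z : Fin d → ℤ} (hz : ‖z - x₀‖ ≤ r) :
    plateauCutoff x₀ r a z = 1 := by
  have : (‖z - x₀‖ - r) / a ≤ 0 := div_nonpos_of_nonpos_of_nonneg (by linarith) ha.le
  rw [plateauCutoff, min_eq_right (by linarith), max_eq_left zero_le_one]

lemma plateauCutoff_eq_zero (ha : 0 < a) {z : Fin d → ℤ} (hz : r + a < ‖z - x₀‖) :
    plateauCutoff x₀ r a z = 0 := by
  have : 1 ≤ (‖z - x₀‖ - r) / a := by rw [le_div_iff₀ ha]; linarith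
  exact max_eq_right ((min_le_left _ _).trans (by linarith))

lemma half_le_plateauCutoff (ha : 0 < a) {z : Fin d → ℤ} (hz : ‖z - x₀‖ ≤ r + a / 2) :
    1 / 2 ≤ plateauCutoff x₀ r a z := by
  have : (‖z - x₀‖ - r) / a ≤ 1 / 2 := by rw [div_le_iff₀ ha]; linarith
  exact (le_min (by linarith) (by norm_num)).trans (le_max_left _ _)

lemma abs_plateauCutoff_sub_le (ha : 0 < a) (z w : Fin d → ℤ) :
    |plateauCutoff x₀ r a z - plateauCutoff x₀ r a w| ≤ ‖z - w‖ / a := by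
  refine (abs_max_sub_max_le_abs _ _ 0).trans ((abs_min_sub_min_le_max _ _ _ _).trans ?_)
  rw [sub_self, abs_zero]
  refine max_le ?_ (by positivity)
  have e : (1 - (‖z - x₀‖ - r) / a) - (1 - (‖w - x₀‖ - r) / a) = (‖w - x₀‖ - ‖z - x₀‖) / a := by
    ring
  rw [e, abs_div, abs_of_pos ha]
  gcongr
  refine (abs_norm_sub_norm_le _ _).trans (le_of_eq ?_)
  rw [sub_sub_sub_cancel_right, norm_sub_rev]

end plateauCutoff

/-- If `f` is at least `l` on `H` and its mean `μ` over `Q` is much more negative, then `f` has a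
large variance. -/
lemma sum_pair_sq_ge {V : Type*} {Q H : Finset V} (hH : H ⊆ Q) (f : V → ℝ) {l μ : ℝ}
    (hl : ∀ z ∈ H, l ≤ f z) (hmean : ∑ z ∈ Q, f z = Q.card * μ) (hμl : μ ≤ 2 * l) (hμ : μ ≤ 0) :
    (Q.card : ℝ) * H.card * (μ ^ 2 / 4) ≤ ∑ a ∈ Q, ∑ b ∈ Q, (f a - f b) ^ 2 := by
  rcases Q.eq_empty_or_nonempty with rfl | hne
  · simp
  have hQ : (0 : ℝ) < Q.card := by exact_mod_cast hne.card_pos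
  rw [Finset.sum_comm]
  calc (Q.card : ℝ) * H.card * (μ ^ 2 / 4) = ∑ _b ∈ H, (Q.card : ℝ) * (μ ^ 2 / 4) := by
        rw [Finset.sum_const, nsmul_eq_mul]; ring
    _ ≤ ∑ b ∈ H, ∑ a ∈ Q, (f a - f b) ^ 2 := by
        refine Finset.sum_le_sum fun b hb => ?_
        have hcs := sq_sum_le_card_mul_sum_sq (s := Q) (f := fun a => f a - f b)
        have e : ∑ a ∈ Q, (f a - f b) = Q.card * (μ - f b) := by
          rw [Finset.sum_sub_distrib, hmean, Finset.sum_const, nsmul_eq_mul]; ring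
        rw [e, mul_pow, sq (Q.card : ℝ), mul_assoc] at hcs
        have h1 := le_of_mul_le_mul_left hcs hQ
        refine le_trans ?_ h1
        gcongr
        nlinarith [hl b hb]
    _ ≤ _ := Finset.sum_le_sum_of_subset_of_nonneg hH fun b _ _ =>
        Finset.sum_nonneg fun a _ => sq_nonneg _

/-! ### The lower bound on most of a cube -/

/-- The logarithmic energy estimate: the derivative of `∑ ψ² log (N u + η)` is bounded below by the
energy of the logarithm, weighted with the smaller value of the cutoff, up to the energy of `ψ`. -/
lemma IsKilledHeatSolution.exists_hasDerivAt_log {V : Type*} [DecidableEq V] {c : V → V → ℝ}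
    {A D : Finset V} {x : V} {u : ℝ → V → ℝ} (hu : IsKilledHeatSolution c A D x u)
    (hsymm : ∀ z w, c z w = c w z) (hnn : ∀ z w, 0 ≤ c z w) (hAD : A ⊆ D) (ψ : V → ℝ)
    (hψ : ∀ z, 0 ≤ ψ z) (hψA : ∀ z, z ∉ A → ψ z = 0) {N η : ℝ} (hN : 0 ≤ N) (hη : 0 < η)
    {s : ℝ} (hs : 0 ≤ s) :
    ∃ G' : ℝ, HasDerivAt (fun s => ∑ z ∈ A, ψ z ^ 2 * Real.log (N * u s z + η)) G' s ∧
      -(5 / 2) * ∑ z ∈ D, ∑ w ∈ D, c z w * (ψ z - ψ w) ^ 2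
        + 1 / 4 * ∑ z ∈ D, ∑ w ∈ D, c z w * (min (ψ z) (ψ w) ^ 2
          * (Real.log (N * u s z + η) - Real.log (N * u s w + η)) ^ 2) ≤ G' := by
  have hv : ∀ z, 0 < N * u s z + η := fun z => by
    have := mul_nonneg hN (hu.nonneg s hs z); linarith
  refine ⟨_, hu.hasDerivAt_sum_comp hsymm hAD (fun z v => ψ z ^ 2 * Real.log (N * v + η))
    (fun z v => ψ z ^ 2 * (N / (N * v + η))) s (fun z _ => ?_)
    (fun z hz => by rw [hψA z hz]; simp), ?_⟩
  · have h1 : HasDerivAt (fun v => N * v + η) N (u s z) := by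
      simpa using ((hasDerivAt_id (u s z)).const_mul N).add_const η
    exact (h1.log (hv z).ne').const_mul _
  · simp only [Finset.mul_sum, ← Finset.sum_add_distrib]
    refine Finset.sum_le_sum fun z _ => Finset.sum_le_sum fun w _ => ?_
    have h := mul_le_mul_of_nonneg_left
      (cutoff_log_inequality (hψ z) (hψ w) (hv z) (hv w)) (hnn z w)
    have e : (ψ z ^ 2 * (N / (N * u s z + η)) - ψ w ^ 2 * (N / (N * u s w + η)))
        * (u s z - u s w) = (ψ z ^ 2 / (N * u s z + η) - ψ w ^ 2 / (N * u s w + η))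
        * (N * u s z + η - (N * u s w + η)) := by ring
    rw [e]
    linarith

/-- The energy near a cube is large if the mean `μ` of `f` over the cube is much smaller than the
values of `f` on a subset `H`. -/
lemma IsLatticeConductance.energy_ge_of_mean {d : ℕ} {c : (Fin d → ℤ) → (Fin d → ℤ) → ℝ} {m₀ ρ : ℕ}
    {K₀ M : ℝ} (hc : IsLatticeConductance c m₀ ρ K₀ M) (hK₀ : 0 ≤ K₀) (x₀ : Fin d → ℤ) (m : ℕ)
    (f : (Fin d → ℤ) → ℝ) {H : Finset (Fin d → ℤ)} (hH : H ⊆ latticeBox x₀ m) {l μ : ℝ}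
    (hl : ∀ z ∈ H, l ≤ f z)
    (hmean : ∑ z ∈ latticeBox x₀ m, f z = (latticeBox x₀ m).card * μ) (hμl : μ ≤ 2 * l)
    (hμ : μ ≤ 0) :
    ((latticeBox x₀ m).card : ℝ) * H.card * (μ ^ 2 / 4)
      ≤ (4 * m + 1 : ℝ) ^ d * (2 * d * m : ℝ) ^ 2 *
        (K₀ * d * (2 * m₀ + 1) ^ d * dirichletEnergy c (latticeBox x₀ (m + m₀)) f) := by
  refine (sum_pair_sq_ge hH f hl hmean hμl hμ).trans ((poincare_latticeBox x₀ m f).trans ?_)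
  refine mul_le_mul_of_nonneg_left ?_ (by positivity)
  exact hc.gradEnergy_le hK₀ _ _ f fun z hz i _ w hw => mem_latticeBox_trans hz hw le_rfl

/-- The bookkeeping of constants in the lower bound on the energy. -/
lemma energy_constants {q N B ℓ cH K₁ P₁ E nH μ γ W : ℝ} (hq : 0 < q) (hB : 0 < B)
    (hcH : 0 < cH) (hK₁ : 0 < K₁) (hP₁ : 0 < P₁) (hE : 0 ≤ E) (hℓ : 0 < ℓ) (hQN : q ≤ B * N)
    (hH : cH * N ≤ nH) (hμγ : μ ≤ γ / 2) (hγ : γ ≤ 0) (hW : W ≤ P₁ * q * ℓ ^ 2)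
    (h : q * nH * (μ ^ 2 / 4) ≤ W * (K₁ * E)) :
    16 * (cH / B / (256 * K₁ * P₁)) * γ ^ 2 * q / ℓ ^ 2 ≤ E := by
  have h3 : γ ^ 2 / 4 ≤ μ ^ 2 := by nlinarith
  have h4 : cH / B * q ≤ nH := by
    refine le_trans ?_ hH
    rw [div_mul_eq_mul_div, div_le_iff₀ hB]
    nlinarith
  have hnH : 0 ≤ nH := le_trans (by positivity) h4
  have h5 : q * (cH / B * q) * (γ ^ 2 / 4 / 4) ≤ P₁ * q * ℓ ^ 2 * (K₁ * E) := by
    have h6 : q * (cH / B * q) * (γ ^ 2 / 4 / 4) ≤ q * nH * (μ ^ 2 / 4) := by gcongr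
    have h7 : W * (K₁ * E) ≤ P₁ * q * ℓ ^ 2 * (K₁ * E) := by gcongr
    linarith
  rw [div_le_iff₀ (by positivity)]
  have h7 : q * K₁ * P₁ * (16 * (cH / B / (256 * K₁ * P₁)) * γ ^ 2 * q)
      ≤ q * K₁ * P₁ * (E * ℓ ^ 2) := by
    calc _ = q * (cH / B * q) * (γ ^ 2 / 4 / 4) := by field_simp; ring
      _ ≤ _ := h5
      _ = _ := by ring
  exact le_of_mul_le_mul_left h7 (by positivity)

/-- A layer of width `2 m₀ ℓ` around a cube of radius `κ ℓ` adds at most a twelfth of its volume. -/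
lemma exists_layer_ratio (d m₀ : ℕ) :
    ∃ κ₀ : ℕ, ∀ κ : ℕ, κ₀ ≤ κ → (1 + 2 * m₀ / κ : ℝ) ^ d ≤ 13 / 12 := by
  have h1 : Filter.Tendsto (fun κ : ℕ => (1 + 2 * m₀ / κ : ℝ) ^ d) Filter.atTop (nhds 1) := by
    have := ((tendsto_const_div_atTop_nhds_zero_nat (2 * m₀ : ℝ)).const_add 1).pow d
    simpa using this
  obtain ⟨κ₀, h⟩ := Filter.eventually_atTop.1 (h1.eventually_le_const (show (1 : ℝ) < 13 / 12 by
    norm_num))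
  exact ⟨κ₀, h⟩

lemma neg_le_weight_mul {p f Λ : ℝ} (hp0 : 0 ≤ p) (hp1 : p ≤ 1) (hΛ : 0 ≤ Λ) (hf : -Λ ≤ f) :
    -Λ ≤ p * f := by
  nlinarith

lemma weight_mul_le {p f v : ℝ} (hp0 : 0 ≤ p) (hp1 : p ≤ 1) (hv : 0 ≤ v) (hf : f ≤ v) :
    p * f ≤ v := by
  nlinarith

lemma nested_radii {κ m₀ ℓ : ℕ} (hκ : 2 * m₀ ≤ κ) (hm₀ : 1 ≤ m₀) (hℓ : 1 ≤ ℓ) :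
    m₀ + 1 ≤ 2 * m₀ * ℓ ∧ ℓ ≤ 2 * κ * ℓ ∧ κ * ℓ ≤ 2 * κ * ℓ ∧ κ * ℓ + 2 * m₀ * ℓ ≤ 2 * κ * ℓ ∧
      κ * ℓ + m₀ ≤ 2 * κ * ℓ + 2 * m₀ * ℓ := by
  have h1 : m₀ ≤ m₀ * ℓ := Nat.le_mul_of_pos_right _ hℓ
  have h2 : 2 * m₀ * ℓ ≤ κ * ℓ := Nat.mul_le_mul_right ℓ hκ
  have h3 : ℓ ≤ κ * ℓ := Nat.le_mul_of_pos_left _ (by omega)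
  have e1 : 2 * m₀ * ℓ = 2 * (m₀ * ℓ) := by ring
  have e2 : 2 * κ * ℓ = 2 * (κ * ℓ) := by ring
  omega

set_option maxHeartbeats 1000000 in
/-- The lower bound on most of the cube: at time of order `ℓ²` the solution is at least a constant
times `ℓ ^ (-d)`, except on at most a third of the cube of radius `κ ℓ`. -/
lemma exists_card_small_le {d : ℕ} (hd : 1 ≤ d) {m₀ : ℕ} (hm₀ : 1 ≤ m₀) {K₀ M : ℝ} (hK₀ : 0 < K₀)
    (hM : 0 < M) :
    ∃ (κ : ℕ) (η : ℝ), 1 ≤ κ ∧ 0 < η ∧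
      ∀ (c : (Fin d → ℤ) → (Fin d → ℤ) → ℝ) (ℓ : ℕ) (x₀ x : Fin d → ℤ)
      (u : ℝ → (Fin d → ℤ) → ℝ) (T : ℝ), IsLatticeConductance c m₀ (2 * m₀ * ℓ) K₀ M →
      1 ≤ ℓ → x ∈ latticeBox x₀ ℓ →
      IsKilledHeatSolution c (latticeBox x₀ (2 * κ * ℓ)) (latticeBox x₀ (2 * κ * ℓ + 2 * m₀ * ℓ))
        x u →
      (ℓ : ℝ) ^ 2 / 8 ≤ T → T ≤ (ℓ : ℝ) ^ 2 →
        3 * ((latticeBox x₀ (κ * ℓ)).filter (fun z => (ℓ : ℝ) ^ d * u T z < η)).card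
          ≤ (latticeBox x₀ (κ * ℓ)).card := by
  obtain ⟨κ₁, hκ₁⟩ := exists_card_large_ge hd m₀ hK₀ hM
  obtain ⟨κ₂, hκ₂⟩ := exists_layer_ratio d m₀
  set κ := max (max κ₁ κ₂) (2 * m₀) with hκdef
  have hκm : 2 * m₀ ≤ κ := le_max_right _ _
  have hκ1 : 1 ≤ κ := by omega
  have hratio := hκ₂ κ ((le_max_right _ _).trans (le_max_left _ _))
  obtain ⟨h, cH, hh0, hh1, hcH, hlarge⟩ := hκ₁ κ ((le_max_left _ _).trans (le_max_left _ _)) hκ1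
  clear_value κ
  have hd0 : (0 : ℝ) < d := by exact_mod_cast hd
  have hκr : (1 : ℝ) ≤ κ := by exact_mod_cast hκ1
  have hmr : (1 : ℝ) ≤ m₀ := by exact_mod_cast hm₀
  set C₁ : ℝ := M * 3 ^ d with hC₁
  set K₁ : ℝ := K₀ * d * (2 * m₀ + 1) ^ d with hK₁
  have hK₁0 : 0 < K₁ := by positivity
  set P₁ : ℝ := 2 ^ d * (2 * d * κ) ^ 2 with hP₁
  have hP₁0 : 0 < P₁ := by positivity
  set c₂ : ℝ := cH / (3 * κ) ^ d / (256 * K₁ * P₁) with hc₂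
  have hc₂0 : 0 < c₂ := by positivity
  obtain ⟨C₅, hC₅, hric⟩ := riccati_lower_bound (C₁ := C₁) (c₂ := c₂) (by positivity) hc₂0
  have hlogh : Real.log h < 0 := Real.log_neg hh0 hh1
  -- `Λ = -log η` loses `Λ / 6` in the layer and must win `Λ / 3` on the set of small values; the
  -- difference has to beat the constants, which do not depend on `η`
  set Λ : ℝ := 6 * (3 + C₅ + 4 * -Real.log h) with hΛ
  have hΛ18 : 18 ≤ Λ := by linarith
  refine ⟨κ, Real.exp (-Λ), hκ1, Real.exp_pos _, ?_⟩
  intro c ℓ x₀ x u T hc hℓ hx hu hT1 hT2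
  set η := Real.exp (-Λ) with hη
  have hη0 : 0 < η := Real.exp_pos _
  have hη1 : η ≤ 1 := Real.exp_le_one_iff.2 (by linarith)
  have hlogη : Real.log η = -Λ := Real.log_exp _
  have hℓr : (1 : ℝ) ≤ ℓ := by exact_mod_cast hℓ
  obtain ⟨hρ, hn1, hn2, hn3, hn4⟩ := nested_radii hκm hm₀ hℓ
  have hκℓr : (ℓ : ℝ) ≤ κ * ℓ := le_mul_of_one_le_left (by linarith) hκr
  have hAD : latticeBox x₀ (2 * κ * ℓ) ⊆ latticeBox x₀ (2 * κ * ℓ + 2 * m₀ * ℓ) :=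
    latticeBox_mono x₀ (Nat.le_add_right _ _)
  have hxA : x ∈ latticeBox x₀ (2 * κ * ℓ) := latticeBox_mono x₀ hn1 hx
  have hl := hlarge c (2 * m₀ * ℓ) ℓ x₀ x u hc hρ hℓ hx hu
  set A := latticeBox x₀ (2 * κ * ℓ) with hA
  set D := latticeBox x₀ (2 * κ * ℓ + 2 * m₀ * ℓ) with hD
  set Q := latticeBox x₀ (κ * ℓ) with hQ
  set P := latticeBox x₀ (κ * ℓ + m₀) with hP
  set R := latticeBox x₀ (κ * ℓ + 2 * m₀ * ℓ) with hR
  have hQA : Q ⊆ A := latticeBox_mono x₀ hn2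
  have hQR : Q ⊆ R := latticeBox_mono x₀ (Nat.le_add_right _ _)
  have hRA : R ⊆ A := latticeBox_mono x₀ hn3
  have hPD : P ⊆ D := latticeBox_mono x₀ hn4
  set N : ℝ := (ℓ : ℝ) ^ d with hN
  have hN0 : 0 < N := by positivity
  obtain ⟨q, hq⟩ : ∃ q : ℝ, q = Q.card := ⟨_, rfl⟩
  have hcQ : q = (2 * (κ * ℓ) + 1 : ℝ) ^ d := by
    rw [hq, hQ, card_latticeBox]; push_cast; ring
  have hQpos : 0 < q := by rw [hcQ]; positivity
  have hNQ : N ≤ q := by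
    rw [hcQ, hN]; gcongr; linarith
  have hQN : q ≤ (3 * κ) ^ d * N := by
    rw [hcQ, hN, ← mul_pow]; gcongr; linarith
  have hcD : (D.card : ℝ) ≤ 3 ^ d * q := by
    rw [hcQ, hD, card_latticeBox, ← mul_pow]
    push_cast
    gcongr
    have : (2 * m₀ : ℝ) * ℓ ≤ κ * ℓ := by gcongr; exact_mod_cast hκm
    linarith
  have hcR : (R.card : ℝ) ≤ 13 / 12 * q := by
    refine le_trans ?_ (mul_le_mul_of_nonneg_right hratio hQpos.le)
    rw [hcQ, hR, card_latticeBox, ← mul_pow]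
    push_cast
    gcongr
    have e : (1 + 2 * m₀ / κ : ℝ) * (2 * (κ * ℓ) + 1)
        = 2 * (κ * ℓ + 2 * m₀ * ℓ) + 1 + 2 * m₀ / κ := by field_simp; ring
    rw [e]
    have : 0 ≤ (2 * m₀ / κ : ℝ) := by positivity
    linarith
  -- the layer where the cutoff decreases has the width of the range, so that its gradient is `O(1/ℓ)`
  set a : ℝ := 2 * m₀ * ℓ with ha
  have ha0 : 0 < a := by positivity
  set ψ := plateauCutoff x₀ ((κ : ℝ) * ℓ) a with hψ
  have hψ0 : ∀ z, 0 ≤ ψ z := plateauCutoff_nonneg x₀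
  have hψ1 : ∀ z, ψ z ≤ 1 := plateauCutoff_le_one x₀
  have hψQ : ∀ z ∈ Q, ψ z = 1 := fun z hz => by
    rw [hQ, mem_latticeBox_iff_norm] at hz
    exact plateauCutoff_eq_one x₀ ha0 (by push_cast at hz; exact hz)
  have hψR : ∀ z, z ∉ R → ψ z = 0 := fun z hz => by
    rw [hR, mem_latticeBox_iff_norm, not_le] at hz
    exact plateauCutoff_eq_zero x₀ ha0 (by push_cast at hz; exact hz)
  have hψA : ∀ z, z ∉ A → ψ z = 0 := fun z hz => hψR z fun h => hz (hRA h)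
  have hψP : ∀ z ∈ P, 1 / 2 ≤ ψ z := fun z hz => by
    rw [hP, mem_latticeBox_iff_norm] at hz
    refine half_le_plateauCutoff x₀ ha0 (hz.trans ?_)
    push_cast
    have : (m₀ : ℝ) ≤ m₀ * ℓ := le_mul_of_one_le_right (by linarith) hℓr
    rw [ha]
    linarith
  have hunn : ∀ s, 0 ≤ s → ∀ z, 0 ≤ N * u s z := fun s hs z =>
    mul_nonneg hN0.le (hu.nonneg s hs z)
  set f : ℝ → (Fin d → ℤ) → ℝ := fun s z => Real.log (N * u s z + η) with hf
  have hfη : ∀ s, 0 ≤ s → ∀ z, -Λ ≤ f s z := fun s hs z => by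
    rw [← hlogη]
    exact Real.log_le_log hη0 (by linarith [hunn s hs z])
  set G : ℝ → ℝ := fun s => ∑ z ∈ A, ψ z ^ 2 * f s z with hG
  -- the layer contributes little to `G`
  have hGlow : ∀ s, 0 ≤ s → ∑ z ∈ Q, f s z - Λ / 12 * q ≤ G s := by
    intro s hs
    have e1 : G s = ∑ z ∈ R, ψ z ^ 2 * f s z := by
      rw [hG]
      refine (Finset.sum_subset hRA fun z _ hz => by rw [hψR z hz]; ring).symm
    have e2 : ∑ z ∈ R, ψ z ^ 2 * f s z
        = ∑ z ∈ R \ Q, ψ z ^ 2 * f s z + ∑ z ∈ Q, f s z := by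
      rw [← Finset.sum_sdiff hQR]
      congr 1
      exact Finset.sum_congr rfl fun z hz => by rw [hψQ z hz]; ring
    have e3 : -(Λ * (R \ Q).card) ≤ ∑ z ∈ R \ Q, ψ z ^ 2 * f s z := by
      have : ∑ z ∈ R \ Q, (-Λ) ≤ ∑ z ∈ R \ Q, ψ z ^ 2 * f s z := by
        refine Finset.sum_le_sum fun z _ => ?_
        exact neg_le_weight_mul (sq_nonneg _) (pow_le_one₀ (hψ0 z) (hψ1 z)) (by linarith)
          (hfη s hs z)
      rw [Finset.sum_const, nsmul_eq_mul] at this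
      linarith
    have e4 : ((R \ Q).card : ℝ) ≤ q / 12 := by
      rw [Finset.card_sdiff_of_subset hQR, Nat.cast_sub (Finset.card_le_card hQR), ← hq]
      linarith
    have e5 : Λ * ((R \ Q).card : ℝ) ≤ Λ * (q / 12) :=
      mul_le_mul_of_nonneg_left e4 (by linarith)
    rw [e1, e2]
    linarith
  -- `G` decreases at a rate at most `C₁ |Q| / ℓ²`, and the energy of the logarithm pushes it up
  have hder : ∀ s, 0 ≤ s → ∃ G' : ℝ, HasDerivAt G G' s ∧
      -C₁ * q / (ℓ : ℝ) ^ 2 + 1 / 16 * dirichletEnergy c P (f s) ≤ G' := by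
    intro s hs
    obtain ⟨G', hG', hle⟩ := hu.exists_hasDerivAt_log hc.symm hc.nonneg hAD ψ hψ0 hψA hN0.le hη0 hs
    refine ⟨G', hG', le_trans ?_ hle⟩
    have b1 : ∑ z ∈ D, ∑ w ∈ D, c z w * (ψ z - ψ w) ^ 2 ≤ M * (3 ^ d * q) / a ^ 2 := by
      calc ∑ z ∈ D, ∑ w ∈ D, c z w * (ψ z - ψ w) ^ 2
          ≤ ∑ z ∈ D, ∑ w ∈ D, c z w * (‖z - w‖ ^ 2 * (1 / a ^ 2)) := by
            refine Finset.sum_le_sum fun z _ => Finset.sum_le_sum fun w _ =>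
              mul_le_mul_of_nonneg_left ?_ (hc.nonneg z w)
            have h1 := abs_plateauCutoff_sub_le x₀ (r := (κ : ℝ) * ℓ) ha0 z w
            calc (ψ z - ψ w) ^ 2 = |ψ z - ψ w| ^ 2 := (sq_abs _).symm
              _ ≤ (‖z - w‖ / a) ^ 2 := by gcongr
              _ = _ := by rw [div_pow]; ring
        _ ≤ M * ∑ z ∈ D, (1 / a ^ 2) := hc.sum_second_moment_le D (fun _ => 1 / a ^ 2)
              (fun _ => by positivity)
        _ = M * D.card / a ^ 2 := by rw [Finset.sum_const, nsmul_eq_mul]; ring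
        _ ≤ _ := by gcongr
    have b2 : 5 / 2 * (M * (3 ^ d * q) / a ^ 2) ≤ C₁ * q / (ℓ : ℝ) ^ 2 := by
      rw [hC₁, ha, mul_div_assoc', div_le_div_iff₀ (by positivity) (by positivity)]
      have : (5 / 2 : ℝ) ≤ 4 * m₀ ^ 2 := by linarith [one_le_pow₀ hmr (n := 2)]
      have h2 := mul_le_mul_of_nonneg_right this
        (show 0 ≤ M * (3 ^ d * q) * (ℓ : ℝ) ^ 2 by positivity)
      calc _ = 5 / 2 * (M * (3 ^ d * q) * (ℓ : ℝ) ^ 2) := by ring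
        _ ≤ _ := h2
        _ = _ := by ring
    have b3 : 1 / 4 * dirichletEnergy c P (f s) ≤ ∑ z ∈ D, ∑ w ∈ D, c z w *
        (min (ψ z) (ψ w) ^ 2 * (f s z - f s w) ^ 2) := by
      have hnn : ∀ z w, 0 ≤ c z w * (min (ψ z) (ψ w) ^ 2 * (f s z - f s w) ^ 2) := fun z w =>
        mul_nonneg (hc.nonneg z w) (by positivity)
      rw [dirichletEnergy]
      simp only [Finset.mul_sum]
      refine le_trans (Finset.sum_le_sum fun z hz => ?_)
        (Finset.sum_le_sum_of_subset_of_nonneg hPD fun z _ _ => Finset.sum_nonneg fun w _ => hnn z w)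
      refine le_trans (Finset.sum_le_sum fun w hw => ?_)
        (Finset.sum_le_sum_of_subset_of_nonneg hPD fun w _ _ => hnn z w)
      have h1 : 1 / 2 ≤ min (ψ z) (ψ w) := le_min (hψP z hz) (hψP w hw)
      have h2 : 1 / 4 ≤ min (ψ z) (ψ w) ^ 2 := by
        have := pow_le_pow_left₀ (by norm_num) h1 2
        linarith
      have h3 : 0 ≤ c z w * (f s z - f s w) ^ 2 := mul_nonneg (hc.nonneg z w) (sq_nonneg _)
      calc 1 / 4 * (c z w * (f s z - f s w) ^ 2)
          ≤ min (ψ z) (ψ w) ^ 2 * (c z w * (f s z - f s w) ^ 2) := by gcongr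
        _ = _ := by ring
    have b4 : -C₁ * q / (ℓ : ℝ) ^ 2 = -(C₁ * q / (ℓ : ℝ) ^ 2) := by ring
    rw [b4]
    linarith
  have hEP : ∀ s, 0 ≤ dirichletEnergy c P (f s) := fun s => Finset.sum_nonneg fun z _ =>
    Finset.sum_nonneg fun w _ => mul_nonneg (hc.nonneg z w) (sq_nonneg _)
  choose! G' hG'd hG'l using hder
  -- the energy is large as long as the mean is very negative
  have hen : ∀ s, (ℓ : ℝ) ^ 2 / 16 ≤ s → s ≤ (ℓ : ℝ) ^ 2 →
      G s / q ≤ -(4 * -Real.log h + Λ / 6) →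
      16 * c₂ * (G s / q) ^ 2 * q / (ℓ : ℝ) ^ 2 ≤ dirichletEnergy c P (f s) := by
    intro s hs1 hs2 hγ
    have hs0 : 0 ≤ s := le_trans (by positivity) hs1
    set μ : ℝ := (∑ z ∈ Q, f s z) / q with hμ
    have hmean : ∑ z ∈ Q, f s z = q * μ := by rw [hμ]; field_simp
    set γ := G s / q with hγdef
    have hμγ : μ ≤ γ + Λ / 12 := by
      rw [hμ, hγdef, div_le_iff₀ hQpos, add_mul, div_mul_cancel₀ _ hQpos.ne']
      linarith [hGlow s hs0]
    have hμ2 : μ ≤ γ / 2 := by linarith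
    have hμl : μ ≤ 2 * Real.log h := by linarith
    set H := Q.filter (fun z => h ≤ N * u s z) with hH
    have hHcard : cH * N ≤ H.card := hl s hs1 hs2
    have hpair := hc.energy_ge_of_mean hK₀.le x₀ (κ * ℓ) (f s)
      (Finset.filter_subset _ Q : H ⊆ Q) (l := Real.log h)
      (fun z hz => Real.log_le_log hh0 (by linarith [(Finset.mem_filter.1 hz).2]))
      (by rw [← hQ, ← hq]; exact hmean) hμl (by linarith)
    rw [← hQ, ← hq, ← hP, ← hK₁] at hpair
    have hE := hEP s
    generalize dirichletEnergy c P (f s) = E at hpair hE ⊢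
    generalize (H.card : ℝ) = nH at hpair hHcard
    clear_value γ μ
    refine energy_constants hQpos (by positivity) hcH hK₁0 hP₁0 hE (by linarith) hQN hHcard hμ2
      (by linarith) ?_ hpair
    have h1 : (4 * (κ * ℓ : ℕ) + 1 : ℝ) ^ d ≤ 2 ^ d * q := by
      rw [hcQ, ← mul_pow]
      push_cast
      refine pow_le_pow_left₀ (by positivity) (by linarith) d
    calc _ ≤ 2 ^ d * q * (2 * d * (κ * ℓ : ℕ) : ℝ) ^ 2 :=
          mul_le_mul_of_nonneg_right h1 (sq_nonneg _)
      _ = _ := by rw [hP₁]; push_cast; ring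
  have hwin : ∀ s ∈ Set.Icc (T / 2) T, (ℓ : ℝ) ^ 2 / 16 ≤ s ∧ s ≤ (ℓ : ℝ) ^ 2 ∧ 0 ≤ s := by
    intro s hs
    have h1 : (ℓ : ℝ) ^ 2 / 16 ≤ s := by linarith [hs.1]
    exact ⟨h1, hs.2.trans hT2, le_trans (by positivity) h1⟩
  have hfin := hric (fun s => G s / q) (fun s => G' s / q)
    (4 * -Real.log h + Λ / 6) T ((ℓ : ℝ) ^ 2) (by linarith) (by positivity) hT1 hT2
    (fun s hs => (hG'd s (hwin s hs).2.2).div_const _)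
    (fun s hs => by
      have h1 := hG'l s (hwin s hs).2.2
      have h2 := hEP s
      rw [le_div_iff₀ hQpos]
      calc -C₁ / (ℓ : ℝ) ^ 2 * q = -C₁ * q / (ℓ : ℝ) ^ 2 := by ring
        _ ≤ _ := by linarith)
    (fun s hs hγ => by
      have h1 := hG'l s (hwin s hs).2.2
      have h2 := hen s (hwin s hs).1 (hwin s hs).2.1 hγ
      rw [le_div_iff₀ hQpos]
      calc (c₂ * (G s / q) ^ 2 - C₁) / (ℓ : ℝ) ^ 2 * q
          = -C₁ * q / (ℓ : ℝ) ^ 2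
            + 1 / 16 * (16 * c₂ * (G s / q) ^ 2 * q / (ℓ : ℝ) ^ 2) := by ring
        _ ≤ _ := by linarith)
  -- too many small values would make the mean too negative
  by_contra hcon
  push Not at hcon
  set S := Q.filter (fun z => N * u T z < η) with hS
  have hT0 : 0 ≤ T := le_trans (by positivity) hT1
  have hSQ : S ⊆ Q := Finset.filter_subset _ _
  have hcS : q < 3 * S.card := by rw [hq]; exact_mod_cast hcon
  have hmassA := hu.sum_le_one hc.symm hc.nonneg hAD hxA hT0
  have hlog2 : Real.log 2 ≤ 1 := by
    have := Real.log_two_lt_d9; linarith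
  have hGup : G T ≤ S.card * (1 - Λ) + N := by
    have e1 : ∀ z ∈ A, ψ z ^ 2 * f T z ≤ (if z ∈ S then 1 - Λ else 0) + N * u T z := by
      intro z _
      have hv := hunn T hT0 z
      by_cases hz : z ∈ S
      · rw [if_pos hz, hψQ z (hSQ hz)]
        have h1 : f T z ≤ Real.log (2 * η) :=
          Real.log_le_log (by linarith) (by linarith [(Finset.mem_filter.1 hz).2])
        rw [Real.log_mul (by norm_num) hη0.ne', hlogη] at h1
        linarith
      · rw [if_neg hz, zero_add]
        have h1 : f T z ≤ N * u T z := by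
          have := Real.log_le_sub_one_of_pos (show 0 < N * u T z + η by linarith)
          linarith
        exact weight_mul_le (sq_nonneg _) (pow_le_one₀ (hψ0 z) (hψ1 z)) hv h1
    calc G T ≤ ∑ z ∈ A, ((if z ∈ S then 1 - Λ else 0) + N * u T z) := Finset.sum_le_sum e1
      _ = S.card * (1 - Λ) + N * ∑ z ∈ A, u T z := by
          rw [Finset.sum_add_distrib, ← Finset.mul_sum, Finset.sum_ite_mem,
            Finset.inter_eq_right.2 (hSQ.trans hQA), Finset.sum_const, nsmul_eq_mul]
      _ ≤ _ := by linarith [mul_le_of_le_one_right hN0.le hmassA]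
  have h1 : G T ≤ q * ((1 - Λ) / 3 + 1) := by
    have : (S.card : ℝ) * (1 - Λ) ≤ q / 3 * (1 - Λ) :=
      mul_le_mul_of_nonpos_right (by linarith) (by linarith)
    linarith
  have h2 : G T / q ≤ (1 - Λ) / 3 + 1 := by
    rw [div_le_iff₀ hQpos]; linarith
  linarith

/-! ### Matrix exponentials and the killed heat kernel -/

section MatrixExp

open scoped Matrix.Norms.Operator

variable {ι : Type*} [Fintype ι] [DecidableEq ι]

lemma hasDerivAt_matrix_exp_apply (B : Matrix ι ι ℝ) (t : ℝ) (i j : ι) :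
    HasDerivAt (fun s : ℝ => (NormedSpace.exp (s • B)) i j)
      ((NormedSpace.exp (t • B) * B) i j) t :=
  (LinearMap.toContinuousLinearMap (Matrix.entryLinearMap ℝ ℝ i j)).hasFDerivAt.comp_hasDerivAt t
    (hasDerivAt_exp_smul_const (𝕂 := ℝ) B t)

lemma hasSum_matrix_exp_apply (B : Matrix ι ι ℝ) (i j : ι) :
    HasSum (fun n : ℕ => (n.factorial : ℝ)⁻¹ * (B ^ n) i j) ((NormedSpace.exp B) i j) :=
  (NormedSpace.exp_series_hasSum_exp' (𝕂 := ℝ) B).mapL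
    (LinearMap.toContinuousLinearMap (Matrix.entryLinearMap ℝ ℝ i j))

lemma matrix_pow_nonneg {B : Matrix ι ι ℝ} (hB : ∀ i j, 0 ≤ B i j) (n : ℕ) :
    ∀ i j, 0 ≤ (B ^ n) i j := by
  induction n with
  | zero =>
    intro i j
    rw [pow_zero, Matrix.one_apply]
    split_ifs <;> norm_num
  | succ n ih =>
    intro i j
    rw [pow_succ, Matrix.mul_apply]
    exact Finset.sum_nonneg fun k _ => mul_nonneg (ih i k) (hB k j)

lemma matrix_exp_add_scalar (B : Matrix ι ι ℝ) (l : ℝ) :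
    NormedSpace.exp (B + l • (1 : Matrix ι ι ℝ)) = Real.exp l • NormedSpace.exp B := by
  have h : NormedSpace.exp (l • (1 : Matrix ι ι ℝ)) = Real.exp l • (1 : Matrix ι ι ℝ) := by
    have := NormedSpace.algebraMap_exp_comm (𝔸 := Matrix ι ι ℝ) l
    rw [← Real.exp_eq_exp_ℝ, Algebra.algebraMap_eq_smul_one, Algebra.algebraMap_eq_smul_one] at this
    exact this.symm
  rw [Matrix.exp_add_of_commute _ _ ((Commute.one_right B).smul_right l), h, mul_smul_comm, mul_one]

lemma matrix_exp_smul_add (B : Matrix ι ι ℝ) (s t : ℝ) :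
    NormedSpace.exp ((s + t) • B) = NormedSpace.exp (s • B) * NormedSpace.exp (t • B) := by
  rw [add_smul]
  exact NormedSpace.exp_add_of_commute (((Commute.refl B).smul_left s).smul_right t)

lemma matrix_exp_smul_pow (B : Matrix ι ι ℝ) (s : ℝ) (n : ℕ) :
    NormedSpace.exp (s • B) ^ n = NormedSpace.exp ((n * s) • B) := by
  induction n with
  | zero => simp [NormedSpace.exp_zero]
  | succ n ih =>
    rw [pow_succ, ih, ← matrix_exp_smul_add]
    congr 2
    push_cast; ring

/-- The exponential of a matrix with nonnegative off-diagonal entries is nonnegative. -/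
lemma matrix_exp_nonneg {B : Matrix ι ι ℝ} (hB : ∀ i j, i ≠ j → 0 ≤ B i j) (i j : ι) :
    0 ≤ (NormedSpace.exp B) i j := by
  obtain ⟨l, hl⟩ : ∃ l : ℝ, ∀ i, 0 ≤ B i i + l := by
    refine ⟨∑ i, |B i i|, fun i => ?_⟩
    have : |B i i| ≤ ∑ i, |B i i| :=
      Finset.single_le_sum (f := fun i => |B i i|) (fun _ _ => abs_nonneg _) (Finset.mem_univ i)
    linarith [neg_abs_le (B i i)]
  have hnn : ∀ i j, 0 ≤ (B + l • (1 : Matrix ι ι ℝ)) i j := by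
    intro i j
    by_cases hij : i = j
    · subst hij; simpa using hl i
    · simpa [Matrix.one_apply, hij] using hB i j hij
  have h1 : 0 ≤ (NormedSpace.exp (B + l • (1 : Matrix ι ι ℝ))) i j :=
    (hasSum_matrix_exp_apply _ i j).nonneg fun n =>
      mul_nonneg (by positivity) (matrix_pow_nonneg hnn n i j)
  rw [matrix_exp_add_scalar, Matrix.smul_apply, smul_eq_mul] at h1
  exact nonneg_of_mul_nonneg_right h1 (Real.exp_pos l)

end MatrixExp

/-- The generator of the walk with conductances `c` among the points of `D`, killed outside `A`. -/
noncomputable def killedGenerator {V : Type*} [DecidableEq V] (c : V → V → ℝ) (A D : Finset V) :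
    Matrix A A ℝ :=
  fun z w => c z w - if z = w then ∑ y ∈ D, c z y else 0

section killedGenerator

variable {V : Type*} [DecidableEq V] {c : V → V → ℝ} {A D : Finset V}

lemma killedGenerator_transpose (hsymm : ∀ z w, c z w = c w z) :
    (killedGenerator c A D).transpose = killedGenerator c A D := by
  ext z w
  simp only [Matrix.transpose_apply, killedGenerator]
  by_cases h : z = w
  · subst h; rfl
  · rw [if_neg h, if_neg (Ne.symm h), hsymm]

lemma exp_killedGenerator_nonneg (hnn : ∀ z w, 0 ≤ c z w) {s : ℝ} (hs : 0 ≤ s) (z w : A) :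
    0 ≤ (NormedSpace.exp (s • killedGenerator c A D)) z w := by
  refine matrix_exp_nonneg (fun i j hij => ?_) z w
  rw [Matrix.smul_apply, killedGenerator, if_neg hij, sub_zero, smul_eq_mul]
  exact mul_nonneg hs (hnn _ _)

lemma exp_killedGenerator_symm (hsymm : ∀ z w, c z w = c w z) (s : ℝ) (z w : A) :
    (NormedSpace.exp (s • killedGenerator c A D)) z w
      = (NormedSpace.exp (s • killedGenerator c A D)) w z := by
  have h := Matrix.exp_transpose (s • killedGenerator c A D)
  rw [Matrix.transpose_smul, killedGenerator_transpose hsymm] at h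
  conv_lhs => rw [h]
  rfl

/-- The row of the killed heat kernel at `x`, extended by zero outside `A`. -/
noncomputable def killedHeat (c : V → V → ℝ) (A D : Finset V) (x : A) (s : ℝ) (z : V) : ℝ :=
  if h : z ∈ A then (NormedSpace.exp (s • killedGenerator c A D)) x ⟨z, h⟩ else 0

lemma isKilledHeatSolution_killedHeat (hsymm : ∀ z w, c z w = c w z) (hnn : ∀ z w, 0 ≤ c z w)
    (hAD : A ⊆ D) (x : A) : IsKilledHeatSolution c A D x (killedHeat c A D x) where
  zero_off s z hz := dif_neg hz
  nonneg s hs z := by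
    rw [killedHeat]
    split_ifs
    · exact exp_killedGenerator_nonneg hnn hs _ _
    · exact le_rfl
  init := by
    funext z
    rw [killedHeat, zero_smul, NormedSpace.exp_zero]
    by_cases hz : z ∈ A
    · rw [dif_pos hz, Matrix.one_apply, Pi.single_apply]
      by_cases h : z = x
      · rw [if_pos h, if_pos (Subtype.ext h.symm)]
      · rw [if_neg h, if_neg fun h' => h (congrArg Subtype.val h').symm]
    · rw [dif_neg hz, Pi.single_eq_of_ne]
      rintro rfl
      exact hz x.2
  deriv s z hz := by
    have h := hasDerivAt_matrix_exp_apply (killedGenerator c A D) s x ⟨z, hz⟩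
    have e1 : (fun s => killedHeat c A D x s z)
        = fun s => (NormedSpace.exp (s • killedGenerator c A D)) x ⟨z, hz⟩ :=
      funext fun s => dif_pos hz
    rw [e1]
    convert h using 1
    rw [Matrix.mul_apply]
    have e2 : ∑ w ∈ D, c z w * killedHeat c A D x s w
        = ∑ w : A, (NormedSpace.exp (s • killedGenerator c A D)) x w * c w z := by
      rw [← Finset.sum_subset hAD fun w _ hw => by rw [killedHeat, dif_neg hw, mul_zero],
        ← Finset.sum_coe_sort A]
      refine Finset.sum_congr rfl fun w _ => ?_
      rw [killedHeat, dif_pos w.2, hsymm z w, mul_comm]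
    simp only [mul_sub, Finset.sum_sub_distrib, e2, killedGenerator]
    congr 1
    simp only [mul_ite, mul_zero, Finset.sum_ite_eq', Finset.mem_univ, if_true]
    rw [← Finset.sum_mul, killedHeat, dif_pos hz, mul_comm]

/-- The semigroup property at time `2 s`; by symmetry both factors are rows. -/
lemma exp_killedGenerator_double (hsymm : ∀ z w, c z w = c w z) (x y : A) (s : ℝ) :
    (NormedSpace.exp ((s + s) • killedGenerator c A D)) x y
      = ∑ z ∈ A, killedHeat c A D x s z * killedHeat c A D y s z := by
  rw [matrix_exp_smul_add, Matrix.mul_apply, ← Finset.sum_coe_sort A]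
  refine Finset.sum_congr rfl fun z _ => ?_
  rw [killedHeat, killedHeat, dif_pos z.2, dif_pos z.2,
    exp_killedGenerator_symm hsymm s z y]

end killedGenerator

/-- Two functions that are both at least `η / N` on more than two thirds of `Q` have a large inner
product. -/
lemma sum_mul_ge_of_card_small_le {V : Type*} {A Q : Finset V} (hQA : Q ⊆ A) {p q : V → ℝ}
    (hp : ∀ z, 0 ≤ p z) (hq : ∀ z, 0 ≤ q z) {N η : ℝ} (hN : 0 < N) (hη : 0 < η)
    (hNQ : N ≤ Q.card) (hpc : 3 * (Q.filter (fun z => N * p z < η)).card ≤ Q.card)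
    (hqc : 3 * (Q.filter (fun z => N * q z < η)).card ≤ Q.card) :
    η ^ 2 / 3 / N ≤ ∑ z ∈ A, p z * q z := by
  classical
  set Bp := Q.filter (fun z => N * p z < η) with hBp
  set Bq := Q.filter (fun z => N * q z < η) with hBq
  have hcard : Q.card ≤ 3 * (Q \ (Bp ∪ Bq)).card := by
    have h1 := Finset.le_card_sdiff (Bp ∪ Bq) Q
    have h2 := Finset.card_union_le Bp Bq
    omega
  have hcard' : N / 3 ≤ (Q \ (Bp ∪ Bq)).card := by
    have : (Q.card : ℝ) ≤ 3 * (Q \ (Bp ∪ Bq)).card := by exact_mod_cast hcard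
    linarith
  calc η ^ 2 / 3 / N = N / 3 * (η / N) ^ 2 := by field_simp
    _ ≤ (Q \ (Bp ∪ Bq)).card * (η / N) ^ 2 := mul_le_mul_of_nonneg_right hcard' (sq_nonneg _)
    _ = ∑ z ∈ Q \ (Bp ∪ Bq), (η / N) ^ 2 := by rw [Finset.sum_const, nsmul_eq_mul]
    _ ≤ ∑ z ∈ Q \ (Bp ∪ Bq), p z * q z := by
        refine Finset.sum_le_sum fun z hz => ?_
        simp only [hBp, hBq, Finset.mem_sdiff, Finset.mem_union, Finset.mem_filter, not_or, not_and,
          not_lt] at hz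
        have h1 : η / N ≤ p z := by rw [div_le_iff₀ hN]; linarith [hz.2.1 hz.1]
        have h2 : η / N ≤ q z := by rw [div_le_iff₀ hN]; linarith [hz.2.2 hz.1]
        rw [sq]
        exact mul_le_mul h1 h2 (by positivity) (hp z)
    _ ≤ _ := Finset.sum_le_sum_of_subset_of_nonneg (Finset.sdiff_subset.trans hQA) fun z _ _ =>
        mul_nonneg (hp z) (hq z)

/-- The near-diagonal lower bound for the killed heat kernel on `ℤ^d`: the two rows at `x` and `y`
are both of order `ℓ ^ (-d)` on a common third of a cube. -/
theorem exists_killed_heat_kernel_ge {d : ℕ} (hd : 1 ≤ d) {m₀ : ℕ} (hm₀ : 1 ≤ m₀) {K₀ M : ℝ}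
    (hK₀ : 0 < K₀) (hM : 0 < M) :
    ∃ (κ : ℕ) (c₁ : ℝ), 1 ≤ κ ∧ 0 < c₁ ∧
      ∀ (c : (Fin d → ℤ) → (Fin d → ℤ) → ℝ) (ℓ : ℕ) (x₀ : Fin d → ℤ)
      (x y : latticeBox x₀ (2 * κ * ℓ)) (T : ℝ), IsLatticeConductance c m₀ (2 * m₀ * ℓ) K₀ M →
      1 ≤ ℓ → (x : Fin d → ℤ) ∈ latticeBox x₀ ℓ → (y : Fin d → ℤ) ∈ latticeBox x₀ ℓ →
      (ℓ : ℝ) ^ 2 / 8 ≤ T → T ≤ (ℓ : ℝ) ^ 2 →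
        c₁ / (ℓ : ℝ) ^ d ≤ (NormedSpace.exp ((T + T) • killedGenerator c
          (latticeBox x₀ (2 * κ * ℓ)) (latticeBox x₀ (2 * κ * ℓ + 2 * m₀ * ℓ)))) x y := by
  obtain ⟨κ, η, hκ, hη, H⟩ := exists_card_small_le hd hm₀ hK₀ hM
  refine ⟨κ, η ^ 2 / 3, hκ, by positivity, ?_⟩
  intro c ℓ x₀ x y T hc hℓ hx hy hT1 hT2
  have hAD : latticeBox x₀ (2 * κ * ℓ) ⊆ latticeBox x₀ (2 * κ * ℓ + 2 * m₀ * ℓ) :=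
    latticeBox_mono x₀ (Nat.le_add_right _ _)
  have hsol := isKilledHeatSolution_killedHeat hc.symm hc.nonneg hAD
  have hbx := H c ℓ x₀ x _ T hc hℓ hx (hsol x) hT1 hT2
  have hby := H c ℓ x₀ y _ T hc hℓ hy (hsol y) hT1 hT2
  rw [exp_killedGenerator_double hc.symm]
  have hℓr : (1 : ℝ) ≤ ℓ := by exact_mod_cast hℓ
  have hκr : (1 : ℝ) ≤ κ := by exact_mod_cast hκ
  have hT0 : 0 ≤ T := le_trans (by positivity) hT1
  refine sum_mul_ge_of_card_small_le (latticeBox_mono x₀ (by nlinarith)) ((hsol x).nonneg T hT0)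
    ((hsol y).nonneg T hT0) (by positivity) hη ?_ hbx hby
  rw [card_latticeBox]
  push_cast
  gcongr
  nlinarith

/-! ### The scaled lattice and the transition probabilities -/

open scoped BoundedContinuousFunction

/-- The point `k / n` of the scaled lattice. -/
noncomputable def latticePoint {d : ℕ} (n : ℕ) (k : Fin d → ℤ) : ScaledLattice d n :=
  ⟨WithLp.toLp 2 fun i => (k i : ℝ) / n, k, fun _ => rfl⟩

lemma latticePoint_surjective (d n : ℕ) :
    Function.Surjective (latticePoint n : (Fin d → ℤ) → ScaledLattice d n) := by
  rintro ⟨v, k, hk⟩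
  refine ⟨k, Subtype.ext ?_⟩
  ext i
  exact (hk i).symm

lemma norm_sub_le_mul_dist {d n : ℕ} (hn : 1 ≤ n) (k l : Fin d → ℤ) :
    ‖k - l‖ ≤ n * dist (latticePoint n k) (latticePoint n l) := by
  have hn0 : (0 : ℝ) < n := by exact_mod_cast hn
  refine (pi_norm_le_iff_of_nonneg (by positivity)).2 fun i => ?_
  have h := PiLp.norm_apply_le
    ((latticePoint n k : EuclideanSpace ℝ (Fin d)) - (latticePoint n l : EuclideanSpace ℝ (Fin d))) i
  have e : ((latticePoint n k : EuclideanSpace ℝ (Fin d))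
      - (latticePoint n l : EuclideanSpace ℝ (Fin d))) i = ((k i - l i : ℤ) : ℝ) / n := by
    rw [PiLp.sub_apply, Int.cast_sub, sub_div]; rfl
  rw [e, norm_div, Real.norm_natCast, div_le_iff₀ hn0, ← dist_eq_norm] at h
  rw [Pi.sub_apply, Int.norm_eq_abs, ← Real.norm_eq_abs, mul_comm]
  exact h

lemma latticePoint_injective {d n : ℕ} (hn : 1 ≤ n) :
    Function.Injective (latticePoint n : (Fin d → ℤ) → ScaledLattice d n) := by
  intro k l h
  have := norm_sub_le_mul_dist hn k l
  rw [h, dist_self, mul_zero] at this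
  exact sub_eq_zero.1 (norm_le_zero_iff.1 this)

lemma dist_latticePoint_neighbour {d n : ℕ} (k : Fin d → ℤ) (i : Fin d) :
    dist (latticePoint n k) (latticePoint n (k + Pi.single i 1)) = 1 / (n : ℝ) := by
  rw [Subtype.dist_eq, EuclideanSpace.dist_eq, Finset.sum_eq_single i]
  · rw [Real.sqrt_sq dist_nonneg, Real.dist_eq]
    simp only [latticePoint, Pi.add_apply, Pi.single_eq_same, Int.cast_add, Int.cast_one]
    rw [add_div, sub_add_cancel_left, abs_neg, abs_of_nonneg (by positivity)]
  · intro j _ hj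
    simp [latticePoint, hj]
  · simp

instance discreteTopology_scaledLattice (d n : ℕ) : DiscreteTopology (ScaledLattice d n) := by
  rcases Nat.eq_zero_or_pos n with rfl | hn
  · -- division by zero collapses the lattice to a single point
    have : Subsingleton (ScaledLattice d 0) := by
      refine ⟨fun x y => ?_⟩
      obtain ⟨k, rfl⟩ := latticePoint_surjective d 0 x
      obtain ⟨l, rfl⟩ := latticePoint_surjective d 0 y
      simp [latticePoint]
    infer_instance
  · refine DiscreteTopology.of_forall_le_dist (r := 1 / (n : ℝ)) (by positivity) ?_
    intro x y hxy
    obtain ⟨k, rfl⟩ := latticePoint_surjective d n x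
    obtain ⟨l, rfl⟩ := latticePoint_surjective d n y
    have hn0 : (0 : ℝ) < n := by exact_mod_cast hn
    have hkl : k ≠ l := fun h => hxy (by rw [h])
    obtain ⟨i, hi⟩ := Function.ne_iff.1 hkl
    have h1 : (1 : ℝ) ≤ ‖(k - l) i‖ := by
      rw [Pi.sub_apply, Int.norm_eq_abs, ← Int.cast_abs]
      exact_mod_cast Int.one_le_abs (sub_ne_zero.2 hi)
    have h2 := (h1.trans (norm_le_pi_norm (k - l) i)).trans (norm_sub_le_mul_dist hn k l)
    rw [div_le_iff₀ hn0]
    linarith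

section OperatorExp

variable {E : Type*} [NormedAddCommGroup E] [NormedSpace ℝ E]

/-- The exponential of a bounded operator. It is stated for an abstract normed space, so that the ring
structure on the operators is found by unification when the space is concrete. -/
noncomputable def operatorExp (T : E →L[ℝ] E) : E →L[ℝ] E := NormedSpace.exp T

lemma hasSum_operatorExp_apply [CompleteSpace E] (T : E →L[ℝ] E) (f : E) :
    HasSum (fun k : ℕ => (k.factorial : ℝ)⁻¹ • (T ^ k) f) (operatorExp T f) :=
  (NormedSpace.exp_series_hasSum_exp' (𝕂 := ℝ) T).mapL (ContinuousLinearMap.apply ℝ E f)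

lemma operatorExp_add_scalar [CompleteSpace E] (T : E →L[ℝ] E) (l : ℝ) :
    operatorExp (T + l • (1 : E →L[ℝ] E)) = Real.exp l • operatorExp T := by
  have h : NormedSpace.exp (l • (1 : E →L[ℝ] E)) = Real.exp l • (1 : E →L[ℝ] E) := by
    have := NormedSpace.algebraMap_exp_comm (𝔸 := E →L[ℝ] E) l
    rw [← Real.exp_eq_exp_ℝ, Algebra.algebraMap_eq_smul_one, Algebra.algebraMap_eq_smul_one] at this
    exact this.symm
  let _ : NormedAlgebra ℚ (E →L[ℝ] E) := NormedAlgebra.restrictScalars ℚ ℝ _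
  rw [operatorExp, operatorExp,
    NormedSpace.exp_add_of_commute ((Commute.one_right T).smul_right l), h, mul_smul_comm, mul_one]

lemma smul_operator_pow_apply (T : E →L[ℝ] E) (t : ℝ) (k : ℕ) (f : E) :
    ((t • T) ^ k) f = t ^ k • (T ^ k) f := by
  rw [smul_pow]; rfl

end OperatorExp

section Generator

variable {d n : ℕ} {c : ScaledLattice d n → ScaledLattice d n → ℝ} {ν : ℝ}

lemma summable_generator (hnn : ∀ x y, 0 ≤ c x y) (hs : ∀ x, Summable (c x))
    (f : ScaledLattice d n →ᵇ ℝ) (x : ScaledLattice d n) :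
    Summable fun y => (f y - f x) * c x y * (n : ℝ) ^ 2 := by
  refine Summable.mul_right _ (Summable.of_norm_bounded ((hs x).mul_left (2 * ‖f‖)) fun y => ?_)
  rw [norm_mul, Real.norm_of_nonneg (hnn x y)]
  refine mul_le_mul_of_nonneg_right ?_ (hnn x y)
  calc ‖f y - f x‖ ≤ ‖f y‖ + ‖f x‖ := norm_sub_le _ _
    _ ≤ 2 * ‖f‖ := by linarith [f.norm_coe_le_norm y, f.norm_coe_le_norm x]

lemma norm_generator_le (hnn : ∀ x y, 0 ≤ c x y) (hs : ∀ x, Summable (c x))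
    (hν : ∀ x, ∑' y, c x y ≤ ν) (f : ScaledLattice d n →ᵇ ℝ) (x : ScaledLattice d n) :
    ‖generator c f x‖ ≤ 2 * ν * (n : ℝ) ^ 2 * ‖f‖ := by
  have hb : ∀ y, ‖(f y - f x) * c x y * (n : ℝ) ^ 2‖ ≤ 2 * ‖f‖ * (n : ℝ) ^ 2 * c x y := fun y => by
    rw [norm_mul, norm_mul, Real.norm_of_nonneg (hnn x y), norm_pow, Real.norm_natCast]
    have : ‖f y - f x‖ ≤ 2 * ‖f‖ := by
      refine (norm_sub_le _ _).trans ?_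
      linarith [f.norm_coe_le_norm y, f.norm_coe_le_norm x]
    calc _ ≤ 2 * ‖f‖ * c x y * (n : ℝ) ^ 2 := by have := hnn x y; gcongr
      _ = _ := by ring
  have hsum : Summable fun y => 2 * ‖f‖ * (n : ℝ) ^ 2 * c x y := (hs x).mul_left _
  calc ‖generator c f x‖ ≤ ∑' y, 2 * ‖f‖ * (n : ℝ) ^ 2 * c x y :=
        tsum_of_norm_bounded hsum.hasSum hb
    _ = 2 * ‖f‖ * (n : ℝ) ^ 2 * ∑' y, c x y := tsum_mul_left
    _ ≤ 2 * ‖f‖ * (n : ℝ) ^ 2 * ν := by gcongr; exact hν x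
    _ = _ := by ring

/-- The generator as a bounded operator on the bounded functions; this is where bounded total
conductances are needed. -/
noncomputable def generatorCLM (hnn : ∀ x y, 0 ≤ c x y) (hs : ∀ x, Summable (c x))
    (hν : ∀ x, ∑' y, c x y ≤ ν) :
    (ScaledLattice d n →ᵇ ℝ) →L[ℝ] (ScaledLattice d n →ᵇ ℝ) :=
  LinearMap.mkContinuous
    { toFun := fun f => BoundedContinuousFunction.ofNormedAddCommGroupDiscrete (generator c f)
        (2 * ν * (n : ℝ) ^ 2 * ‖f‖) (norm_generator_le hnn hs hν f)
      map_add' := fun f g => by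
        ext x
        change generator c (f + g) x = generator c f x + generator c g x
        rw [generator, generator, generator,
          ← (summable_generator hnn hs f x).tsum_add (summable_generator hnn hs g x)]
        refine tsum_congr fun y => ?_
        simp only [Pi.add_apply]
        ring
      map_smul' := fun r f => by
        ext x
        change generator c (r • f) x = r * generator c f x
        rw [generator, generator, ← tsum_mul_left]
        refine tsum_congr fun y => ?_
        simp only [Pi.smul_apply, smul_eq_mul]
        ring }
    (2 * ν * (n : ℝ) ^ 2) fun f => by
      by_cases hne : Nonempty (ScaledLattice d n)
      · exact (BoundedContinuousFunction.norm_le_of_nonempty).2 (norm_generator_le hnn hs hν f)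
      · exact absurd ⟨latticePoint n 0⟩ hne

/-- The indicator function of a point, as a bounded function. -/
noncomputable def pointIndicator (y : ScaledLattice d n) : ScaledLattice d n →ᵇ ℝ :=
  BoundedContinuousFunction.ofNormedAddCommGroupDiscrete (Set.indicator {y} fun _ => 1) 1 fun x => by
    by_cases h : x ∈ ({y} : Set (ScaledLattice d n)) <;> simp [h]

lemma coe_pointIndicator (y : ScaledLattice d n) :
    ⇑(pointIndicator y) = Set.indicator {y} fun _ => (1 : ℝ) := rfl

lemma hasSum_operatorExp_eval
    (T : (ScaledLattice d n →ᵇ ℝ) →L[ℝ] (ScaledLattice d n →ᵇ ℝ)) (f : ScaledLattice d n →ᵇ ℝ)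
    (x : ScaledLattice d n) :
    HasSum (fun k : ℕ => (k.factorial : ℝ)⁻¹ * ((T ^ k) f) x) (operatorExp T f x) :=
  (hasSum_operatorExp_apply T f).mapL (BoundedContinuousFunction.evalCLM ℝ x)

lemma transitionProb_eq_exp (hnn : ∀ x y, 0 ≤ c x y) (hs : ∀ x, Summable (c x))
    (hν : ∀ x, ∑' y, c x y ≤ ν) (t : ℝ) (x y : ScaledLattice d n) :
    transitionProb c t x y
      = operatorExp (t • generatorCLM hnn hs hν) (pointIndicator y) x := by
  have hpow : ∀ k : ℕ, ⇑(((generatorCLM hnn hs hν) ^ k) (pointIndicator y))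
      = (generator c)^[k] (Set.indicator {y} fun _ => 1) := by
    intro k
    induction k with
    | zero => rfl
    | succ k ih =>
      rw [pow_succ', Function.iterate_succ_apply', ← ih]
      rfl
  rw [← (hasSum_operatorExp_eval (t • generatorCLM hnn hs hν) (pointIndicator y) x).tsum_eq,
    transitionProb]
  refine tsum_congr fun k => ?_
  rw [smul_operator_pow_apply, BoundedContinuousFunction.smul_apply, hpow k, smul_eq_mul]
  ring

/-- A positive operator which dominates a nonnegative matrix on a finite set of points has a larger
exponential. -/
lemma matrix_exp_le_operatorExp {ι : Type*} [Fintype ι] [DecidableEq ι]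
    (T : (ScaledLattice d n →ᵇ ℝ) →L[ℝ] (ScaledLattice d n →ᵇ ℝ)) (B : Matrix ι ι ℝ)
    (e : ι → ScaledLattice d n) (hB : ∀ i j, 0 ≤ B i j)
    (hT : ∀ f : ScaledLattice d n →ᵇ ℝ, (∀ x, 0 ≤ f x) → ∀ x, 0 ≤ T f x)
    (hTB : ∀ f : ScaledLattice d n →ᵇ ℝ, (∀ x, 0 ≤ f x) →
      ∀ i, ∑ j, B i j * f (e j) ≤ T f (e i)) (i j : ι) :
    (NormedSpace.exp B) i j ≤ operatorExp T (pointIndicator (e j)) (e i) := by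
  have key : ∀ k : ℕ, (∀ x, 0 ≤ (T ^ k) (pointIndicator (e j)) x) ∧
      ∀ i, (B ^ k) i j ≤ (T ^ k) (pointIndicator (e j)) (e i) := by
    intro k
    induction k with
    | zero =>
      constructor
      · intro x
        rw [pow_zero, one_apply_eq_self, coe_pointIndicator]
        exact Set.indicator_nonneg (fun _ _ => zero_le_one) x
      · intro i
        rw [pow_zero, pow_zero, one_apply_eq_self, coe_pointIndicator,
          Matrix.one_apply]
        split_ifs with h
        · subst h; simp
        · exact Set.indicator_nonneg (fun _ _ => zero_le_one) _
    | succ k ih =>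
      constructor
      · intro x
        rw [pow_succ', mul_apply_eq_comp]
        exact hT _ ih.1 x
      · intro i
        rw [pow_succ', pow_succ', mul_apply_eq_comp, Matrix.mul_apply]
        refine le_trans (Finset.sum_le_sum fun w _ => ?_) (hTB _ ih.1 i)
        exact mul_le_mul_of_nonneg_left (ih.2 w) (hB i w)
  refine hasSum_le (fun k => ?_) (hasSum_matrix_exp_apply B i j)
    (hasSum_operatorExp_eval T (pointIndicator (e j)) (e i))
  exact mul_le_mul_of_nonneg_left ((key k).2 i) (by positivity)

end Generator

/-! ### Comparison of the transition probabilities with the killed heat kernel -/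

lemma summable_mul_bounded {d n : ℕ} {c : ScaledLattice d n → ScaledLattice d n → ℝ}
    (hnn : ∀ x y, 0 ≤ c x y) (hs : ∀ x, Summable (c x)) (f : ScaledLattice d n →ᵇ ℝ)
    (x : ScaledLattice d n) : Summable fun y => c x y * f y := by
  refine Summable.of_norm_bounded ((hs x).mul_right ‖f‖) fun y => ?_
  rw [norm_mul, Real.norm_of_nonneg (hnn x y)]
  exact mul_le_mul_of_nonneg_left (f.norm_coe_le_norm y) (hnn x y)

lemma generator_eq {d n : ℕ} {c : ScaledLattice d n → ScaledLattice d n → ℝ}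
    (hnn : ∀ x y, 0 ≤ c x y) (hs : ∀ x, Summable (c x)) (f : ScaledLattice d n →ᵇ ℝ)
    (x : ScaledLattice d n) :
    generator c f x = (n : ℝ) ^ 2 * (∑' y, c x y * f y - f x * ∑' y, c x y) := by
  rw [generator, ← tsum_mul_left, ← (summable_mul_bounded hnn hs f x).tsum_sub
    ((hs x).mul_left (f x)), ← tsum_mul_left]
  exact tsum_congr fun y => by ring

/-- The transition probabilities dominate the killed heat kernel of smaller conductances `c'`, up to
the factor `exp (-g t)` where `g` is the rate of the jumps lost on passing from `c` to `c'`. -/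
lemma exp_killedGenerator_le_transitionProb {d n : ℕ} (hn : 1 ≤ n)
    {c : ScaledLattice d n → ScaledLattice d n → ℝ} {ν g : ℝ}
    (hnn : ∀ x y, 0 ≤ c x y) (hs : ∀ x, Summable (c x)) (hν : ∀ x, ∑' y, c x y ≤ ν)
    {c' : (Fin d → ℤ) → (Fin d → ℤ) → ℝ} {A D : Finset (Fin d → ℤ)} (hc'0 : ∀ z w, 0 ≤ c' z w)
    (hc' : ∀ z w, c' z w ≤ c (latticePoint n z) (latticePoint n w))
    (hg : ∀ z ∈ A, (n : ℝ) ^ 2 * ∑' y, c (latticePoint n z) y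
      ≤ (n : ℝ) ^ 2 * ∑ w ∈ D, c' z w + g)
    {t : ℝ} (ht : 0 ≤ t) (x y : A) :
    Real.exp (-(g * t)) * (NormedSpace.exp (((n : ℝ) ^ 2 * t) • killedGenerator c' A D)) x y
      ≤ transitionProb c t (latticePoint n (x : Fin d → ℤ)) (latticePoint n (y : Fin d → ℤ)) := by
  have hinj := latticePoint_injective (d := d) hn
  have hsum_le : ∀ (S : Finset (Fin d → ℤ)) (f : ScaledLattice d n →ᵇ ℝ), (∀ x, 0 ≤ f x) → ∀ z,
      ∑ w ∈ S, c' z w * f (latticePoint n w) ≤ ∑' y, c (latticePoint n z) y * f y := by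
    intro S f hf z
    calc ∑ w ∈ S, c' z w * f (latticePoint n w)
        ≤ ∑ w ∈ S, c (latticePoint n z) (latticePoint n w) * f (latticePoint n w) :=
          Finset.sum_le_sum fun w _ => mul_le_mul_of_nonneg_right (hc' z w) (hf _)
      _ = ∑ y ∈ S.map ⟨latticePoint n, hinj⟩, c (latticePoint n z) y * f y := by
          rw [Finset.sum_map]; rfl
      _ ≤ _ := (summable_mul_bounded hnn hs f _).sum_le_tsum _
          fun y _ => mul_nonneg (hnn _ _) (hf y)
  have hrow : ∀ z, ∑ w ∈ D, c' z w ≤ ν := by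
    intro z
    have := hsum_le D (BoundedContinuousFunction.const _ 1) (fun _ => zero_le_one) z
    simp only [BoundedContinuousFunction.const_apply, mul_one] at this
    exact this.trans (hν _)
  -- shifting both generators by a multiple of the identity makes them entrywise nonnegative
  set l : ℝ := t * ((n : ℝ) ^ 2 * ν + g) with hl
  set K := killedGenerator c' A D with hK
  set G := generatorCLM hnn hs hν with hG
  have hexp := matrix_exp_le_operatorExp (t • G + l • 1)
    (((n : ℝ) ^ 2 * t) • K + (l - t * g) • (1 : Matrix A A ℝ))
    (fun z : A => latticePoint n (z : Fin d → ℤ)) ?_ ?_ ?_ x y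
  · rw [matrix_exp_add_scalar, operatorExp_add_scalar, Matrix.smul_apply, smul_eq_mul, smul_apply,
      BoundedContinuousFunction.smul_apply, smul_eq_mul, sub_eq_add_neg, Real.exp_add, mul_assoc,
      ← transitionProb_eq_exp hnn hs hν, mul_comm t g] at hexp
    exact le_of_mul_le_mul_left hexp (Real.exp_pos l)
  · intro z w
    rw [Matrix.add_apply, Matrix.smul_apply, Matrix.smul_apply, smul_eq_mul, smul_eq_mul, hK,
      killedGenerator, Matrix.one_apply]
    have h0 : 0 ≤ (n : ℝ) ^ 2 * t * c' z w := mul_nonneg (by positivity) (hc'0 _ _)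
    split_ifs with h
    · have h1 : (n : ℝ) ^ 2 * t * ∑ y ∈ D, c' z y ≤ (n : ℝ) ^ 2 * t * ν :=
        mul_le_mul_of_nonneg_left (hrow z) (by positivity)
      rw [hl]
      linarith
    · linarith
  · intro f hf z
    have e : (t • G + l • 1 : (ScaledLattice d n →ᵇ ℝ) →L[ℝ] (ScaledLattice d n →ᵇ ℝ)) f z
        = t * generator c f z + l * f z := rfl
    rw [e, generator_eq hnn hs]
    obtain ⟨k, rfl⟩ := latticePoint_surjective d n z
    have h1 : 0 ≤ ∑' y, c (latticePoint n k) y * f y :=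
      tsum_nonneg fun y => mul_nonneg (hnn _ _) (hf y)
    have h2 := mul_le_mul_of_nonneg_left (hν (latticePoint n k)) (hf (latticePoint n k))
    have h3 : 0 ≤ t * (n : ℝ) ^ 2 := by positivity
    have hg0 : 0 ≤ t * g * f (latticePoint n k) := by
      have : 0 ≤ g := by
        have h4 := hg x x.2
        have h5 := hsum_le D (BoundedContinuousFunction.const _ 1) (fun _ => zero_le_one) x
        simp only [BoundedContinuousFunction.const_apply, mul_one] at h5
        have h6 := mul_le_mul_of_nonneg_left h5 (show 0 ≤ (n : ℝ) ^ 2 by positivity)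
        linarith
      exact mul_nonneg (mul_nonneg ht this) (hf _)
    have h7 := mul_nonneg h3 h1
    have h8 := mul_le_mul_of_nonneg_left h2 h3
    rw [hl]
    linarith
  · intro f hf z
    have e : (t • G + l • 1 : (ScaledLattice d n →ᵇ ℝ) →L[ℝ] (ScaledLattice d n →ᵇ ℝ)) f
        (latticePoint n z) = t * generator c f (latticePoint n z) + l * f (latticePoint n z) := rfl
    rw [e, generator_eq hnn hs]
    have hfz := hf (latticePoint n z)
    have e2 : ∑ j : A, (((n : ℝ) ^ 2 * t) • K + (l - t * g) • (1 : Matrix A A ℝ)) z j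
          * f (latticePoint n (j : Fin d → ℤ))
        = (n : ℝ) ^ 2 * t * (∑ w ∈ A, c' z w * f (latticePoint n w)
            - (∑ y ∈ D, c' z y) * f (latticePoint n z)) + (l - t * g) * f (latticePoint n z) := by
      rw [← Finset.sum_coe_sort A]
      simp only [Matrix.add_apply, Matrix.smul_apply, smul_eq_mul, add_mul, Finset.sum_add_distrib,
        hK, killedGenerator, Matrix.one_apply, mul_sub, sub_mul, Finset.sum_sub_distrib, mul_ite,
        ite_mul, zero_mul, mul_zero, Finset.sum_ite_eq, Finset.mem_univ, if_true, Finset.mul_sum,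
        mul_one, mul_assoc]
      simp only [← Finset.mul_sum]
      ring
    rw [e2]
    have h1 := hsum_le A f hf z
    have h3 : 0 ≤ (n : ℝ) ^ 2 * t := by positivity
    have h4 := mul_le_mul_of_nonneg_left h1 h3
    have h5 := mul_le_mul_of_nonneg_left (hg z z.2) (mul_nonneg ht hfz)
    linarith

/-! ### Sample paths and exit times -/

namespace IsMarkovChainFrom

variable {d n : ℕ} {C : ScaledLattice d n → ScaledLattice d n → ℝ} {x : ScaledLattice d n}
  {Ω : Type*} [MeasurableSpace Ω] {P : Measure Ω} {Y : ℝ≥0 → Ω → ScaledLattice d n}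

lemma measurableSet_eq (hY : IsMarkovChainFrom C x P Y) (t : ℝ≥0) (z : ScaledLattice d n) :
    MeasurableSet {ω | Y t ω = z} :=
  hY.measurable t (measurableSet_singleton z)

lemma measurableSet_mem (hY : IsMarkovChainFrom C x P Y) (t : ℝ≥0)
    {A : Set (ScaledLattice d n)} (hA : A.Finite) : MeasurableSet {ω | Y t ω ∈ A} :=
  hY.measurable t hA.measurableSet

/-- The finite dimensional distributions at the multiples of a fixed time. -/
lemma measureReal_steps (hY : IsMarkovChainFrom C x P Y) (h : ℝ≥0) (j : ℕ)
    (z : ℕ → ScaledLattice d n) (hz : z 0 = x) :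
    P.real {ω | ∀ i ≤ j, Y (i * h) ω = z i}
      = ∏ i ∈ Finset.range j, transitionProb C h (z i) (z (i + 1)) := by
  rw [hY.finiteDimensional j (fun i => i * h) z
    (fun a b hab => mul_le_mul_left (Nat.cast_le.2 hab) h) (by simp) hz]
  refine Finset.prod_congr rfl fun i _ => ?_
  congr 1
  push_cast
  ring

/-- Summing over the paths in `e '' ι`: if the one step transition probabilities dominate the matrix
`Q`, then the chain observed at the multiples of `h` follows a given path up to time `j`, stays in
`e '' ι` for `l` further steps and ends at `e y` with at least the probability given by `Q ^ l`. -/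
lemma prod_mul_pow_le (hY : IsMarkovChainFrom C x P Y) {ι : Type*} [Fintype ι] [DecidableEq ι]
    {e : ι → ScaledLattice d n} (he : Function.Injective e) (h : ℝ≥0) {Q : Matrix ι ι ℝ}
    (hQ0 : ∀ i j, 0 ≤ Q i j) (hQ : ∀ i j, Q i j ≤ transitionProb C h (e i) (e j)) (y : ι) (l : ℕ) :
    ∀ (j : ℕ) (z : ℕ → ScaledLattice d n) (a : ι), z 0 = x → z j = e a →
      (∏ i ∈ Finset.range j, transitionProb C h (z i) (z (i + 1))) * (Q ^ l) a y
        ≤ P.real {ω | (∀ i ≤ j, Y (i * h) ω = z i) ∧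
            (∀ i, j ≤ i → i ≤ j + l → Y (i * h) ω ∈ Set.range e) ∧ Y ((j + l : ℕ) * h) ω = e y} := by
  have := hY.isProbabilityMeasure
  have hmeas : ∀ (j l : ℕ) (z : ℕ → ScaledLattice d n),
      MeasurableSet {ω | (∀ i ≤ j, Y (i * h) ω = z i) ∧
        (∀ i, j ≤ i → i ≤ j + l → Y (i * h) ω ∈ Set.range e) ∧ Y ((j + l : ℕ) * h) ω = e y} := by
    intro j l z
    have e1 : {ω | (∀ i ≤ j, Y (i * h) ω = z i) ∧
        (∀ i, j ≤ i → i ≤ j + l → Y (i * h) ω ∈ Set.range e) ∧ Y ((j + l : ℕ) * h) ω = e y}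
        = (⋂ i, ⋂ (_ : i ≤ j), {ω | Y (i * h) ω = z i}) ∩
          ((⋂ i, ⋂ (_ : j ≤ i), ⋂ (_ : i ≤ j + l), {ω | Y (i * h) ω ∈ Set.range e}) ∩
            {ω | Y ((j + l : ℕ) * h) ω = e y}) := by
      ext ω; simp
    rw [e1]
    refine MeasurableSet.inter ?_ (MeasurableSet.inter ?_ (hY.measurableSet_eq _ _))
    · exact MeasurableSet.iInter fun i => MeasurableSet.iInter fun _ => hY.measurableSet_eq _ _
    · exact MeasurableSet.iInter fun i => MeasurableSet.iInter fun _ => MeasurableSet.iInter fun _ =>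
        hY.measurableSet_mem _ (Set.finite_range e)
  induction l with
  | zero =>
    intro j z a hz hza
    rw [pow_zero, Matrix.one_apply]
    split_ifs with hay
    · subst hay
      rw [mul_one, ← hY.measureReal_steps h j z hz]
      refine measureReal_mono ?_
      intro ω hω
      refine ⟨hω, fun i hi1 hi2 => ?_, ?_⟩
      · rw [show i = j by omega, hω j le_rfl, hza]
        exact Set.mem_range_self a
      · rw [add_zero, hω j le_rfl, hza]
    · rw [mul_zero]; exact measureReal_nonneg
  | succ l ih =>
    intro j z a hz hza
    set p := ∏ i ∈ Finset.range j, transitionProb C h (z i) (z (i + 1)) with hp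
    have hp0 : 0 ≤ p := by
      rw [hp, ← hY.measureReal_steps h j z hz]; exact measureReal_nonneg
    set z' : ι → ℕ → ScaledLattice d n := fun b => Function.update z (j + 1) (e b) with hz'
    have hz'lt : ∀ b i, i ≤ j → z' b i = z i := fun b i hi => by
      rw [hz']; exact Function.update_of_ne (by omega) _ _
    have hz'j : ∀ b, z' b (j + 1) = e b := fun b => by rw [hz']; exact Function.update_self _ _ _
    set E : ι → Set Ω := fun b => {ω | (∀ i ≤ j + 1, Y (i * h) ω = z' b i) ∧
      (∀ i, j + 1 ≤ i → i ≤ j + 1 + l → Y (i * h) ω ∈ Set.range e) ∧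
        Y ((j + 1 + l : ℕ) * h) ω = e y} with hE
    have hone : ∀ b, p * (Q a b * (Q ^ l) b y) ≤ P.real (E b) := by
      intro b
      have h1 := ih (j + 1) (z' b) b (by rw [hz'lt b 0 (Nat.zero_le _), hz]) (hz'j b)
      refine le_trans ?_ h1
      have h2 : ∏ i ∈ Finset.range j, transitionProb C h (z' b i) (z' b (i + 1)) = p := by
        refine Finset.prod_congr rfl fun i hi => ?_
        have := Finset.mem_range.1 hi
        rw [hz'lt b i (by omega), hz'lt b (i + 1) (by omega)]
      rw [Finset.prod_range_succ, h2, hz'j, hz'lt b j le_rfl, hza, mul_assoc]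
      refine mul_le_mul_of_nonneg_left ?_ hp0
      exact mul_le_mul_of_nonneg_right (hQ a b) (matrix_pow_nonneg hQ0 l b y)
    have hdisj : ((Finset.univ : Finset ι) : Set ι).PairwiseDisjoint E := by
      intro b _ b' _ hbb'
      refine Set.disjoint_left.2 fun ω hω hω' => hbb' (he ?_)
      rw [← hz'j b, ← hz'j b', ← hω.1 (j + 1) le_rfl, ← hω'.1 (j + 1) le_rfl]
    calc p * (Q ^ (l + 1)) a y = ∑ b, p * (Q a b * (Q ^ l) b y) := by
          rw [pow_succ', Matrix.mul_apply, Finset.mul_sum]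
      _ ≤ ∑ b, P.real (E b) := Finset.sum_le_sum fun b _ => hone b
      _ = P.real (⋃ b ∈ (Finset.univ : Finset ι), E b) :=
          (measureReal_biUnion_finset hdisj fun b _ => hmeas (j + 1) l (z' b)).symm
      _ ≤ _ := by
          refine measureReal_mono ?_
          intro ω hω
          simp only [Set.mem_iUnion] at hω
          obtain ⟨b, -, h1, h2, h3⟩ := hω
          refine ⟨fun i hi => by rw [h1 i (by omega), hz'lt b i hi], fun i hi1 hi2 => ?_, ?_⟩
          · rcases Nat.eq_or_lt_of_le hi1 with rfl | hlt
            · rw [h1 j (by omega), hz'lt b j le_rfl, hza]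
              exact Set.mem_range_self a
            · exact h2 i hlt (by omega)
          · rw [show j + (l + 1) = j + 1 + l by omega]; exact h3

/-- Right continuity in the discrete space: the chain stays where it is for a positive time. -/
lemma exists_constant (hY : IsMarkovChainFrom C x P Y) (ω : Ω) (t : ℝ≥0) :
    ∃ u > t, ∀ s, t ≤ s → s < u → Y s ω = Y t ω := by
  have h := (hY.rightContinuous ω t) (IsOpen.mem_nhds (isOpen_discrete {Y t ω}) rfl)
  obtain ⟨u, hu, hsub⟩ := mem_nhdsGE_iff_exists_Ico_subset.1 h
  exact ⟨u, hu, fun s h1 h2 => hsub ⟨h1, h2⟩⟩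

/-- A chain which is in `A` at all dyadic fractions of `t` stays in `A` beyond time `t`. -/
lemma lt_exitTime (hY : IsMarkovChainFrom C x P Y) {ω : Ω} {t : ℝ≥0} (ht : 0 < t)
    {A : Set (ScaledLattice d n)}
    (h : ∀ k i : ℕ, i ≤ 2 ^ k → Y (i * (t / 2 ^ k)) ω ∈ A) : (t : ℝ≥0∞) < exitTime Y A ω := by
  have hle : ∀ s ≤ t, Y s ω ∈ A := by
    intro s hs
    rcases hs.eq_or_lt with rfl | hlt
    · simpa using h 0 1 (by norm_num)
    obtain ⟨u, hu, hconst⟩ := hY.exists_constant ω s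
    -- a dyadic fraction of `t` between `s` and `u`
    obtain ⟨k, hk⟩ : ∃ k : ℕ, t / 2 ^ k < u - s := by
      have hpos : (0 : ℝ≥0) < (u - s) / t := div_pos (tsub_pos_of_lt hu) ht
      obtain ⟨k, hk⟩ := exists_pow_lt_of_lt_one hpos (show (1 / 2 : ℝ≥0) < 1 by
        rw [← NNReal.coe_lt_coe]; norm_num)
      refine ⟨k, ?_⟩
      rw [lt_div_iff₀ ht] at hk
      calc t / 2 ^ k = (1 / 2) ^ k * t := by rw [div_pow, one_pow]; ring
        _ < _ := hk
    have hδ : 0 < t / 2 ^ k := by positivity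
    set i := ⌈s / (t / 2 ^ k)⌉₊ with hi
    have hi1 : s ≤ i * (t / 2 ^ k) := (div_le_iff₀ hδ).1 (Nat.le_ceil _)
    have hi2 : i * (t / 2 ^ k) < u := by
      have h1 : (i : ℝ≥0) < s / (t / 2 ^ k) + 1 := Nat.ceil_lt_add_one zero_le
      calc (i : ℝ≥0) * (t / 2 ^ k) < (s / (t / 2 ^ k) + 1) * (t / 2 ^ k) :=
            mul_lt_mul_of_pos_right h1 hδ
        _ = s + t / 2 ^ k := by rw [add_mul, div_mul_cancel₀ _ hδ.ne', one_mul]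
        _ < s + (u - s) := by gcongr
        _ = u := add_tsub_cancel_of_le hu.le
    have hi3 : i ≤ 2 ^ k := by
      refine Nat.ceil_le.2 ?_
      rw [div_le_iff₀ hδ]
      push_cast
      rw [mul_div_cancel₀ _ (by positivity)]
      exact hs
    rw [← hconst _ hi1 hi2]
    exact h k i hi3
  obtain ⟨u, hu, hconst⟩ := hY.exists_constant ω t
  refine lt_of_lt_of_le (ENNReal.coe_lt_coe.2 hu) ?_
  refine le_iInf fun r => le_iInf fun hr => ENNReal.coe_le_coe.2 ?_
  by_contra hcon
  push Not at hcon
  rcases le_total r t with h1 | h1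
  · exact hr (hle r h1)
  · rw [hconst r h1 hcon] at hr
    exact hr (hle t le_rfl)

/-- A lower bound for the killed transition function of the chain: the chain observed at the dyadic
fractions of `t` is treated by `prod_mul_pow_le`, and right continuity gives the passage to the
limit. -/
lemma le_measureReal_exitTime (hY : IsMarkovChainFrom C x P Y) {ι : Type*} [Fintype ι]
    [DecidableEq ι] {e : ι → ScaledLattice d n} (he : Function.Injective e) {t : ℝ≥0} (ht : 0 < t)
    (Q : ℝ≥0 → Matrix ι ι ℝ) (hQ0 : ∀ s i j, 0 ≤ Q s i j)
    (hQ : ∀ s i j, Q s i j ≤ transitionProb C s (e i) (e j))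
    (hpow : ∀ m : ℕ, 0 < m → Q (t / m) ^ m = Q t) {a y : ι} (hx : x = e a)
    {A : Set (ScaledLattice d n)} (hA : Set.range e ⊆ A) :
    Q t a y ≤ P.real {ω | Y t ω = e y ∧ (t : ℝ≥0∞) < exitTime Y A ω} := by
  have := hY.isProbabilityMeasure
  set E : ℕ → Set Ω := fun k =>
    {ω | (∀ i : ℕ, i ≤ 2 ^ k → Y (i * (t / 2 ^ k)) ω ∈ Set.range e) ∧ Y t ω = e y} with hE
  have hlow : ∀ k, Q t a y ≤ P.real (E k) := by
    intro k
    have h1 := hY.prod_mul_pow_le he (t / 2 ^ k) (hQ0 _) (hQ _) y (2 ^ k) 0 (fun _ => x) a rfl hx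
    have h2 := hpow (2 ^ k) (by positivity)
    push_cast at h2
    rw [Finset.range_zero, Finset.prod_empty, one_mul, h2] at h1
    refine h1.trans (measureReal_mono ?_)
    rintro ω ⟨-, h3, h4⟩
    refine ⟨fun i hi => h3 i (Nat.zero_le _) (by omega), ?_⟩
    rw [zero_add] at h4
    push_cast at h4
    rwa [mul_div_cancel₀ _ (by positivity)] at h4
  have hmeas : ∀ k, MeasurableSet (E k) := by
    intro k
    have e1 : E k = (⋂ i : ℕ, ⋂ (_ : i ≤ 2 ^ k), {ω | Y (i * (t / 2 ^ k)) ω ∈ Set.range e}) ∩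
        {ω | Y t ω = e y} := by
      ext ω; simp [hE]
    rw [e1]
    exact (MeasurableSet.iInter fun i => MeasurableSet.iInter fun _ =>
      hY.measurableSet_mem _ (Set.finite_range e)).inter (hY.measurableSet_eq _ _)
  have hanti : Antitone E := by
    refine antitone_nat_of_succ_le fun k ω hω => ⟨fun i hi => ?_, hω.2⟩
    have h1 := hω.1 (2 * i) (by rw [pow_succ]; omega)
    have e1 : ((2 * i : ℕ) : ℝ≥0) * (t / 2 ^ (k + 1)) = i * (t / 2 ^ k) := by
      push_cast
      rw [pow_succ]
      field_simp
    rwa [e1] at h1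
  have hlim := (ENNReal.tendsto_toReal (measure_ne_top P _)).comp
    (tendsto_measure_iInter_atTop (μ := P) (fun k => (hmeas k).nullMeasurableSet) hanti
      ⟨0, measure_ne_top P _⟩)
  refine (ge_of_tendsto' hlim hlow).trans (measureReal_mono (μ := P) ?_)
  intro ω hω
  rw [Set.mem_iInter] at hω
  exact ⟨(hω 0).2, hY.lt_exitTime ht fun k i hi => hA ((hω k).1 i hi)⟩

end IsMarkovChainFrom

/-! ### Rescaled and truncated conductances -/

/-- Along a chain inside `S` whose steps have conductance at least `δ`, the increment of a function is
controlled by its energy in `S`, independently of the length of the chain: loops can be erased. -/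
lemma sq_sub_le_of_chain {V : Type*} {c : V → V → ℝ} (hnn : ∀ a b, 0 ≤ c a b)
    (hsymm : ∀ a b, c a b = c b a) {S : Finset V} {δ : ℝ} (hδ : 0 < δ) {N : ℕ} (hN : 1 ≤ N)
    (z : ℕ → V) (hz : ∀ i, 1 ≤ i → i ≤ N → z i ∈ S)
    (hstep : ∀ i, 1 ≤ i → i < N → δ ≤ c (z i) (z (i + 1))) (f : V → ℝ) :
    (f (z N) - f (z 1)) ^ 2
      ≤ (S.card : ℝ) ^ 2 / δ * ∑ a ∈ S, ∑ b ∈ S, c a b * (f a - f b) ^ 2 := by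
  classical
  let G : SimpleGraph V :=
    { Adj := fun a b => a ≠ b ∧ a ∈ S ∧ b ∈ S ∧ δ ≤ c a b
      symm := ⟨fun a b h => ⟨h.1.symm, h.2.2.1, h.2.1, by rw [hsymm]; exact h.2.2.2⟩⟩
      loopless := ⟨fun a h => h.1 rfl⟩ }
  have hreach : ∀ i, 1 ≤ i → i ≤ N → G.Reachable (z 1) (z i) := by
    intro i hi
    induction i, hi using Nat.le_induction with
    | base => intro _; exact SimpleGraph.Reachable.refl _
    | succ i hi ih =>
      intro hiN
      refine (ih (by omega)).trans ?_
      by_cases heq : z i = z (i + 1)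
      · rw [heq]
      · exact SimpleGraph.Adj.reachable
          ⟨heq, hz i hi (by omega), hz (i + 1) (by omega) hiN, hstep i hi (by omega)⟩
  set E := ∑ a ∈ S, ∑ b ∈ S, c a b * (f a - f b) ^ 2 with hE
  have hterm : ∀ a b, 0 ≤ c a b * (f a - f b) ^ 2 := fun a b => mul_nonneg (hnn a b) (sq_nonneg _)
  have hE0 : 0 ≤ E := Finset.sum_nonneg fun a _ => Finset.sum_nonneg fun b _ => hterm a b
  have hadj : ∀ a b, G.Adj a b → |f a - f b| ≤ Real.sqrt (E / δ) := by
    rintro a b ⟨-, ha, hb, hab⟩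
    refine Real.abs_le_sqrt ?_
    rw [le_div_iff₀ hδ]
    calc (f a - f b) ^ 2 * δ ≤ c a b * (f a - f b) ^ 2 := by nlinarith [sq_nonneg (f a - f b)]
      _ ≤ ∑ b ∈ S, c a b * (f a - f b) ^ 2 :=
          Finset.single_le_sum (f := fun b => c a b * (f a - f b) ^ 2) (fun b _ => hterm a b) hb
      _ ≤ E := Finset.single_le_sum (f := fun a => ∑ b ∈ S, c a b * (f a - f b) ^ 2)
          (fun a _ => Finset.sum_nonneg fun b _ => hterm a b) ha
  have hwalk : ∀ a b (p : G.Walk a b), a ∈ S →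
      (∀ v ∈ p.support, v ∈ S) ∧ |f b - f a| ≤ p.length * Real.sqrt (E / δ) := by
    intro a b p
    induction p with
    | nil => intro ha; simp [ha]
    | cons hab p ih =>
      intro ha
      obtain ⟨h1, h2⟩ := ih hab.2.2.1
      constructor
      · intro v hv
        rw [SimpleGraph.Walk.support_cons, List.mem_cons] at hv
        rcases hv with rfl | hv
        · exact ha
        · exact h1 v hv
      · rw [SimpleGraph.Walk.length_cons]
        have h3 := hadj _ _ hab
        rw [abs_sub_comm] at h3
        push_cast
        refine (abs_sub_le _ _ _).trans (le_trans (add_le_add h2 h3) (le_of_eq ?_))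
        ring
  obtain ⟨p, hp⟩ := (hreach N hN le_rfl).exists_isPath
  obtain ⟨h1, h2⟩ := hwalk _ _ p (hz 1 le_rfl hN)
  have hlen : p.length ≤ S.card := by
    have h3 : p.support.toFinset ⊆ S := fun v hv => h1 v (List.mem_toFinset.1 hv)
    have h4 := Finset.card_le_card h3
    rw [List.toFinset_card_of_nodup hp.support_nodup, SimpleGraph.Walk.length_support] at h4
    omega
  have hlen' : (p.length : ℝ) ≤ S.card := by exact_mod_cast hlen
  calc (f (z N) - f (z 1)) ^ 2 = |f (z N) - f (z 1)| ^ 2 := (sq_abs _).symm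
    _ ≤ (S.card * Real.sqrt (E / δ)) ^ 2 := by
        refine pow_le_pow_left₀ (abs_nonneg _) (h2.trans ?_) 2
        exact mul_le_mul_of_nonneg_right hlen' (Real.sqrt_nonneg _)
    _ = (S.card : ℝ) ^ 2 / δ * E := by
        rw [mul_pow, Real.sq_sqrt (by positivity)]; ring

lemma dist_latticePoint_le {d n : ℕ} (k l : Fin d → ℤ) :
    dist (latticePoint n k) (latticePoint n l) ≤ d * (‖k - l‖ / n) := by
  have h1 : ∀ i : Fin d, dist ((latticePoint n k : EuclideanSpace ℝ (Fin d)) i)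
      ((latticePoint n l : EuclideanSpace ℝ (Fin d)) i) ≤ ‖k - l‖ / n := by
    intro i
    have e : dist ((latticePoint n k : EuclideanSpace ℝ (Fin d)) i)
        ((latticePoint n l : EuclideanSpace ℝ (Fin d)) i) = ‖(k - l) i‖ / n := by
      rw [Real.dist_eq, Pi.sub_apply, Int.norm_eq_abs, Int.cast_sub]
      simp only [latticePoint]
      rw [← sub_div, abs_div, Nat.abs_cast]
    rw [e]
    exact div_le_div_of_nonneg_right (norm_le_pi_norm (k - l) i) (Nat.cast_nonneg n)
  rw [Subtype.dist_eq, EuclideanSpace.dist_eq]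
  refine Real.sqrt_le_iff.2 ⟨by positivity, ?_⟩
  calc ∑ i, dist ((latticePoint n k : EuclideanSpace ℝ (Fin d)) i)
        ((latticePoint n l : EuclideanSpace ℝ (Fin d)) i) ^ 2
      ≤ ∑ _i : Fin d, (‖k - l‖ / n) ^ 2 :=
        Finset.sum_le_sum fun i _ => pow_le_pow_left₀ dist_nonneg (h1 i) 2
    _ = d * (‖k - l‖ / n) ^ 2 := by simp
    _ ≤ d ^ 2 * (‖k - l‖ / n) ^ 2 := by
        refine mul_le_mul_of_nonneg_right ?_ (sq_nonneg _)
        exact_mod_cast Nat.le_self_pow (by norm_num) d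
    _ = _ := by ring

/-- The conductances on `ℤ^d` obtained by rescaling, without the jumps of range more than `ρ`. -/
noncomputable def truncatedConductance {d n : ℕ} (C : ScaledLattice d n → ScaledLattice d n → ℝ)
    (ρ : ℕ) (z w : Fin d → ℤ) : ℝ :=
  if ‖z - w‖ ≤ ρ then C (latticePoint n z) (latticePoint n w) else 0

section Truncation

variable {d n : ℕ} {C : ScaledLattice d n → ScaledLattice d n → ℝ} {m₀ ℓ : ℕ} {δ M : ℝ}

/-- The assumptions on the rescaled conductances at the diffusive scale `ℓ ≤ 2 n`: the truncated second
moment bounds the second moment, since the jumps of lattice range at most `2 m₀ ℓ ≤ 4 m₀ n` have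
bounded length, and the paths that join neighbours survive the truncation. -/
lemma isLatticeConductance_truncated (hn : 1 ≤ n) (hnn : ∀ x y, 0 ≤ C x y)
    (hsymm : ∀ x y, C x y = C y x) (hδ : 0 < δ) (hm₀ : 1 ≤ m₀) (hℓ : 1 ≤ ℓ) (hℓn : ℓ ≤ 2 * n)
    (hpath : ∀ x y : ScaledLattice d n, dist x y = 1 / (n : ℝ) →
      ∃ (N : ℕ) (z : ℕ → ScaledLattice d n), 2 ≤ N ∧ z 1 = x ∧ z N = y ∧
        (∀ i, 1 ≤ i → i ≤ N → dist x (z i) < m₀ / (n : ℝ)) ∧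
        (∀ i, 1 ≤ i → i < N → δ ≤ C (z i) (z (i + 1))))
    (hM : ∀ x : ScaledLattice d n, Summable (fun y => min 1 (dist x y ^ 2) * C x y) ∧
      (n : ℝ) ^ 2 * ∑' y, min 1 (dist x y ^ 2) * C x y ≤ M) :
    IsLatticeConductance (truncatedConductance C (2 * m₀ * ℓ)) m₀ (2 * m₀ * ℓ)
      (((2 * m₀ + 1 : ℝ) ^ d) ^ 2 / δ) (16 * m₀ ^ 2 * M) := by
  have hn0 : (0 : ℝ) < n := by exact_mod_cast hn
  have hm₀r : (1 : ℝ) ≤ m₀ := by exact_mod_cast hm₀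
  have hℓnr : (ℓ : ℝ) ≤ 2 * n := by exact_mod_cast hℓn
  have htnn : ∀ z w, 0 ≤ truncatedConductance C (2 * m₀ * ℓ) z w := fun z w => by
    rw [truncatedConductance]
    split_ifs
    · exact hnn _ _
    · exact le_rfl
  have htsymm : ∀ z w, truncatedConductance C (2 * m₀ * ℓ) z w
      = truncatedConductance C (2 * m₀ * ℓ) w z := fun z w => by
    rw [truncatedConductance, truncatedConductance, norm_sub_rev, hsymm]
  refine ⟨htnn, htsymm, fun z w h => if_neg (not_le.2 h), ?_, ?_⟩
  · intro z S
    obtain ⟨hs, hle⟩ := hM (latticePoint n z)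
    have hpt : ∀ w, ‖z - w‖ ^ 2 * truncatedConductance C (2 * m₀ * ℓ) z w
        ≤ 16 * m₀ ^ 2 * (n : ℝ) ^ 2 *
          (min 1 (dist (latticePoint n z) (latticePoint n w) ^ 2)
            * C (latticePoint n z) (latticePoint n w)) := by
      intro w
      have hC := hnn (latticePoint n z) (latticePoint n w)
      rw [truncatedConductance]
      split_ifs with h
      · rw [← mul_assoc]
        refine mul_le_mul_of_nonneg_right ?_ hC
        have h1 : (1 : ℝ) ≤ m₀ ^ 2 := one_le_pow₀ hm₀r
        rw [mul_min_of_nonneg _ _ (by positivity)]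
        refine le_min ?_ ?_
        · calc ‖z - w‖ ^ 2 ≤ (4 * m₀ * n) ^ 2 := by
                refine pow_le_pow_left₀ (norm_nonneg _) (h.trans ?_) 2
                push_cast
                nlinarith
            _ = _ := by ring
        · calc ‖z - w‖ ^ 2 ≤ (n * dist (latticePoint n z) (latticePoint n w)) ^ 2 :=
                pow_le_pow_left₀ (norm_nonneg _) (norm_sub_le_mul_dist hn z w) 2
            _ = 1 * ((n : ℝ) ^ 2 * dist (latticePoint n z) (latticePoint n w) ^ 2) := by ring
            _ ≤ 16 * m₀ ^ 2 * ((n : ℝ) ^ 2 * dist (latticePoint n z) (latticePoint n w) ^ 2) := by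
                refine mul_le_mul_of_nonneg_right ?_ (by positivity)
                linarith
            _ = _ := by ring
      · rw [mul_zero]; positivity
    calc ∑ w ∈ S, ‖z - w‖ ^ 2 * truncatedConductance C (2 * m₀ * ℓ) z w
        ≤ ∑ w ∈ S, 16 * m₀ ^ 2 * (n : ℝ) ^ 2 *
          (min 1 (dist (latticePoint n z) (latticePoint n w) ^ 2)
            * C (latticePoint n z) (latticePoint n w)) := Finset.sum_le_sum fun w _ => hpt w
      _ = 16 * m₀ ^ 2 * (n : ℝ) ^ 2 * ∑ y ∈ S.map ⟨latticePoint n, latticePoint_injective hn⟩,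
          min 1 (dist (latticePoint n z) y ^ 2) * C (latticePoint n z) y := by
          rw [← Finset.mul_sum, Finset.sum_map]; rfl
      _ ≤ 16 * m₀ ^ 2 * (n : ℝ) ^ 2 *
          ∑' y, min 1 (dist (latticePoint n z) y ^ 2) * C (latticePoint n z) y := by
          refine mul_le_mul_of_nonneg_left ?_ (by positivity)
          exact hs.sum_le_tsum _ fun y _ => mul_nonneg (by positivity) (hnn _ _)
      _ = 16 * m₀ ^ 2 * ((n : ℝ) ^ 2 *
          ∑' y, min 1 (dist (latticePoint n z) y ^ 2) * C (latticePoint n z) y) := by ring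
      _ ≤ _ := mul_le_mul_of_nonneg_left hle (by positivity)
  · intro z i f
    obtain ⟨N, p, hN, hp1, hpN, hball, hcond⟩ := hpath _ _ (dist_latticePoint_neighbour (n := n) z i)
    choose q hq using fun j => latticePoint_surjective d n (p j)
    have hq1 : q 1 = z := latticePoint_injective hn (by rw [hq, hp1])
    have hqN : q N = z + Pi.single i 1 := latticePoint_injective hn (by rw [hq, hpN])
    have hqball : ∀ j, 1 ≤ j → j ≤ N → q j ∈ latticeBox z m₀ := by
      intro j h1 h2
      rw [mem_latticeBox_iff_norm, norm_sub_rev]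
      refine (norm_sub_le_mul_dist hn z (q j)).trans ?_
      have := hball j h1 h2
      rw [lt_div_iff₀ hn0] at this
      rw [hq]
      linarith
    have h := sq_sub_le_of_chain htnn htsymm hδ (by omega : 1 ≤ N) q hqball (fun j h1 h2 => by
      have ha := mem_latticeBox_iff_norm.1 (hqball j h1 (by omega))
      have hb := mem_latticeBox_iff_norm.1 (hqball (j + 1) (by omega) (by omega))
      rw [truncatedConductance, if_pos, hq, hq]
      · exact hcond j h1 h2
      · have e : q j - q (j + 1) = (q j - z) - (q (j + 1) - z) := by abel
        rw [e]
        refine (norm_sub_le _ _).trans ((add_le_add ha hb).trans ?_)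
        have hℓr : (1 : ℝ) ≤ ℓ := by exact_mod_cast hℓ
        push_cast
        nlinarith) f
    rw [hq1, hqN, card_latticeBox] at h
    push_cast at h
    exact h

/-- The jumps of lattice range more than `ρ` occur at rate at most `M / t` if `n √t ≤ ρ`. -/
lemma total_le_truncated_add (hn : 1 ≤ n) (hnn : ∀ x y, 0 ≤ C x y) (hs : ∀ x, Summable (C x))
    (hM : ∀ x : ScaledLattice d n, Summable (fun y => min 1 (dist x y ^ 2) * C x y) ∧
      (n : ℝ) ^ 2 * ∑' y, min 1 (dist x y ^ 2) * C x y ≤ M) {t : ℝ} (ht0 : 0 < t) (ht1 : t ≤ 1)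
    {ρ : ℕ} (hρ : n * Real.sqrt t ≤ ρ) {z : Fin d → ℤ} {D : Finset (Fin d → ℤ)}
    (hD : latticeBox z ρ ⊆ D) :
    (n : ℝ) ^ 2 * ∑' y, C (latticePoint n z) y
      ≤ (n : ℝ) ^ 2 * ∑ w ∈ D, truncatedConductance C ρ z w + M / t := by
  classical
  have hn0 : (0 : ℝ) < n := by exact_mod_cast hn
  obtain ⟨hsum, hle⟩ := hM (latticePoint n z)
  set F := (latticeBox z ρ).map ⟨latticePoint n, latticePoint_injective hn⟩ with hF
  have hsF : Summable fun y => if y ∈ F then C (latticePoint n z) y else 0 :=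
    summable_of_ne_finset_zero (s := F) fun y hy => if_neg hy
  have hpt : ∀ y, C (latticePoint n z) y ≤ (if y ∈ F then C (latticePoint n z) y else 0)
      + t⁻¹ * (min 1 (dist (latticePoint n z) y ^ 2) * C (latticePoint n z) y) := by
    intro y
    have hC := hnn (latticePoint n z) y
    split_ifs with hy
    · have : 0 ≤ t⁻¹ * (min 1 (dist (latticePoint n z) y ^ 2) * C (latticePoint n z) y) := by
        positivity
      linarith
    · obtain ⟨w, rfl⟩ := latticePoint_surjective d n y
      have hw : (ρ : ℝ) < ‖z - w‖ := by
        by_contra hcon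
        refine hy (Finset.mem_map.2 ⟨w, ?_, rfl⟩)
        rw [mem_latticeBox_iff_norm, norm_sub_rev]
        exact not_lt.1 hcon
      have h1 : Real.sqrt t ≤ dist (latticePoint n z) (latticePoint n w) := by
        have := norm_sub_le_mul_dist hn z w
        exact le_of_mul_le_mul_left (by linarith) hn0
      have h2 : t ≤ dist (latticePoint n z) (latticePoint n w) ^ 2 := by
        calc t = Real.sqrt t ^ 2 := (Real.sq_sqrt ht0.le).symm
          _ ≤ _ := pow_le_pow_left₀ (Real.sqrt_nonneg _) h1 2
      rw [zero_add, inv_mul_eq_div, le_div_iff₀ ht0, mul_comm]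
      exact mul_le_mul_of_nonneg_right (le_min ht1 h2) hC
  have h1 : ∑' y, C (latticePoint n z) y ≤ ∑ w ∈ D, truncatedConductance C ρ z w
      + t⁻¹ * ∑' y, min 1 (dist (latticePoint n z) y ^ 2) * C (latticePoint n z) y := by
    refine ((hs _).tsum_le_tsum hpt (hsF.add (hsum.mul_left _))).trans ?_
    rw [hsF.tsum_add (hsum.mul_left _), tsum_mul_left]
    refine add_le_add ?_ le_rfl
    rw [tsum_eq_sum (s := F) fun y hy => if_neg hy, hF, Finset.sum_map]
    refine le_trans (Finset.sum_le_sum fun w hw => ?_)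
      (Finset.sum_le_sum_of_subset_of_nonneg hD fun w _ _ => ?_)
    · rw [if_pos (Finset.mem_map_of_mem _ hw), truncatedConductance,
        if_pos (by rw [norm_sub_rev]; exact mem_latticeBox_iff_norm.1 hw)]
      rfl
    · rw [truncatedConductance]
      split_ifs
      · exact hnn _ _
      · exact le_rfl
  have h2 := mul_le_mul_of_nonneg_left h1 (show 0 ≤ (n : ℝ) ^ 2 by positivity)
  refine h2.trans ?_
  rw [mul_add]
  refine add_le_add le_rfl ?_
  rw [le_div_iff₀ ht0]
  calc _ = (n : ℝ) ^ 2 * ∑' y, min 1 (dist (latticePoint n z) y ^ 2) * C (latticePoint n z) y := by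
        field_simp
    _ ≤ M := hle

end Truncation

/-! ### The near-diagonal lower bound -/

theorem proposition4p2 (d : ℕ) (hd : 1 ≤ d)
    (C : ∀ n : ℕ, ScaledLattice d n → ScaledLattice d n → ℝ)
    (hC : IsConductanceFamily C)
    (hA1 : TotalConductanceBounded C)
    (hA2 : NeighboursConnected C)
    (hA3 : DominatedByProfile C)
    (hM : TruncatedSecondMomentBounded C) :
    ∃ c₁ θ : ℝ, 0 < c₁ ∧ 0 < θ ∧ θ < 1 ∧
      ∀ (n : ℕ), 1 ≤ n → ∀ (x y x₀ : ScaledLattice d n) (t : ℝ≥0) (r : ℝ),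
        1 / (n : ℝ) < (t : ℝ) → (t : ℝ) ≤ 1 →
        dist x x₀ ≤ Real.sqrt t → dist y x₀ ≤ Real.sqrt t →
        Real.sqrt t / θ ≤ r →
        ∀ (Ω : Type*) [MeasurableSpace Ω] (P : Measure Ω) (Y : ℝ≥0 → Ω → ScaledLattice d n),
          IsMarkovChainFrom (C n) x P Y →
            c₁ * (t : ℝ) ^ (-(d : ℝ) / 2) * (n : ℝ) ^ (-(d : ℝ)) ≤
              P.real {ω | Y t ω = y ∧ (t : ℝ≥0∞) < exitTime Y (Metric.ball x₀ r) ω} := by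
  obtain ⟨_, ν, _, _, hν⟩ := hA1
  obtain ⟨M₀, δ, hM₀, hδ, hpath⟩ := hA2
  obtain ⟨M', hM'⟩ := hM
  set m₀ := ⌈M₀⌉₊ with hm₀def
  have hm₀ : 1 ≤ m₀ := Nat.one_le_ceil_iff.2 (by linarith)
  have hM₀m : M₀ ≤ m₀ := Nat.le_ceil _
  have hm₀r : (1 : ℝ) ≤ m₀ := by exact_mod_cast hm₀
  set M : ℝ := max M' 1 with hMdef
  have hM0 : 0 < M := lt_of_lt_of_le one_pos (le_max_right _ _)
  have hMle : ∀ n : ℕ, 1 ≤ n → ∀ x : ScaledLattice d n,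
      Summable (fun y => min 1 (dist x y ^ 2) * C n x y) ∧
      (n : ℝ) ^ 2 * ∑' y, min 1 (dist x y ^ 2) * C n x y ≤ M := fun n hn x =>
    ⟨(hM' n hn x).1, (hM' n hn x).2.trans (le_max_left _ _)⟩
  have hd0 : (1 : ℝ) ≤ d := by exact_mod_cast hd
  obtain ⟨κ, c₁, hκ, hc₁, hker⟩ := exists_killed_heat_kernel_ge hd hm₀
    (K₀ := ((2 * m₀ + 1 : ℝ) ^ d) ^ 2 / δ) (M := 16 * m₀ ^ 2 * M) (by positivity) (by positivity)
  have hκr : (1 : ℝ) ≤ κ := by exact_mod_cast hκ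
  have hκd : (1 : ℝ) ≤ κ * d := by nlinarith
  refine ⟨Real.exp (-M) * c₁ / 2 ^ d, 1 / (4 * (κ * d) + 1), by positivity, by positivity, ?_, ?_⟩
  · rw [div_lt_one (by positivity)]; linarith
  intro n hn x y x₀ t r htn ht1 hx hy hr Ω _ P Y hY
  have hn0 : (0 : ℝ) < n := by exact_mod_cast hn
  have hn1 : (1 : ℝ) ≤ n := by exact_mod_cast hn
  have ht0 : (0 : ℝ) < t := lt_trans (by positivity) htn
  have hst0 : 0 < Real.sqrt t := Real.sqrt_pos.2 ht0
  have hst : Real.sqrt t ^ 2 = t := Real.sq_sqrt ht0.le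
  -- the diffusive length scale in lattice units
  have hnt1 : 1 ≤ n * Real.sqrt t := by
    rw [div_lt_iff₀ hn0] at htn
    have h1 : (1 : ℝ) ≤ (n * Real.sqrt t) ^ 2 := by
      rw [mul_pow, hst]; nlinarith
    exact (one_le_sq_iff₀ (by positivity)).1 h1
  set ℓ := ⌈n * Real.sqrt t⌉₊ with hℓdef
  have hℓ1 : n * Real.sqrt t ≤ ℓ := Nat.le_ceil _
  have hℓ2 : (ℓ : ℝ) ≤ 2 * (n * Real.sqrt t) := by
    have := Nat.ceil_lt_add_one (show 0 ≤ n * Real.sqrt t by positivity)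
    linarith
  have hℓ : 1 ≤ ℓ := Nat.one_le_ceil_iff.2 (by linarith)
  have hℓ0 : (0 : ℝ) < ℓ := by exact_mod_cast hℓ
  have hst1 : Real.sqrt t ≤ 1 := Real.sqrt_le_one.2 ht1
  have hℓn : ℓ ≤ 2 * n := by
    have : (ℓ : ℝ) ≤ 2 * n := by nlinarith
    exact_mod_cast this
  have hnt2 : (n * Real.sqrt t) ^ 2 = (n : ℝ) ^ 2 * t := by rw [mul_pow, hst]
  obtain ⟨kx, rfl⟩ := latticePoint_surjective d n x
  obtain ⟨ky, rfl⟩ := latticePoint_surjective d n y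
  obtain ⟨k₀, rfl⟩ := latticePoint_surjective d n x₀
  have hbox : ∀ k : Fin d → ℤ, dist (latticePoint n k) (latticePoint n k₀) ≤ Real.sqrt t →
      k ∈ latticeBox k₀ ℓ := by
    intro k hk
    rw [mem_latticeBox_iff_norm]
    refine (norm_sub_le_mul_dist hn k k₀).trans (le_trans ?_ hℓ1)
    exact mul_le_mul_of_nonneg_left hk hn0.le
  have hsub : latticeBox k₀ ℓ ⊆ latticeBox k₀ (2 * κ * ℓ) := latticeBox_mono k₀ (by nlinarith)
  set A := latticeBox k₀ (2 * κ * ℓ) with hA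
  set D := latticeBox k₀ (2 * κ * ℓ + 2 * m₀ * ℓ) with hD
  set c := truncatedConductance (C n) (2 * m₀ * ℓ) with hc
  have hnn := hC.nonneg n hn
  have hs := fun x => (hν n hn x).1
  have hcond : IsLatticeConductance c m₀ (2 * m₀ * ℓ) (((2 * m₀ + 1 : ℝ) ^ d) ^ 2 / δ)
      (16 * m₀ ^ 2 * M) := by
    refine isLatticeConductance_truncated hn hnn (hC.symm n hn) hδ hm₀ hℓ hℓn ?_ (hMle n hn)
    intro x y hxy
    obtain ⟨N, z, h1, h2, h3, h4, h5⟩ := hpath n hn x y hxy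
    exact ⟨N, z, h1, h2, h3, fun i hi1 hi2 => (h4 i hi1 hi2).trans_le (by gcongr), h5⟩
  set K := killedGenerator c A D with hK
  -- truncation removes jumps at rate at most `M / t`, whence the factor `exp (-(M / t) s)`
  set Q : ℝ≥0 → Matrix A A ℝ := fun s =>
    Real.exp (-(M / t * s)) • NormedSpace.exp (((n : ℝ) ^ 2 * s) • K) with hQ
  have hQle : ∀ s i j, Q s i j ≤ transitionProb (C n) s (latticePoint n (i : Fin d → ℤ))
      (latticePoint n (j : Fin d → ℤ)) := by
    intro s i j
    refine exp_killedGenerator_le_transitionProb hn hnn hs (fun x => (hν n hn x).2.2) hcond.nonneg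
      (fun z w => ?_) (fun z hz => ?_) s.2 i j
    · rw [hc, truncatedConductance]
      split_ifs
      · exact le_rfl
      · exact hnn _ _
    · refine total_le_truncated_add hn hnn hs (hMle n hn) ht0 ht1 (hℓ1.trans ?_)
        fun w hw => mem_latticeBox_trans hz hw le_rfl
      push_cast
      nlinarith
  have hQ0 : ∀ s i j, 0 ≤ Q s i j := fun s i j =>
    mul_nonneg (Real.exp_pos _).le
      (exp_killedGenerator_nonneg hcond.nonneg (by positivity) i j)
  have hpow : ∀ m : ℕ, 0 < m → Q (t / m) ^ m = Q t := by
    intro m hm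
    have hm0 : (m : ℝ) ≠ 0 := by exact_mod_cast hm.ne'
    simp only [hQ]
    rw [smul_pow, matrix_exp_smul_pow, ← Real.exp_nat_mul]
    push_cast
    congr 2
    · field_simp
    · congr 1; field_simp
  have hball : Set.range (fun i : A => latticePoint n (i : Fin d → ℤ))
      ⊆ Metric.ball (latticePoint n k₀) r := by
    rintro _ ⟨i, rfl⟩
    rw [Metric.mem_ball]
    have h1 := mem_latticeBox_iff_norm.1 i.2
    push_cast at h1
    rw [div_div_eq_mul_div, div_one] at hr
    calc dist (latticePoint n (i : Fin d → ℤ)) (latticePoint n k₀)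
        ≤ d * (‖(i : Fin d → ℤ) - k₀‖ / n) := dist_latticePoint_le _ _
      _ ≤ d * (2 * κ * (2 * (n * Real.sqrt t)) / n) := by
          gcongr
          exact h1.trans (mul_le_mul_of_nonneg_left hℓ2 (by positivity))
      _ = Real.sqrt t * (4 * (κ * d)) := by field_simp; ring
      _ < Real.sqrt t * (4 * (κ * d) + 1) := by gcongr; linarith
      _ ≤ r := hr
  have hkx := hbox kx hx
  have hky := hbox ky hy
  have hmain := hY.le_measureReal_exitTime
    (e := fun i : A => latticePoint n (i : Fin d → ℤ))
    (fun i j h => Subtype.ext (latticePoint_injective hn h)) (t := t) (by exact_mod_cast ht0)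
    Q hQ0 hQle hpow (a := ⟨kx, hsub hkx⟩) (y := ⟨ky, hsub hky⟩) rfl hball
  refine le_trans ?_ hmain
  -- the kernel estimate is used with `T = n² t / 2`, which is of order `ℓ²`
  have hT := hker c ℓ k₀ ⟨kx, hsub hkx⟩ ⟨ky, hsub hky⟩ ((n : ℝ) ^ 2 * t / 2) hcond hℓ hkx hky
    (by
      have : (ℓ : ℝ) ^ 2 ≤ (2 * (n * Real.sqrt t)) ^ 2 := pow_le_pow_left₀ hℓ0.le hℓ2 2
      rw [mul_pow, hnt2] at this
      linarith)
    (by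
      have : (n * Real.sqrt t) ^ 2 ≤ (ℓ : ℝ) ^ 2 := pow_le_pow_left₀ (by positivity) hℓ1 2
      rw [hnt2] at this
      have h0 : 0 ≤ (n : ℝ) ^ 2 * t := by positivity
      linarith)
  rw [add_halves] at hT
  have hexp : M / (t : ℝ) * t = M := div_mul_cancel₀ _ ht0.ne'
  calc Real.exp (-M) * c₁ / 2 ^ d * (t : ℝ) ^ (-(d : ℝ) / 2) * (n : ℝ) ^ (-(d : ℝ))
      = Real.exp (-M) * (c₁ / (2 * (n * Real.sqrt t)) ^ d) := by
        have e1 : (t : ℝ) ^ (-(d : ℝ) / 2) = (Real.sqrt t ^ d)⁻¹ := by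
          rw [Real.sqrt_eq_rpow, ← Real.rpow_natCast, ← Real.rpow_mul ht0.le,
            ← Real.rpow_neg ht0.le]
          congr 1; ring
        rw [e1, Real.rpow_neg hn0.le, Real.rpow_natCast, mul_pow, mul_pow]
        field_simp
    _ ≤ Real.exp (-M) * (c₁ / (ℓ : ℝ) ^ d) := by gcongr
    _ ≤ Real.exp (-M) * (NormedSpace.exp (((n : ℝ) ^ 2 * t) • K)) ⟨kx, hsub hkx⟩ ⟨ky, hsub hky⟩ :=
        mul_le_mul_of_nonneg_left hT (Real.exp_pos _).le
    _ = Q t ⟨kx, hsub hkx⟩ ⟨ky, hsub hky⟩ := by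
        simp only [hQ]
        rw [Matrix.smul_apply, smul_eq_mul, hexp]
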